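/- **Conventions.** Let $\mathbb{k}$ be a field. Permutations are composed from right to left. A *quasi-diagram* of size $n$ is an $\alpha\in\mathfrak S_n$ with $\alpha^2=\mathrm{id}$; its fixed points are its *isolated points*. A *chord diagram* is a quasi-diagram without isolated points. With $\zeta=\zeta_n=(1\,2\cdots n)$, the *faces* of $\alpha$ are the orbits of $\zeta\alpha$ on $\{1,\dots,n\}$. The quasi-diagram $\alpha$ is *maximal* if it has exactly one face; it is *regular* if every orbit of $\zeta\alpha$ contains $1$ or an isolated point of $\alpha$. For $l\in\mathbb Z$ the $l$-th *rotation* of $\alpha$ is $\zeta^l\alpha\zeta^{-l}$; $\alpha$ is *rotatably regular* if all its rotations are regular. The *gentle algebra associated to* a quasi-diagram $\alpha$ of size $n$ is $A_\alpha=\mathbb{k}Q/I$, where the vertices of $Q$ are the orbits of $\alpha$ on $\{1,\dots,n\}$, where $Q$ has one arrow $a_i$ from the orbit of $i$ to the orbit of $i+1$ for each $1\le i\le n-1$, and where $I$ is generated by the paths $a_ia_j$ of length two (composed from left to right) with $j\ne i+1$. A *gentle algebra* is a finite-dimensional algebra isomorphic to $\mathbb{k}Q/I$ with $Q$ a finite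 quiver with at most two arrows starting and at most two arrows ending at each vertex, $I$ generated by paths of length two, and such that for each arrow $a$ there is at most one arrow $b$ for which $ab$ is a path in $I$, at most one $b$ for which $ab$ is a path not in $I$, at most one $c$ for which $ca$ is a path in $I$, and at most one $c$ for which $ca$ is a path not in $I$. A *maximal path* is a path $p$ (possibly trivial) with $p\neq0$ in $\mathbb{k}Q/I$ and $pa=0=ap$ there for every arrow $a$. If $\mathbb{k}Q/I$ is gentle with exactly one maximal path, with vertices $v_1,\dots,v_n$ in order, its *associated quasi-diagram* is the permutation $\beta$ of $\{1,\dots,n\}$ such that $v_i=v_j$ if and only if $j\in\{i,\beta(i)\}$. For $A=\mathbb{k}Q/I$ as above, let $A_0=A/A_{\ge1}$ be the right $A$-module obtained by dividing by the ideal generated by the arrows. The *Koszul dual* of $A$ is the Yoneda algebra $A^!=\bigoplus_{i\ge0}\operatorname{Ext}^i_A(A_0,A_0)$. The *Koszul dual $\alpha^!$ exists* if $(A_\alpha)^!$ is isomorphic to a gentle algebra with exactly one maximal path; $\alpha^!$ is then the quasi-diagram associated to it. Finally, $\operatorname{gldim}A$ is the supremum of the projective dimensions of all right $A$-modules. **Proposition.**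 Let $m\geq 1$, let $\alpha\in\mathfrak S_{2m}$ be a chord diagram, and let $A=A_\alpha$ be its associated gentle algebra. Then the following are equivalent: 1. $\alpha$ is maximal; 2. $\alpha$ is regular; 3. $\alpha$ is rotatably regular; 4. the $l$-th rotation of $\alpha$ is maximal for every integer $l$; 5. the Koszul dual $\alpha^!$ exists; 6. $\alpha=\beta^!$ for some maximal chord diagram $\beta\in\mathfrak S_{2m}$ (whose Koszul dual exists); 7. $\operatorname{gldim}A=2m-1$. Moreover, if $\alpha$ is maximal, then $m$ is even. -/

import Mathlib

open CategoryTheory CategoryTheory.Abelian DirectSum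

noncomputable section

universe u v w

/-! ### Quasi-diagrams

The points `1, …, n` are the elements `0, …, n - 1` of `Fin n`, and the cycle `(1 2 ⋯ n)` is
`finRotate n`.  Products of permutations are composed from right to left. -/

namespace QuasiDiagram

variable {n : ℕ}

/-- A quasi-diagram is an involution (the identity is allowed). -/
def IsQuasiDiagram (α : Equiv.Perm (Fin n)) : Prop := α * α = 1

/-- An isolated point is a fixed point. -/
def IsIsolated (α : Equiv.Perm (Fin n)) (i : Fin n) : Prop := α i = i

/-- A chord diagram is a quasi-diagram without isolated points. -/
def IsChordDiagram (α : Equiv.Perm (Fin n)) : Prop :=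
  IsQuasiDiagram α ∧ ∀ i, ¬ IsIsolated α i

/-- The faces of `α` are the orbits (one-point orbits included) of `ζ α`, `ζ = (1 2 ⋯ n)`. -/
def Face (α : Equiv.Perm (Fin n)) : Type :=
  Quotient (Equiv.Perm.SameCycle.setoid (finRotate n * α))

/-- `α` is maximal if it has exactly one face. -/
def IsMaximal (α : Equiv.Perm (Fin n)) : Prop := Nat.card (Face α) = 1

/-- `α` is regular if every orbit of `ζ α` contains the first point or an isolated point. -/
def IsRegular (α : Equiv.Perm (Fin n)) : Prop :=
  ∀ i : Fin n, ∃ j : Fin n,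
    (finRotate n * α).SameCycle i j ∧ (j.val = 0 ∨ IsIsolated α j)

/-- The `l`-th rotation `ζ ^ l α ζ ^ (-l)`. -/
def rotation (l : ℤ) (α : Equiv.Perm (Fin n)) : Equiv.Perm (Fin n) :=
  finRotate n ^ l * α * finRotate n ^ (-l)

/-- `α` is rotatably regular if all its rotations are regular. -/
def IsRotatablyRegular (α : Equiv.Perm (Fin n)) : Prop :=
  ∀ l : ℤ, IsRegular (rotation l α)

end QuasiDiagram

/-! ### Bound quivers with quadratic monomial relations and their algebras -/

/-- A finite quiver (vertices `V`, arrows `E`, source, target) with a set `rel` of paths `a b`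
of length two; paths are composed from left to right. -/
structure BoundQuiver where
  V : Type
  E : Type
  [fintypeV : Fintype V]
  [finiteE : Finite E]
  src : E → V
  tgt : E → V
  rel : E → E → Prop
  rel_composable : ∀ a b, rel a b → tgt a = src b

attribute [instance] BoundQuiver.fintypeV BoundQuiver.finiteE

namespace BoundQuiver

/-- The defining relations of `k Q / I` on the generators `e_v` (trivial paths) and `a` (arrows):
the `e_v` are orthogonal idempotents with sum `1`, `e_{s(a)} a = a = a e_{t(a)}`, which presents
the path algebra `k Q`, and `a b = 0` for the paths `a b` generating `I`. -/
inductive Rel (k : Type u) [Field k] (Q : BoundQuiver) :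
    FreeAlgebra k (Q.V ⊕ Q.E) → FreeAlgebra k (Q.V ⊕ Q.E) → Prop
  | idem (v : Q.V) :
      Rel k Q (FreeAlgebra.ι k (Sum.inl v) * FreeAlgebra.ι k (Sum.inl v))
        (FreeAlgebra.ι k (Sum.inl v))
  | orth (v w : Q.V) (h : v ≠ w) :
      Rel k Q (FreeAlgebra.ι k (Sum.inl v) * FreeAlgebra.ι k (Sum.inl w)) 0
  | complete : Rel k Q (∑ v : Q.V, FreeAlgebra.ι k (Sum.inl v)) 1
  | source (a : Q.E) :
      Rel k Q (FreeAlgebra.ι k (Sum.inl (Q.src a)) * FreeAlgebra.ι k (Sum.inr a))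
        (FreeAlgebra.ι k (Sum.inr a))
  | target (a : Q.E) :
      Rel k Q (FreeAlgebra.ι k (Sum.inr a) * FreeAlgebra.ι k (Sum.inl (Q.tgt a)))
        (FreeAlgebra.ι k (Sum.inr a))
  | zero (a b : Q.E) (h : Q.rel a b) :
      Rel k Q (FreeAlgebra.ι k (Sum.inr a) * FreeAlgebra.ι k (Sum.inr b)) 0

/-- The algebra `k Q / I` of a bound quiver. -/
def Alg (k : Type u) [Field k] (Q : BoundQuiver) : Type u := RingQuot (Rel k Q)

instance (k : Type u) [Field k] (Q : BoundQuiver) : Ring (Q.Alg k) :=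
  inferInstanceAs (Ring (RingQuot (Rel k Q)))

instance (k : Type u) [Field k] (Q : BoundQuiver) : Algebra k (Q.Alg k) :=
  inferInstanceAs (Algebra k (RingQuot (Rel k Q)))

/-- The class of the trivial path at `v`. -/
def idempotent (k : Type u) [Field k] (Q : BoundQuiver) (v : Q.V) : Q.Alg k :=
  RingQuot.mkAlgHom k (Rel k Q) (FreeAlgebra.ι k (Sum.inl v))

/-- The class of the arrow `a`. -/
def arrow (k : Type u) [Field k] (Q : BoundQuiver) (a : Q.E) : Q.Alg k :=
  RingQuot.mkAlgHom k (Rel k Q) (FreeAlgebra.ι k (Sum.inr a))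

/-- A path of length `l`: its `l + 1` vertices and its `l` arrows. -/
structure Path (Q : BoundQuiver) (l : ℕ) where
  vertex : Fin (l + 1) → Q.V
  edge : Fin l → Q.E
  src_edge : ∀ i, Q.src (edge i) = vertex i.castSucc
  tgt_edge : ∀ i, Q.tgt (edge i) = vertex i.succ

/-- The class in `k Q / I` of a path. -/
def Path.toAlg (k : Type u) [Field k] {Q : BoundQuiver} {l : ℕ} (p : Q.Path l) : Q.Alg k :=
  Q.idempotent k (p.vertex 0) * (List.ofFn fun i => Q.arrow k (p.edge i)).prod

/-- A maximal path of `k Q / I`: a nonzero path `p` with `p a = 0 = a p` for all arrows `a`. -/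
def Path.IsMaximal (k : Type u) [Field k] {Q : BoundQuiver} {l : ℕ} (p : Q.Path l) : Prop :=
  p.toAlg k ≠ 0 ∧ ∀ a : Q.E, p.toAlg k * Q.arrow k a = 0 ∧ Q.arrow k a * p.toAlg k = 0

/-- `k Q / I` is gentle: the combinatorial conditions on `(Q, I)` together with finite
dimension. -/
structure IsGentle (k : Type u) [Field k] (Q : BoundQuiver) : Prop where
  out_le : ∀ v : Q.V, {a : Q.E | Q.src a = v}.ncard ≤ 2
  in_le : ∀ v : Q.V, {a : Q.E | Q.tgt a = v}.ncard ≤ 2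
  rel_right : ∀ a b b' : Q.E, Q.rel a b → Q.rel a b' → b = b'
  rel_left : ∀ a c c' : Q.E, Q.rel c a → Q.rel c' a → c = c'
  nonrel_right : ∀ a b b' : Q.E, Q.tgt a = Q.src b → ¬ Q.rel a b →
    Q.tgt a = Q.src b' → ¬ Q.rel a b' → b = b'
  nonrel_left : ∀ a c c' : Q.E, Q.tgt c = Q.src a → ¬ Q.rel c a →
    Q.tgt c' = Q.src a → ¬ Q.rel c' a → c = c'
  finite : Module.Finite k (Q.Alg k)

/-- `k Q / I` has exactly one maximal path. -/
def HasOneMaximalPath (k : Type u) [Field k] (Q : BoundQuiver) : Prop :=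
  ∃! p : (Σ l : ℕ, Q.Path l), p.2.IsMaximal k

/-- The maximal path of `k Q / I` has `n` vertices `v_1, …, v_n`, and `α` is the permutation of
`{1, …, n}` with `α i = j` if `v_i = v_j` for some `j ≠ i`, and `α i = i` if there is no
such `j`. -/
def GluingDatum (k : Type u) [Field k] (Q : BoundQuiver) {n : ℕ}
    (α : Equiv.Perm (Fin n)) : Prop :=
  ∃ (l : ℕ) (h : n = l + 1) (p : Q.Path l), p.IsMaximal k ∧
    ∀ i j : Fin n, p.vertex (i.cast h) = p.vertex (j.cast h) ↔ (j = i ∨ j = α i)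

/-- The arrow ideal of `A = k Q / I`, that is, the part `A_{≥ 1}` of positive degree for the
grading by path length: the two-sided ideal generated by the arrows, as a right ideal. -/
def arrowIdeal (k : Type u) [Field k] (Q : BoundQuiver) :
    Submodule (Q.Alg k)ᵐᵒᵖ (Q.Alg k) :=
  Submodule.span (Q.Alg k)ᵐᵒᵖ {y | ∃ (x : Q.Alg k) (a : Q.E), y = x * Q.arrow k a}

/-- The right `A`-module `A_0 = A / A_{≥ 1}` for `A = k Q / I`. -/
def degreeZero (k : Type u) [Field k] (Q : BoundQuiver) : ModuleCat.{u} (Q.Alg k)ᵐᵒᵖ :=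
  ModuleCat.of (Q.Alg k)ᵐᵒᵖ (Q.Alg k ⧸ Q.arrowIdeal k)

end BoundQuiver

/-- `B` is (isomorphic to) a gentle algebra with one maximal path. -/
def IsGentleWithOneMaximalPath (k : Type u) [Field k] (B : Type v) [Ring B] [Algebra k B] :
    Prop :=
  ∃ Q : BoundQuiver, Q.IsGentle k ∧ Q.HasOneMaximalPath k ∧ Nonempty (B ≃ₐ[k] Q.Alg k)

/-- `B` is (isomorphic to) a gentle algebra with one maximal path, and `α` is the
quasi-diagram associated to it. -/
def HasAssociatedDiagram (k : Type u) [Field k] (B : Type v) [Ring B] [Algebra k B] {n : ℕ}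
    (α : Equiv.Perm (Fin n)) : Prop :=
  ∃ Q : BoundQuiver, Q.IsGentle k ∧ Q.HasOneMaximalPath k ∧ Q.GluingDatum k α ∧
    Nonempty (B ≃ₐ[k] Q.Alg k)

/-! ### Global dimension and Yoneda algebras -/

/-- The (right) global dimension: the supremum of the projective dimensions of all right
modules. -/
def globalDimension (A : Type u) [Ring A] : WithBot ℕ∞ :=
  ⨆ M : ModuleCat.{u} Aᵐᵒᵖ, projectiveDimension M

instance moduleCatHasExt (R : Type u) [Ring R] : HasExt.{u} (ModuleCat.{u} R) :=
  hasExt_of_enoughProjectives.{u} (ModuleCat.{u} R)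

section Yoneda

variable (k : Type w) [Field k] {C : Type u} [Category.{v} C] [Abelian C] [HasExt.{v} C]
  (X : C)

variable {X} in
theorem ext_mk_comp {i j c c' : ℕ} (x : Ext.{v} X X i) (y : Ext.{v} X X j) (h : i + j = c)
    (h' : i + j = c') :
    (GradedMonoid.mk c (x.comp y h) : GradedMonoid fun n : ℕ => Ext.{v} X X n) =
      GradedMonoid.mk c' (x.comp y h') := by
  subst h; subst h'; rfl

/-- The Yoneda product `x * y = x ∘ y` (first `y`, then `x`) on `Ext (X, X)`. -/
instance yonedaGMul : GradedMonoid.GMul fun n : ℕ => Ext.{v} X X n where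
  mul {i j} x y := y.comp x (add_comm j i)

instance yonedaGOne : GradedMonoid.GOne fun n : ℕ => Ext.{v} X X n where
  one := Ext.mk₀ (𝟙 X)

variable {X} in
theorem yoneda_one_mul (a : GradedMonoid fun n : ℕ => Ext.{v} X X n) : 1 * a = a := by
  obtain ⟨i, x⟩ := a
  exact (ext_mk_comp x (Ext.mk₀ (𝟙 X)) _ (add_zero i)).trans (by rw [Ext.comp_mk₀_id]; rfl)

variable {X} in
theorem yoneda_mul_one (a : GradedMonoid fun n : ℕ => Ext.{v} X X n) : a * 1 = a := by
  obtain ⟨i, x⟩ := a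
  exact (ext_mk_comp (Ext.mk₀ (𝟙 X)) x _ (zero_add i)).trans (by rw [Ext.mk₀_id_comp]; rfl)

variable {X} in
theorem yoneda_mul_assoc (a b c : GradedMonoid fun n : ℕ => Ext.{v} X X n) :
    a * b * c = a * (b * c) := by
  obtain ⟨i, x⟩ := a
  obtain ⟨j, y⟩ := b
  obtain ⟨l, z⟩ := c
  refine (ext_mk_comp z (y.comp x (add_comm j i)) _
    (show l + (i + j) = i + (j + l) by omega)).trans ?_
  rw [← Ext.comp_assoc z y x (add_comm l j) (add_comm j i) (by omega)]
  rfl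

instance yonedaGRing : DirectSum.GRing fun n : ℕ => Ext.{v} X X n where
  toGMul := yonedaGMul X
  one := Ext.mk₀ (𝟙 X)
  mul_zero x := Ext.zero_comp X _ x _ _
  zero_mul y := Ext.comp_zero y X _ _ _
  mul_add x y z := Ext.add_comp y z x _
  add_mul x y z := Ext.comp_add z x y _
  one_mul := yoneda_one_mul
  mul_one := yoneda_mul_one
  mul_assoc := yoneda_mul_assoc
  natCast m := m • Ext.mk₀ (𝟙 X)
  natCast_zero := zero_smul _ _
  natCast_succ m := succ_nsmul _ _
  intCast m := m • Ext.mk₀ (𝟙 X)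
  intCast_ofNat m := natCast_zsmul _ _
  intCast_negSucc_ofNat m := negSucc_zsmul _ _

instance yonedaGAlgebra [Linear k C] : DirectSum.GAlgebra k fun n : ℕ => Ext.{v} X X n where
  toFun :=
    { toFun := fun r => r • Ext.mk₀ (𝟙 X)
      map_zero' := zero_smul _ _
      map_add' := fun r s => add_smul r s _ }
  map_one := one_smul _ _
  map_mul r s := by
    refine Eq.trans ?_ (ext_mk_comp (s • Ext.mk₀ (𝟙 X)) (r • Ext.mk₀ (𝟙 X)) (add_zero 0) _)
    rw [Ext.comp_smul, Ext.comp_mk₀_id, smul_smul]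
    rfl
  commutes r a := by
    obtain ⟨i, x⟩ := a
    refine (ext_mk_comp x (r • Ext.mk₀ (𝟙 X)) _ (add_zero i)).trans
      (Eq.trans ?_ (ext_mk_comp (r • Ext.mk₀ (𝟙 X)) x (zero_add i) _))
    rw [Ext.comp_smul, Ext.smul_comp, Ext.comp_mk₀_id, Ext.mk₀_id_comp]
  smul_def r a := by
    obtain ⟨i, x⟩ := a
    refine Eq.trans ?_ (ext_mk_comp x (r • Ext.mk₀ (𝟙 X)) (add_zero i) _)
    rw [Ext.comp_smul, Ext.comp_mk₀_id]
    rfl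

end Yoneda

/-- The Koszul dual `A^!` of `A = k Q / I`: the Yoneda algebra `⨁ n, Ext_A^n (A_0, A_0)`. -/
abbrev KoszulDual (k : Type u) [Field k] (Q : BoundQuiver) : Type u :=
  ⨁ n : ℕ, Ext.{u} (Q.degreeZero k) (Q.degreeZero k) n

/-! ### The gentle algebra of a quasi-diagram -/

namespace QuasiDiagram

variable {n : ℕ}

/-- The vertices are the orbits of `α`; with `f i` the orbit of `i`, there is for each
`1 ≤ i ≤ n - 1` an arrow `a_i : f i → f (i + 1)`, and the relations are the paths `a_i a_j`
with `j ≠ i + 1`. -/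
def gentleQuiver (α : Equiv.Perm (Fin n)) : BoundQuiver where
  V := Quotient (Equiv.Perm.SameCycle.setoid α)
  E := {i : Fin n // i.val + 1 < n}
  fintypeV := Fintype.ofFinite _
  src i := Quotient.mk _ i.1
  tgt i := Quotient.mk _ ⟨i.1.val + 1, i.2⟩
  rel i j := (Quotient.mk (Equiv.Perm.SameCycle.setoid α) ⟨i.1.val + 1, i.2⟩ =
      Quotient.mk (Equiv.Perm.SameCycle.setoid α) j.1) ∧ j.1.val ≠ i.1.val + 1
  rel_composable _ _ h := h.1

/-- The gentle algebra associated to `α`. -/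
abbrev GentleAlgebra (k : Type u) [Field k] (α : Equiv.Perm (Fin n)) : Type u :=
  (gentleQuiver α).Alg k

/-- The Koszul dual `α^!` exists: the Koszul dual of the gentle algebra of `α` is again a gentle
algebra with one maximal path. -/
def KoszulDualExists (k : Type u) [Field k] (α : Equiv.Perm (Fin n)) : Prop :=
  IsGentleWithOneMaximalPath k (KoszulDual k (gentleQuiver α))

/-- `β = α^!`: the Koszul dual of the gentle algebra of `α` is a gentle algebra with one maximal
path and associated quasi-diagram `β`. -/
def IsKoszulDual (k : Type u) [Field k] (α β : Equiv.Perm (Fin n)) : Prop :=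
  HasAssociatedDiagram k (KoszulDual k (gentleQuiver α)) β

end QuasiDiagram

end

/-! Write `n = l + 1 = 2m`, `ζ = finRotate n`, and number the points from `0`. The algebra `A` of
`α` is faithfully represented by the upper triangular `n × n` matrices whose diagonal is constant on
the chords `{i, α i}` (`IsGluedModel`). Its radical, the strictly upper triangular part, is the
direct sum over `i ≠ 0` of the modules `tail i` of row vectors supported in columns `≥ i`. The
projective cover of `tail i` is made of the rows `i` and `α i`; the kernel is `tail (ζ (α i))`, or
zero if `α i` is the last point, i.e. if `ζ (α i) = 0`. So taking syzygies means walking along the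
orbits of `ζ α`, with `0` as the only exit.

If `α` is maximal, the single walk passes every nonzero point once and stops: the top `A / rad A`
has projective dimension `l`, and filtering modules by semisimple ones gives global dimension `l`.
If `α` is not maximal, an orbit avoiding `0` yields nonzero self-extensions of the top in all
positive degrees. Then the global dimension is infinite and the Yoneda algebra is
infinite-dimensional, hence not gentle.

`SyzygySystem` turns the walk into a basis of the Yoneda algebra with explicit products. In the
maximal case, numbering the arrows along the face identifies the Yoneda algebra with the algebra of
`faceDual = w⁻¹ α w`, where `w = faceWalk` satisfies `ζ α w ζ = w`. By this identity `ζ * faceDual`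
is conjugate to `ζ⁻¹`, so the dual is again maximal, and dualizing twice returns `α`; thus every
maximal diagram is a dual. Conversely, if `α` is the dual of a maximal `β`, one and the same algebra
is glued along `α` and along the face dual of `β`; its global dimension is `l` by the second
description, so `α` is maximal by the first (`globalDimension_eq_iff`).

The other conditions are combinatorial: without isolated points, regularity says that every orbit of
`ζ α` contains `0`, and rotating `α` conjugates `ζ α`. Taking signs in `ζ α w ζ = w` gives `sign α =
1`, while `sign α = (-1) ^ m`. -/

open CategoryTheory CategoryTheory.Abelian DirectSum

noncomputable section

universe u v w

/-! ### Yoneda products from a system of syzygies -/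

section Syzygies

variable {C : Type u} [Category.{v} C] [Abelian C] [HasExt.{v} C]

/-- In the long exact sequence the middle object contributes nothing: its higher Ext groups vanish
by projectivity, and in degree zero its maps to `Y` die on `S.X₁`. Hence the connecting map is
bijective even at `d = 0`. -/
theorem precomp_extClass_bijective {S : ShortComplex C} (hS : S.ShortExact) (hP : Projective S.X₂)
    {Y : C} (hY : ∀ h : S.X₂ ⟶ Y, S.f ≫ h = 0) {d d' : ℕ} (hd : 1 + d = d') :
    Function.Bijective fun x : Ext.{v} S.X₁ Y d => hS.extClass.comp x hd := by
  constructor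
  · intro x y hxy
    rw [← sub_eq_zero]
    have h0 : hS.extClass.comp (x - y) hd = 0 := by
      have := sub_eq_zero.2 hxy
      rw [sub_eq_add_neg, Ext.comp_add, Ext.comp_neg, ← sub_eq_add_neg]
      exact this
    obtain ⟨z, hz⟩ := Ext.contravariant_sequence_exact₁ hS Y (x - y) hd h0
    rw [← hz]
    obtain _ | d := d
    · obtain ⟨h, rfl⟩ := (Ext.mk₀_bijective _ _).2 z
      rw [Ext.mk₀_comp_mk₀, hY, Ext.mk₀_zero]
    · rw [z.eq_zero_of_projective, Ext.comp_zero]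
  · intro y
    subst hd
    have : (1 + d) = d + 1 := add_comm _ _
    have h0 : ∀ {m : ℕ} (z : Ext.{v} S.X₂ Y m), m = d + 1 → z = 0 := by
      rintro m z rfl
      exact z.eq_zero_of_projective
    exact Ext.contravariant_sequence_exact₃ hS Y y (h0 _ this) rfl

variable (k : Type w) [Field k] [Linear k C]

/-- A projective presentation `0 ⟶ J ⟶ P ⟶ X ⟶ 0` whose kernel is a biproduct of objects `M e`
with `Hom (M e, X)` one-dimensional, each `M e` being projective or a quotient of a projective
object by another `M e'`. -/
structure SyzygySystem (X : C) (E : Type) [Fintype E] [DecidableEq E] where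
  J : C
  P : C
  f : J ⟶ P
  g : P ⟶ X
  w : f ≫ g = 0
  exact : (ShortComplex.mk f g w).ShortExact
  projective : Projective P
  comp_eq_zero : ∀ h : P ⟶ X, f ≫ h = 0
  M : E → C
  ι : ∀ e, M e ⟶ J
  p : ∀ e, J ⟶ M e
  ι_p : ∀ e, ι e ≫ p e = 𝟙 (M e)
  ι_p_of_ne : ∀ e e', e ≠ e' → ι e ≫ p e' = 0
  total : ∑ e, p e ≫ ι e = 𝟙 J
  π : ∀ e, M e ⟶ X
  π_ne_zero : ∀ e, π e ≠ 0
  π_span : ∀ e (h : M e ⟶ X), ∃ c : k, h = c • π e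
  next : E → Option E
  terminal : ∀ e, next e = none → Projective (M e)
  -- The maps `ι e'`, `r`, `π e` form a morphism to the presentation of `X`, which will relate the
  -- two extension classes. The last condition makes the dimension shift bijective from degree zero
  -- on.
  step : ∀ e e', next e = some e' → ∃ (Q : C) (i : M e' ⟶ Q) (q : Q ⟶ M e) (r : Q ⟶ P)
    (w : i ≫ q = 0), (ShortComplex.mk i q w).ShortExact ∧ Projective Q ∧
      i ≫ r = ι e' ≫ f ∧ r ≫ g = q ≫ π e ∧ ∀ h : Q ⟶ X, i ≫ h = 0

namespace SyzygySystem

variable {k} {X : C} {E : Type} [Fintype E] [DecidableEq E] (D : SyzygySystem k X E)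

/-- The class of the presentation of `X`. -/
def η : Ext.{v} X D.J 1 := D.exact.extClass

theorem η_bijective (d : ℕ) :
    Function.Bijective fun x : Ext.{v} D.J X d => D.η.comp x (add_comm 1 d) :=
  precomp_extClass_bijective D.exact D.projective D.comp_eq_zero _

/-- The class in `Ext (M e, M e')` obtained from the presentation of `X`. -/
def κ (e e' : E) : Ext.{v} (D.M e) (D.M e') 1 :=
  (Ext.mk₀ (D.π e)).comp (D.η.comp (Ext.mk₀ (D.p e')) (add_zero 1)) (zero_add 1)

/-- By naturality of extension classes, pulling `η` back along `π e` agrees with pushing the class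
of the sequence in `step` forward along `ι e'`. Hence only the component at `next e` survives. -/
theorem κ_of_next {e e' : E} (h : D.next e = some e') :
    ∃ (Q : C) (i : D.M e' ⟶ Q) (q : Q ⟶ D.M e) (w : i ≫ q = 0)
      (hS : (ShortComplex.mk i q w).ShortExact), Projective Q ∧ (∀ h : Q ⟶ X, i ≫ h = 0) ∧
      ∀ e'', D.κ e e'' = hS.extClass.comp (Ext.mk₀ (D.ι e' ≫ D.p e'')) (add_zero 1) := by
  obtain ⟨Q, i, q, r, w, hS, hQ, h₁, h₂, h₃⟩ := D.step e e' h
  refine ⟨Q, i, q, w, hS, hQ, h₃, fun e'' => ?_⟩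
  let φ : ShortComplex.mk i q w ⟶ ShortComplex.mk D.f D.g D.w :=
    { τ₁ := D.ι e', τ₂ := r, τ₃ := D.π e, comm₁₂ := h₁.symm, comm₂₃ := h₂ }
  have hn := ShortComplex.ShortExact.extClass_naturality hS D.exact φ
  rw [κ, ← Ext.comp_assoc (a₁₂ := 1) _ _ _ (by lia) (by lia) (by lia), η]
  rw [← Ext.mk₀_comp_mk₀, ← Ext.comp_assoc (a₁₂ := 1) _ _ _ (by lia) (by lia) (by lia)]
  exact congrArg (fun z => Ext.comp z (Ext.mk₀ (D.p e'')) (add_zero 1)) hn.symm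

theorem κ_eq_zero {e e' : E} (h : D.next e ≠ some e') : D.κ e e' = 0 := by
  rcases hn : D.next e with _ | e₁
  · have := D.terminal e hn
    exact Ext.eq_zero_of_projective _
  · obtain ⟨Q, i, q, w, hS, hQ, h₃, hκ⟩ := D.κ_of_next hn
    rw [hκ, D.ι_p_of_ne e₁ e' (by rintro rfl; exact h hn), Ext.mk₀_zero, Ext.comp_zero]

theorem κ_bijective {e e' : E} (h : D.next e = some e') (d : ℕ) :
    Function.Bijective fun x : Ext.{v} (D.M e') X d => (D.κ e e').comp x (add_comm 1 d) := by
  obtain ⟨Q, i, q, w, hS, hQ, h₃, hκ⟩ := D.κ_of_next h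
  rw [hκ, D.ι_p, Ext.comp_mk₀_id]
  exact precomp_extClass_bijective hS hQ h₃ _

/-- The canonical element of `Ext (M e, X)` in degree `d`. -/
def θ : (d : ℕ) → (e : E) → Ext.{v} (D.M e) X d
  | 0, e => Ext.mk₀ (D.π e)
  | d + 1, e => (D.next e).elim 0 fun e' => (D.κ e e').comp (θ d e') (add_comm 1 d)

/-- `next` can be applied `d` times to `e`. -/
def Alive : ℕ → E → Prop
  | 0, _ => True
  | d + 1, e => ∃ e', D.next e = some e' ∧ Alive d e'

theorem θ_succ_of_next {e e' : E} (h : D.next e = some e') (d : ℕ) :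
    D.θ (d + 1) e = (D.κ e e').comp (D.θ d e') (add_comm 1 d) := by
  simp [θ, h]

theorem κ_comp_θ (d : ℕ) (e e' : E) :
    (D.κ e e').comp (D.θ d e') (add_comm 1 d) =
      if D.next e = some e' then D.θ (d + 1) e else 0 := by
  split_ifs with h
  · rw [D.θ_succ_of_next h]
  · rw [D.κ_eq_zero h, Ext.zero_comp]

theorem θ_eq_zero {d : ℕ} {e : E} (h : ¬ D.Alive d e) : D.θ d e = 0 := by
  induction d generalizing e with
  | zero => exact absurd trivial h
  | succ d ih =>
    rcases hn : D.next e with _ | e'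
    · simp [θ, hn]
    · rw [D.θ_succ_of_next hn, ih fun h' => h ⟨e', hn, h'⟩, Ext.comp_zero]

theorem θ_ne_zero {d : ℕ} {e : E} (h : D.Alive d e) : D.θ d e ≠ 0 := by
  induction d generalizing e with
  | zero => simpa [θ] using D.π_ne_zero e
  | succ d ih =>
    obtain ⟨e', hn, h'⟩ := h
    rw [D.θ_succ_of_next hn]
    intro h0
    exact ih h' ((D.κ_bijective hn d).1 (by simpa using h0))

/-- Composition with `κ` shifts the claim from `e` to `next e`, one degree lower, and ends with
`π_span` or with a projective `M e`. -/
theorem exists_eq_smul_θ (d : ℕ) (e : E) (x : Ext.{v} (D.M e) X d) :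
    ∃ c : k, x = c • D.θ d e := by
  induction d generalizing e with
  | zero =>
    obtain ⟨h, rfl⟩ := (Ext.mk₀_bijective _ _).2 x
    obtain ⟨c, rfl⟩ := D.π_span e h
    exact ⟨c, by rw [Ext.mk₀_smul]; rfl⟩
  | succ d ih =>
    rcases hn : D.next e with _ | e'
    · have := D.terminal e hn
      exact ⟨0, by rw [x.eq_zero_of_projective, zero_smul]⟩
    · obtain ⟨y, rfl⟩ := (D.κ_bijective hn d).2 x
      obtain ⟨c, rfl⟩ := ih e' y
      exact ⟨c, by rw [D.θ_succ_of_next hn]; exact Ext.comp_smul ..⟩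

/-- The canonical elements of `Ext (X, X)` in degree `d + 1`. -/
def Θ (d : ℕ) (e : E) : Ext.{v} X X (d + 1) :=
  D.η.comp ((Ext.mk₀ (D.p e)).comp (D.θ d e) (zero_add d)) (add_comm 1 d)

/-- Reassociating exposes `κ e e'` in the middle, so the product is decided by `next` alone. -/
theorem Θ_zero_comp_Θ (d : ℕ) (e e' : E) :
    (D.Θ 0 e).comp (D.Θ d e') (by omega : 0 + 1 + (d + 1) = d + 1 + 1) =
      if D.next e = some e' then D.Θ (d + 1) e else 0 := by
  have h : (D.Θ 0 e).comp (D.Θ d e') (by omega : 0 + 1 + (d + 1) = d + 1 + 1) =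
      D.η.comp ((Ext.mk₀ (D.p e)).comp
        ((D.κ e e').comp (D.θ d e') (add_comm 1 d)) (zero_add _)) (add_comm 1 (d + 1)) := by
    simp only [Θ, κ, θ]
    rw [Ext.comp_assoc (a₁₂ := 1) (a₂₃ := d + 1) _ _ _ (by lia) (by lia) (by lia),
      Ext.comp_assoc (a₁₂ := 0) (a₂₃ := d + 1) _ _ _ (by lia) (by lia) (by lia),
      Ext.comp_assoc (a₁₂ := 1) (a₂₃ := d + 1) _ _ _ (by lia) (by lia) (by lia),
      Ext.comp_assoc (a₁₂ := 1) (a₂₃ := d) _ _ _ (by lia) (by lia) (by lia)]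
  rw [h, D.κ_comp_θ]
  split_ifs
  · rfl
  · simp

theorem Θ_eq_zero {d : ℕ} {e : E} (h : ¬ D.Alive d e) : D.Θ d e = 0 := by
  rw [Θ, D.θ_eq_zero h, Ext.comp_zero, Ext.comp_zero]

/-- The shift along `η` replaces `X` by `J`, and `total` splits `Ext (J, X)` into the at most
one-dimensional `Ext (M e, X)`. -/
theorem exists_eq_sum_smul_Θ (d : ℕ) (x : Ext.{v} X X (d + 1)) :
    ∃ c : E → k, x = ∑ e, c e • D.Θ d e := by
  obtain ⟨y, rfl⟩ := (D.η_bijective d).2 x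
  choose c hc using fun e => D.exists_eq_smul_θ d e ((Ext.mk₀ (D.ι e)).comp y (zero_add d))
  refine ⟨c, ?_⟩
  have hy : y = ∑ e, c e • (Ext.mk₀ (D.p e)).comp (D.θ d e) (zero_add d) := by
    have h1 : (Ext.mk₀ (∑ e, D.p e ≫ D.ι e)).comp y (zero_add d) = y := by
      rw [D.total, Ext.mk₀_id_comp]
    have h2 : Ext.mk₀ (∑ e, D.p e ≫ D.ι e) = ∑ e, Ext.mk₀ (D.p e ≫ D.ι e) :=
      map_sum (Ext.addEquiv₀ (X := D.J) (Y := D.J)).symm _ _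
    have h3 : (∑ e, Ext.mk₀ (D.p e ≫ D.ι e)).comp y (zero_add d) =
        ∑ e, (Ext.mk₀ (D.p e ≫ D.ι e)).comp y (zero_add d) :=
      map_sum (Ext.postcomp y D.J (zero_add d)) _ _
    rw [← h1, h2, h3]
    refine Finset.sum_congr rfl fun e _ => ?_
    rw [← Ext.mk₀_comp_mk₀_assoc, hc, Ext.comp_smul]
  calc D.η.comp y (add_comm 1 d)
      = D.η.comp (∑ e, c e • (Ext.mk₀ (D.p e)).comp (D.θ d e) (zero_add d)) (add_comm 1 d) := by
        rw [← hy]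
    _ = ∑ e, D.η.comp (c e • (Ext.mk₀ (D.p e)).comp (D.θ d e) (zero_add d)) (add_comm 1 d) :=
        map_sum (Ext.precomp D.η X (add_comm 1 d)) _ _
    _ = _ := by simp only [Ext.comp_smul, Θ]

/-- Cancelling `η` and precomposing with `ι e` isolates `c e • θ d e`. -/
theorem eq_zero_of_sum_smul_Θ {d : ℕ} {c : E → k} (h : ∑ e, c e • D.Θ d e = 0) {e : E}
    (he : D.Alive d e) : c e = 0 := by
  have h1 : D.η.comp (∑ e, c e • (Ext.mk₀ (D.p e)).comp (D.θ d e) (zero_add d))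
      (add_comm 1 d) = 0 := by
    rw [← h]
    refine (map_sum (Ext.precomp D.η X (add_comm 1 d)) _ _).trans ?_
    exact Finset.sum_congr rfl fun e _ => Ext.comp_smul ..
  have h2 : ∑ e, c e • (Ext.mk₀ (D.p e)).comp (D.θ d e) (zero_add d) = 0 :=
    (D.η_bijective d).1 (by simpa using h1)
  have h3 : (Ext.mk₀ (D.ι e)).comp
      (∑ e, c e • (Ext.mk₀ (D.p e)).comp (D.θ d e) (zero_add d)) (zero_add d) =
        c e • D.θ d e := by
    refine (map_sum (Ext.precomp (Ext.mk₀ (D.ι e)) X (zero_add d)) _ _).trans ?_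
    rw [Finset.sum_eq_single e]
    · change (Ext.mk₀ (D.ι e)).comp (c e • _) (zero_add d) = _
      rw [Ext.comp_smul, Ext.mk₀_comp_mk₀_assoc, D.ι_p, Ext.mk₀_id_comp]
    · intro e' _ hne
      change (Ext.mk₀ (D.ι e)).comp (c e' • _) (zero_add d) = _
      rw [Ext.comp_smul, Ext.mk₀_comp_mk₀_assoc, D.ι_p_of_ne e e' hne.symm, Ext.mk₀_zero,
        Ext.zero_comp, smul_zero]
    · simp
  rw [h2, Ext.comp_zero] at h3
  exact (smul_eq_zero.1 h3.symm).resolve_right (D.θ_ne_zero he)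

theorem Θ_ne_zero {d : ℕ} {e : E} (h : D.Alive d e) : D.Θ d e ≠ 0 := by
  intro h0
  have : ∑ e', (Pi.single e (1 : k) : E → k) e' • D.Θ d e' = 0 := by
    simp [Pi.single_apply, h0]
  simpa using D.eq_zero_of_sum_smul_Θ this h

end SyzygySystem

end Syzygies

/-! ### Algebras of bound quivers -/

namespace BoundQuiver

variable {k : Type u} [Field k] {Q : BoundQuiver}

section Presentation

theorem idempotent_mul_self (v : Q.V) :
    Q.idempotent k v * Q.idempotent k v = Q.idempotent k v := by
  have := RingQuot.mkAlgHom_rel k (Rel.idem (k := k) (Q := Q) v)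
  rwa [map_mul] at this

theorem idempotent_mul_of_ne {v w : Q.V} (h : v ≠ w) :
    Q.idempotent k v * Q.idempotent k w = 0 := by
  have := RingQuot.mkAlgHom_rel k (Rel.orth (k := k) (Q := Q) v w h)
  rwa [map_mul, map_zero] at this

theorem sum_idempotent : ∑ v : Q.V, Q.idempotent k v = 1 := by
  have := RingQuot.mkAlgHom_rel k (Rel.complete (k := k) (Q := Q))
  rwa [map_sum, map_one] at this

theorem idempotent_src_mul_arrow (a : Q.E) :
    Q.idempotent k (Q.src a) * Q.arrow k a = Q.arrow k a := by
  have := RingQuot.mkAlgHom_rel k (Rel.source (k := k) (Q := Q) a)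
  rwa [map_mul] at this

theorem arrow_mul_idempotent_tgt (a : Q.E) :
    Q.arrow k a * Q.idempotent k (Q.tgt a) = Q.arrow k a := by
  have := RingQuot.mkAlgHom_rel k (Rel.target (k := k) (Q := Q) a)
  rwa [map_mul] at this

theorem arrow_mul_arrow_of_rel {a b : Q.E} (h : Q.rel a b) :
    Q.arrow k a * Q.arrow k b = 0 := by
  have := RingQuot.mkAlgHom_rel k (Rel.zero (k := k) (Q := Q) a b h)
  rwa [map_mul, map_zero] at this

theorem idempotent_mul_arrow_of_ne {v : Q.V} {a : Q.E} (h : v ≠ Q.src a) :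
    Q.idempotent k v * Q.arrow k a = 0 := by
  rw [← idempotent_src_mul_arrow, ← mul_assoc, idempotent_mul_of_ne h, zero_mul]

theorem arrow_mul_idempotent_of_ne {v : Q.V} {a : Q.E} (h : Q.tgt a ≠ v) :
    Q.arrow k a * Q.idempotent k v = 0 := by
  rw [← arrow_mul_idempotent_tgt, mul_assoc, idempotent_mul_of_ne h, mul_zero]

theorem arrow_mul_arrow_of_ne {a b : Q.E} (h : Q.tgt a ≠ Q.src b) :
    Q.arrow k a * Q.arrow k b = 0 := by
  rw [← arrow_mul_idempotent_tgt, mul_assoc, idempotent_mul_arrow_of_ne h, mul_zero]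

/-- The universal property of the algebra of a bound quiver. -/
def lift {B : Type*} [Ring B] [Algebra k B] (e : Q.V → B) (x : Q.E → B)
    (idem : ∀ v, e v * e v = e v) (orth : ∀ v w, v ≠ w → e v * e w = 0)
    (complete : ∑ v, e v = 1) (source : ∀ a, e (Q.src a) * x a = x a)
    (target : ∀ a, x a * e (Q.tgt a) = x a) (zero : ∀ a b, Q.rel a b → x a * x b = 0) :
    Q.Alg k →ₐ[k] B :=
  RingQuot.liftAlgHom k ⟨FreeAlgebra.lift k (Sum.elim e x), by
    intro y z h
    induction h with
    | idem v => simpa using idem v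
    | orth v w h => simpa using orth v w h
    | complete => simpa using complete
    | source a => simpa using source a
    | target a => simpa using target a
    | zero a b h => simpa using zero a b h⟩

section Lift

variable {B : Type*} [Ring B] [Algebra k B] (e : Q.V → B) (x : Q.E → B)
    (h₁ : ∀ v, e v * e v = e v) (h₂ : ∀ v w, v ≠ w → e v * e w = 0)
    (h₃ : ∑ v, e v = 1) (h₄ : ∀ a, e (Q.src a) * x a = x a)
    (h₅ : ∀ a, x a * e (Q.tgt a) = x a) (h₆ : ∀ a b, Q.rel a b → x a * x b = 0)

@[simp]
theorem lift_idempotent (v : Q.V) : lift e x h₁ h₂ h₃ h₄ h₅ h₆ (Q.idempotent k v) = e v := by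
  refine (RingQuot.liftAlgHom_mkAlgHom_apply k _ _ _).trans ?_
  simp

@[simp]
theorem lift_arrow (a : Q.E) : lift e x h₁ h₂ h₃ h₄ h₅ h₆ (Q.arrow k a) = x a := by
  refine (RingQuot.liftAlgHom_mkAlgHom_apply k _ _ _).trans ?_
  simp

end Lift

theorem eq_top_of_mul_mem (S : Submodule k (Q.Alg k)) (h₁ : 1 ∈ S)
    (he : ∀ s ∈ S, ∀ v, s * Q.idempotent k v ∈ S) (ha : ∀ s ∈ S, ∀ a, s * Q.arrow k a ∈ S) :
    S = ⊤ := by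
  rw [eq_top_iff]
  rintro x -
  obtain ⟨y, rfl⟩ := RingQuot.mkAlgHom_surjective k (Rel k Q) x
  let ψ : FreeAlgebra k (Q.V ⊕ Q.E) →ₐ[k] Q.Alg k := RingQuot.mkAlgHom k (Rel k Q)
  -- Allowing any `s` in place of `1` lets the induction pass through products.
  suffices h : ∀ s ∈ S, s * ψ y ∈ S by
    have := h 1 h₁
    rwa [one_mul] at this
  induction y using FreeAlgebra.induction with
  | grade0 r =>
    intro s hs
    rw [AlgHom.commutes]
    rw [← Algebra.commutes, ← Algebra.smul_def]
    exact S.smul_mem _ hs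
  | grade1 i =>
    intro s hs
    rcases i with v | a
    · exact he s hs v
    · exact ha s hs a
  | mul y z hy hz =>
    intro s hs
    rw [map_mul]
    have := hz _ (hy s hs)
    rwa [mul_assoc] at this
  | add y z hy hz =>
    intro s hs
    rw [map_add]
    have := S.add_mem (hy s hs) (hz s hs)
    rwa [← mul_add] at this

end Presentation

/-! ### String modules, which detect paths without relations -/

section StringModule

open Classical in
/-- The action of an arrow on the string module of a path. -/
def Path.arrowMatrix (k : Type u) [Field k] {l : ℕ} (p : Q.Path l) (a : Q.E) :
    Matrix (Fin (l + 1)) (Fin (l + 1)) k :=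
  Matrix.of fun i j => if ∃ s : Fin l, i = s.castSucc ∧ j = s.succ ∧ p.edge s = a then 1 else 0

open Classical in
/-- The action of a trivial path on the string module of a path. -/
def Path.vertexMatrix (k : Type u) [Field k] {l : ℕ} (p : Q.Path l) (v : Q.V) :
    Matrix (Fin (l + 1)) (Fin (l + 1)) k :=
  Matrix.diagonal fun i => if p.vertex i = v then 1 else 0

/-- No two consecutive arrows of the path form a relation. -/
def Path.IsFree {l : ℕ} (p : Q.Path l) : Prop :=
  ∀ s t : Fin l, t.val = s.val + 1 → ¬ Q.rel (p.edge s) (p.edge t)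

open Classical in
/-- The string module of a path without relations. -/
def Path.stringRep (k : Type u) [Field k] {l : ℕ} (p : Q.Path l) (hp : p.IsFree) :
    Q.Alg k →ₐ[k] Matrix (Fin (l + 1)) (Fin (l + 1)) k :=
  lift (p.vertexMatrix k) (p.arrowMatrix k)
    (fun v => by simp [Path.vertexMatrix])
    (fun v w h => by
      ext i j
      simp only [Path.vertexMatrix, Matrix.diagonal_mul_diagonal, Matrix.diagonal_apply]
      split_ifs <;> simp_all)
    (by
      ext i j
      rw [Matrix.sum_apply]
      by_cases h : i = j <;> simp [Path.vertexMatrix, Matrix.one_apply, h])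
    (fun a => by
      ext i j
      simp only [Path.vertexMatrix, Path.arrowMatrix, Matrix.diagonal_mul, Matrix.of_apply]
      by_cases h : ∃ s : Fin l, i = s.castSucc ∧ j = s.succ ∧ p.edge s = a
      · rw [if_pos h, mul_one, if_pos]
        obtain ⟨s, rfl, rfl, rfl⟩ := h
        exact (p.src_edge s).symm
      · rw [if_neg h, mul_zero])
    (fun a => by
      ext i j
      simp only [Path.vertexMatrix, Path.arrowMatrix, Matrix.mul_diagonal, Matrix.of_apply]
      by_cases h : ∃ s : Fin l, i = s.castSucc ∧ j = s.succ ∧ p.edge s = a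
      · rw [if_pos h, one_mul, if_pos]
        obtain ⟨s, rfl, rfl, rfl⟩ := h
        exact (p.tgt_edge s).symm
      · rw [if_neg h, zero_mul])
    (fun a b h => by
      ext i j
      rw [Matrix.mul_apply]
      refine Finset.sum_eq_zero fun m _ => ?_
      simp only [Path.arrowMatrix, Matrix.of_apply]
      split_ifs with h₁ h₂ <;> simp
      obtain ⟨s, rfl, rfl, rfl⟩ := h₁
      obtain ⟨t, ht, rfl, rfl⟩ := h₂
      exact hp s t (by simpa using congrArg Fin.val ht.symm) h)

variable {l : ℕ} (p : Q.Path l) (hp : p.IsFree)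

@[simp]
theorem Path.stringRep_idempotent (v : Q.V) :
    p.stringRep k hp (Q.idempotent k v) = p.vertexMatrix k v := lift_idempotent ..

@[simp]
theorem Path.stringRep_arrow (a : Q.E) :
    p.stringRep k hp (Q.arrow k a) = p.arrowMatrix k a := lift_arrow ..

open Matrix in
theorem Path.single_vecMul_vertexMatrix (i : Fin (l + 1)) :
    (Pi.single i 1 : Fin (l + 1) → k) ᵥ* p.vertexMatrix k (p.vertex i) = Pi.single i 1 := by
  ext j
  by_cases h : i = j <;> simp [Path.vertexMatrix, h]

open Matrix in
theorem Path.single_vecMul_arrowMatrix (s : Fin l) :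
    (Pi.single s.castSucc 1 : Fin (l + 1) → k) ᵥ* p.arrowMatrix k (p.edge s) =
      Pi.single s.succ 1 := by
  ext j
  by_cases h : j = s.succ
  · subst h
    simp [Path.arrowMatrix]
  · simp [Path.arrowMatrix, h]

open Matrix in
theorem Path.single_vecMul_stringRep_prod (d : ℕ) (hd : d ≤ l) :
    (Pi.single 0 1 : Fin (l + 1) → k) ᵥ* p.stringRep k hp
      (List.ofFn fun i : Fin d => Q.arrow k (p.edge (i.castLE hd))).prod =
        Pi.single ⟨d, by omega⟩ 1 := by
  induction d with
  | zero => simp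
  | succ d ih =>
    rw [List.ofFn_succ', List.concat_eq_append, List.prod_append, map_mul, ← Matrix.vecMul_vecMul]
    have := ih (by omega)
    simp only [Fin.castLE_castSucc] at this ⊢
    rw [this]
    rw [List.prod_singleton, Path.stringRep_arrow]
    exact p.single_vecMul_arrowMatrix (k := k) ⟨d, by omega⟩

open Matrix in
theorem Path.single_vecMul_stringRep_toAlg :
    (Pi.single 0 1 : Fin (l + 1) → k) ᵥ* p.stringRep k hp (p.toAlg k) =
      Pi.single (Fin.last l) 1 := by
  rw [Path.toAlg, map_mul, ← Matrix.vecMul_vecMul, Path.stringRep_idempotent,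
    Path.single_vecMul_vertexMatrix]
  exact p.single_vecMul_stringRep_prod hp l le_rfl

include hp in
-- The path carries the first basis vector of its string module to the last one.
theorem Path.toAlg_ne_zero : p.toAlg k ≠ 0 := by
  intro h
  have := p.single_vecMul_stringRep_toAlg (k := k) hp
  rw [h, map_zero, Matrix.vecMul_zero] at this
  simpa using congrFun this (Fin.last l)

include hp in
-- The initial subpaths carry the first basis vector to all `l + 1` basis vectors, so the algebra
-- maps onto a space of that dimension. This bounds the lengths of relation-free paths.
theorem Path.length_lt_finrank [Module.Finite k (Q.Alg k)] :
    l < Module.finrank k (Q.Alg k) := by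
  let φ : Q.Alg k →ₗ[k] Fin (l + 1) → k :=
    (Matrix.vecMulBilin k k (Pi.single 0 1)).comp (p.stringRep k hp).toLinearMap
  have hφ : Function.Surjective φ := by
    rw [← LinearMap.range_eq_top, eq_top_iff]
    rw [← (Pi.basisFun k (Fin (l + 1))).span_eq, Submodule.span_le]
    rintro _ ⟨i, rfl⟩
    exact ⟨_, (p.single_vecMul_stringRep_prod hp i.val (by omega)).trans (by simp)⟩
  have := LinearMap.finrank_le_finrank_of_surjective hφ
  simpa using this

end StringModule

end BoundQuiver

/-! ### Bound quivers glued from a linear quiver -/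

/-- The predecessor of a position, if there is one. -/
def finPrev {l : ℕ} (j : Fin l) : Option (Fin l) :=
  if 0 < j.val then some ⟨j.val - 1, by omega⟩ else none

theorem finPrev_eq_some {l : ℕ} {i j : Fin l} : finPrev j = some i ↔ i.val + 1 = j.val := by
  unfold finPrev
  split_ifs with h
  · simp only [Option.some.injEq, Fin.ext_iff]
    omega
  · simp only [false_iff]
    omega

theorem finPrev_eq_none {l : ℕ} {j : Fin l} : finPrev j = none ↔ j.val = 0 := by
  unfold finPrev
  split_ifs with h
  · simp only [false_iff]
    omega
  · simp only [true_iff]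
    omega

/-- The upper triangular matrices with diagonal constant on the orbits of the involution `γ`, as
the image of a faithful representation of `A`. -/
structure IsGluedModel {k : Type u} [Field k] {n : ℕ} (γ : Equiv.Perm (Fin n)) {A : Type v}
    [Ring A] [Algebra k A] (ρ : A →ₐ[k] Matrix (Fin n) (Fin n) k) : Prop where
  injective : Function.Injective ρ
  mem_range : ∀ M, (∃ a, ρ a = M) ↔
    (∀ i j, j < i → M i j = 0) ∧ ∀ i, M i i = M (γ i) (γ i)

namespace BoundQuiver

variable {k : Type u} [Field k] {Q : BoundQuiver} {l : ℕ}

/-- The bound quiver is obtained from the path by identifying the vertices `i` and `γ i`. -/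
structure Path.IsGlued (p : Q.Path l) (γ : Equiv.Perm (Fin (l + 1))) : Prop where
  edge_bijective : Function.Bijective p.edge
  vertex_surjective : Function.Surjective p.vertex
  vertex_eq : ∀ i j, p.vertex i = p.vertex j ↔ j = i ∨ j = γ i
  rel_iff : ∀ i j : Fin l, Q.rel (p.edge i) (p.edge j) ↔
    p.vertex i.succ = p.vertex j.castSucc ∧ j.val ≠ i.val + 1

/-- The subpath with `d + 1` arrows ending with the arrow `j`, or `0` if there is none. -/
def Path.segment (k : Type u) [Field k] (p : Q.Path l) : ℕ → Fin l → Q.Alg k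
  | 0, j => Q.arrow k (p.edge j)
  | d + 1, j => (finPrev j).elim 0 fun i => Path.segment k p d i * Q.arrow k (p.edge j)

theorem Path.segment_eq_mul_arrow (p : Q.Path l) (d : ℕ) (j : Fin l) :
    ∃ x, p.segment k d j = x * Q.arrow k (p.edge j) := by
  rcases d with _ | d
  · exact ⟨1, (one_mul _).symm⟩
  · rcases h : finPrev j with _ | i
    · exact ⟨0, by simp [segment, h]⟩
    · exact ⟨p.segment k d i, by simp [segment, h]⟩

theorem Path.segment_succ_of_prev (p : Q.Path l) {d : ℕ} {i j : Fin l}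
    (h : i.val + 1 = j.val) :
    p.segment k (d + 1) j = p.segment k d i * Q.arrow k (p.edge j) := by
  simp [segment, finPrev_eq_some.2 h]

theorem Path.segment_eq_zero (p : Q.Path l) {d : ℕ} {j : Fin l} (h : j.val < d) :
    p.segment k d j = 0 := by
  induction d generalizing j with
  | zero => omega
  | succ d ih =>
    rcases hj : finPrev j with _ | i
    · simp [segment, hj]
    · have := finPrev_eq_some.1 hj
      rw [p.segment_succ_of_prev this, ih (by omega), zero_mul]

theorem Path.segment_mul_idempotent (p : Q.Path l) (d : ℕ) (j : Fin l) :
    p.segment k d j * Q.idempotent k (p.vertex j.succ) = p.segment k d j := by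
  obtain ⟨x, hx⟩ := p.segment_eq_mul_arrow (k := k) d j
  rw [hx, mul_assoc, ← p.tgt_edge, arrow_mul_idempotent_tgt]

theorem Path.segment_mul_idempotent_of_ne (p : Q.Path l) (d : ℕ) {j : Fin l} {v : Q.V}
    (h : p.vertex j.succ ≠ v) : p.segment k d j * Q.idempotent k v = 0 := by
  obtain ⟨x, hx⟩ := p.segment_eq_mul_arrow (k := k) d j
  rw [hx, mul_assoc, arrow_mul_idempotent_of_ne (by rwa [p.tgt_edge]), mul_zero]

/-- The trivial paths and the subpaths of the path `p`. -/
def Path.spanning (k : Type u) [Field k] (p : Q.Path l) :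
    Q.V ⊕ (Fin l × Fin l) → Q.Alg k :=
  Sum.elim (Q.idempotent k) fun x => p.segment k x.1 x.2

namespace Path.IsGlued

variable {p : Q.Path l} {γ : Equiv.Perm (Fin (l + 1))} (hp : p.IsGlued γ)
include hp

theorem isFree : p.IsFree := fun s t hst h => ((hp.rel_iff s t).1 h).2 hst

theorem arrow_mul_arrow {i j : Fin l} (h : i.val + 1 ≠ j.val) :
    Q.arrow k (p.edge i) * Q.arrow k (p.edge j) = 0 := by
  by_cases hv : p.vertex i.succ = p.vertex j.castSucc
  · exact arrow_mul_arrow_of_rel ((hp.rel_iff i j).2 ⟨hv, h.symm⟩)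
  · exact arrow_mul_arrow_of_ne (by rwa [p.tgt_edge, p.src_edge])

theorem segment_mul_arrow {d : ℕ} {i j : Fin l} (h : j.val + 1 ≠ i.val) :
    p.segment k d j * Q.arrow k (p.edge i) = 0 := by
  obtain ⟨x, hx⟩ := p.segment_eq_mul_arrow (k := k) d j
  rw [hx, mul_assoc, hp.arrow_mul_arrow h, mul_zero]

/-- The span contains `1` and is stable under right multiplication by generators: a segment times an
arrow is a longer segment or zero. -/
theorem span_spanning : Submodule.span k (Set.range (p.spanning k)) = ⊤ := by
  have he : ∀ v, Q.idempotent k v ∈ Submodule.span k (Set.range (p.spanning k)) := fun v =>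
    Submodule.subset_span ⟨Sum.inl v, rfl⟩
  have hs : ∀ d j, p.segment k d j ∈ Submodule.span k (Set.range (p.spanning k)) := by
    intro d j
    -- Segments with more than `l` arrows vanish, so indices in `Fin l × Fin l` suffice.
    by_cases h : d < l
    · exact Submodule.subset_span ⟨Sum.inr (⟨d, h⟩, j), rfl⟩
    · rw [p.segment_eq_zero (by omega)]
      exact zero_mem _
  refine eq_top_of_mul_mem _ ?_ ?_ ?_
  · rw [← sum_idempotent]
    exact sum_mem fun v _ => he v
  · intro s h v
    suffices Submodule.span k (Set.range (p.spanning k)) ≤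
        (Submodule.span k (Set.range (p.spanning k))).comap
          (LinearMap.mulRight k (Q.idempotent k v)) from this h
    rw [Submodule.span_le]
    rintro _ ⟨w | ⟨d, j⟩, rfl⟩
    · change Q.idempotent k w * Q.idempotent k v ∈ Submodule.span k (Set.range (p.spanning k))
      by_cases hw : w = v
      · rw [hw, idempotent_mul_self]
        exact he v
      · rw [idempotent_mul_of_ne hw]
        exact zero_mem _
    · change p.segment k d j * Q.idempotent k v ∈ Submodule.span k (Set.range (p.spanning k))
      by_cases hw : p.vertex j.succ = v
      · rw [← hw, p.segment_mul_idempotent]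
        exact hs _ _
      · rw [p.segment_mul_idempotent_of_ne _ hw]
        exact zero_mem _
  · intro s h a
    obtain ⟨i, rfl⟩ := hp.edge_bijective.2 a
    suffices Submodule.span k (Set.range (p.spanning k)) ≤
        (Submodule.span k (Set.range (p.spanning k))).comap
          (LinearMap.mulRight k (Q.arrow k (p.edge i))) from this h
    rw [Submodule.span_le]
    rintro _ ⟨w | ⟨d, j⟩, rfl⟩
    · change Q.idempotent k w * Q.arrow k (p.edge i) ∈ Submodule.span k (Set.range (p.spanning k))
      by_cases hw : w = Q.src (p.edge i)
      · rw [hw, idempotent_src_mul_arrow]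
        exact hs 0 i
      · rw [idempotent_mul_arrow_of_ne hw]
        exact zero_mem _
    · change p.segment k d j * Q.arrow k (p.edge i) ∈ Submodule.span k (Set.range (p.spanning k))
      by_cases hw : j.val + 1 = i.val
      · rw [← p.segment_succ_of_prev hw]
        exact hs _ _
      · rw [hp.segment_mul_arrow hw]
        exact zero_mem _

theorem exists_eq_sum (a : Q.Alg k) : ∃ (c : Q.V → k) (b : Fin l × Fin l → k),
    a = ∑ v, c v • Q.idempotent k v + ∑ x, b x • p.segment k x.1 x.2 := by
  have h : a ∈ Submodule.span k (Set.range (p.spanning k)) := by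
    rw [hp.span_spanning]
    trivial
  obtain ⟨c, rfl⟩ := (Submodule.mem_span_range_iff_exists_fun k).1 h
  exact ⟨fun v => c (Sum.inl v), fun x => c (Sum.inr x), Fintype.sum_sum_type _⟩

theorem finite : Module.Finite k (Q.Alg k) :=
  ⟨Submodule.fg_def.2 ⟨_, Set.finite_range _, hp.span_spanning⟩⟩

/-- The representation by matrices. -/
def rep (k : Type u) [Field k] : Q.Alg k →ₐ[k] Matrix (Fin (l + 1)) (Fin (l + 1)) k :=
  p.stringRep k hp.isFree

theorem rep_arrow (s : Fin l) :
    hp.rep k (Q.arrow k (p.edge s)) = Matrix.single s.castSucc s.succ 1 := by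
  ext i j
  rw [rep, Path.stringRep_arrow, Path.arrowMatrix, Matrix.of_apply, Matrix.single_apply]
  congr 1
  simp only [hp.edge_bijective.1.eq_iff, eq_iff_iff]
  constructor
  · rintro ⟨t, rfl, rfl, rfl⟩
    exact ⟨rfl, rfl⟩
  · rintro ⟨rfl, rfl⟩
    exact ⟨s, rfl, rfl, rfl⟩

/-- The segment acts as the matrix unit in row `s - d` and column `s + 1`. The additive form also
gives zero when `s < d`. -/
theorem rep_segment (d : ℕ) (s : Fin l) (i j : Fin (l + 1)) :
    hp.rep k (p.segment k d s) i j = if i.val + d = s.val ∧ j = s.succ then 1 else 0 := by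
  induction d generalizing s i j with
  | zero =>
    rw [Path.segment, rep_arrow, Matrix.single_apply]
    congr 1
    simp only [Fin.ext_iff, eq_iff_iff]
    simp
    omega
  | succ d ih =>
    rcases hs : finPrev s with _ | t
    · have := finPrev_eq_none.1 hs
      rw [Path.segment, hs, if_neg (by omega)]
      simp
    · have := finPrev_eq_some.1 hs
      rw [p.segment_succ_of_prev this, map_mul, rep_arrow]
      by_cases hj : j = s.succ
      · subst hj
        have : t.succ = s.castSucc := Fin.ext (by simpa using this)
        rw [Matrix.mul_single_apply_same, ih, mul_one]
        congr 1
        simp only [this, eq_iff_iff, and_true]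
        omega
      · rw [Matrix.mul_single_apply_of_ne _ _ _ _ _ hj, if_neg (by tauto)]

open Classical in
theorem rep_sum (c : Q.V → k) (b : Fin l × Fin l → k) (i j : Fin (l + 1)) :
    hp.rep k (∑ v, c v • Q.idempotent k v + ∑ x, b x • p.segment k x.1 x.2) i j =
      (if i = j then c (p.vertex i) else 0) +
        ∑ x : Fin l × Fin l, if i.val + x.1.val = x.2.val ∧ j = x.2.succ then b x else 0 := by
  simp only [map_add, map_sum, map_smul, Matrix.add_apply, Matrix.sum_apply, Matrix.smul_apply,
    rep_segment, smul_eq_mul, mul_ite, mul_one, mul_zero]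
  congr 1
  simp only [rep, Path.stringRep_idempotent, Path.vertexMatrix, Matrix.diagonal_apply]
  split_ifs <;> simp

theorem rep_sum_diag (c : Q.V → k) (b : Fin l × Fin l → k) (i : Fin (l + 1)) :
    hp.rep k (∑ v, c v • Q.idempotent k v + ∑ x, b x • p.segment k x.1 x.2) i i =
      c (p.vertex i) := by
  rw [rep_sum, if_pos rfl, Finset.sum_eq_zero, add_zero]
  rintro ⟨d, s⟩ -
  rw [if_neg]
  rintro ⟨h, rfl⟩
  simp at h
  omega

theorem rep_sum_lower (c : Q.V → k) (b : Fin l × Fin l → k) {i j : Fin (l + 1)} (hij : j < i) :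
    hp.rep k (∑ v, c v • Q.idempotent k v + ∑ x, b x • p.segment k x.1 x.2) i j = 0 := by
  rw [rep_sum, if_neg hij.ne', Finset.sum_eq_zero, add_zero]
  rintro ⟨d, s⟩ -
  rw [if_neg]
  rintro ⟨h, rfl⟩
  simp [Fin.lt_def] at h hij
  omega

theorem rep_sum_upper (c : Q.V → k) (b : Fin l × Fin l → k) (i : Fin (l + 1)) (d s : Fin l)
    (h : i.val + d.val = s.val) :
    hp.rep k (∑ v, c v • Q.idempotent k v + ∑ x, b x • p.segment k x.1 x.2) i s.succ =
      b (d, s) := by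
  rw [rep_sum, if_neg (by simp [Fin.ext_iff]; omega), zero_add, Finset.sum_eq_single (d, s)]
  · rw [if_pos ⟨h, rfl⟩]
  · rintro ⟨d', s'⟩ - hne
    rw [if_neg]
    rintro ⟨h', hs⟩
    have := Fin.succ_injective _ hs
    subst this
    exact hne (by simp [Fin.ext_iff]; simp at h'; omega)
  · simp

theorem isGluedModel : IsGluedModel γ (hp.rep k) where
  injective := by
    rw [injective_iff_map_eq_zero]
    intro a ha
    obtain ⟨c, b, rfl⟩ := hp.exists_eq_sum a
    have hc : ∀ v, c v = 0 := by
      intro v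
      obtain ⟨i, rfl⟩ := hp.vertex_surjective v
      rw [← hp.rep_sum_diag c b, ha, Matrix.zero_apply]
    -- Only these products can be shown to vanish: for `s < d` the segment is zero and its
    -- coefficient is arbitrary.
    have hb : ∀ x : Fin l × Fin l, b x • p.segment k x.1 x.2 = 0 := by
      rintro ⟨d, s⟩
      by_cases h : d.val ≤ s.val
      · rw [← hp.rep_sum_upper c b ⟨s.val - d.val, by omega⟩ d s (by simp; omega), ha,
          Matrix.zero_apply, zero_smul]
      · rw [p.segment_eq_zero (by simpa using h), smul_zero]
    simp [hc, hb]
  mem_range := by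
    intro M
    constructor
    · rintro ⟨a, rfl⟩
      obtain ⟨c, b, rfl⟩ := hp.exists_eq_sum a
      refine ⟨fun i j hij => hp.rep_sum_lower c b hij, fun i => ?_⟩
      rw [rep_sum_diag, rep_sum_diag, (hp.vertex_eq i (γ i)).2 (Or.inr rfl)]
    · rintro ⟨hM, hγ⟩
      choose f hf using hp.vertex_surjective
      -- Each coefficient is the matrix entry at the position of its basis element; a vertex uses a
      -- chosen point `f v` above it, which is harmless by `hγ`.
      refine ⟨∑ v, M (f v) (f v) • Q.idempotent k v +
        ∑ x : Fin l × Fin l, (if h : x.1.val ≤ x.2.val then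
          M ⟨x.2.val - x.1.val, by omega⟩ x.2.succ else 0) • p.segment k x.1 x.2, ?_⟩
      ext i j
      rcases lt_trichotomy i j with h | rfl | h
      · obtain ⟨s, rfl⟩ := Fin.exists_succ_eq.2 (show j ≠ 0 by rintro rfl; simp at h)
        rw [Fin.lt_def, Fin.val_succ] at h
        rw [hp.rep_sum_upper _ (fun x : Fin l × Fin l => if h : x.1.val ≤ x.2.val then
          M ⟨x.2.val - x.1.val, by omega⟩ x.2.succ else 0) i ⟨s.val - i.val, by omega⟩ s
          (by simp; omega), dif_pos (by simp)]
        congr 1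
        ext
        simp
        omega
      · rw [hp.rep_sum_diag (fun v => M (f v) (f v))]
        rcases (hp.vertex_eq i (f (p.vertex i))).1 (hf _).symm with h | h
        · rw [h]
        · rw [h, ← hγ]
      · rw [hp.rep_sum_lower _ _ h, hM _ _ h]

end Path.IsGlued

end BoundQuiver

/-! ### Modules over a glued algebra -/

section RowModules

open Matrix

variable {k : Type u} [Field k] {n : ℕ} {A : Type u} [Ring A] [Algebra k A]

/-- The right `A`-module of row vectors. -/
@[nolint unusedArguments]
def RowModule (_ρ : A →ₐ[k] Matrix (Fin n) (Fin n) k) : Type u := Fin n → k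

variable (ρ : A →ₐ[k] Matrix (Fin n) (Fin n) k)

instance : AddCommGroup (RowModule ρ) := inferInstanceAs (AddCommGroup (Fin n → k))

variable {ρ} in
/-- The coordinates of a row vector. -/
def RowModule.coord (x : RowModule ρ) : Fin n → k := x

/-- The row vector with given coordinates. -/
def RowModule.of (x : Fin n → k) : RowModule ρ := x

instance : Module Aᵐᵒᵖ (RowModule ρ) where
  smul r x := RowModule.of ρ (x.coord ᵥ* ρ r.unop)
  one_smul x := (congrArg (vecMul x.coord) (map_one ρ)).trans (vecMul_one x.coord)
  mul_smul r s x := (congrArg (vecMul x.coord) (map_mul ρ s.unop r.unop)).trans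
    (vecMul_vecMul x.coord (ρ s.unop) (ρ r.unop)).symm
  smul_zero r := zero_vecMul (ρ r.unop)
  smul_add r x y := add_vecMul (ρ r.unop) x.coord y.coord
  add_smul r s x := (congrArg (vecMul x.coord) (map_add ρ r.unop s.unop)).trans
    (vecMul_add (ρ r.unop) (ρ s.unop) x.coord)
  zero_smul x := (congrArg (vecMul x.coord) (map_zero ρ)).trans (vecMul_zero x.coord)

namespace RowModule

variable {ρ}

@[simp]
theorem coord_of (x : Fin n → k) : (of ρ x).coord = x := rfl

@[simp]
theorem coord_smul (r : Aᵐᵒᵖ) (x : RowModule ρ) : (r • x).coord = x.coord ᵥ* ρ r.unop := rfl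

theorem coord_injective : Function.Injective (coord : RowModule ρ → Fin n → k) := fun _ _ h => h

end RowModule

/-- The projection of `A` to the `i`-th row. -/
def rowMap (i : Fin n) : A →ₗ[Aᵐᵒᵖ] RowModule ρ where
  toFun a := RowModule.of ρ (ρ a i)
  map_add' a b := congrFun (map_add ρ a b) i
  map_smul' r a := (congrFun (map_mul ρ a r.unop) i).trans (mul_apply_eq_vecMul _ _ _)

@[simp]
theorem coord_rowMap (i : Fin n) (a : A) : (rowMap ρ i a).coord = ρ a i := rfl

/-- Left multiplication, as a map of right modules. -/
def mulLeftHom (a : A) : A →ₗ[Aᵐᵒᵖ] A where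
  toFun b := a * b
  map_add' := mul_add a
  map_smul' r b := (mul_assoc a b r.unop).symm

namespace IsGluedModel

variable {ρ} {α : Equiv.Perm (Fin n)} (hρ : IsGluedModel α ρ)
include hρ

theorem lower (a : A) {i j : Fin n} (h : j < i) : ρ a i j = 0 :=
  ((hρ.mem_range _).1 ⟨a, rfl⟩).1 i j h

theorem diag (a : A) (i : Fin n) : ρ a (α i) (α i) = ρ a i i :=
  (((hρ.mem_range _).1 ⟨a, rfl⟩).2 i).symm

theorem diag_mul (a b : A) (i : Fin n) : ρ (a * b) i i = ρ a i i * ρ b i i := by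
  rw [map_mul, Matrix.mul_apply, Finset.sum_eq_single i]
  · intro j _ hj
    rcases lt_or_gt_of_ne hj with h | h
    · rw [hρ.lower a h, zero_mul]
    · rw [hρ.lower b h, mul_zero]
  · simp

theorem ext {a b : A} (h : ∀ i j, ρ a i j = ρ b i j) : a = b :=
  hρ.injective (Matrix.ext h)

/-- The element with the given matrix. -/
def ofMatrix (M : Matrix (Fin n) (Fin n) k)
    (hM : (∀ i j, j < i → M i j = 0) ∧ ∀ i, M i i = M (α i) (α i)) : A :=
  ((hρ.mem_range M).2 hM).choose

@[simp]
theorem rho_ofMatrix (M : Matrix (Fin n) (Fin n) k)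
    (hM : (∀ i j, j < i → M i j = 0) ∧ ∀ i, M i i = M (α i) (α i)) :
    ρ (hρ.ofMatrix M hM) = M :=
  ((hρ.mem_range M).2 hM).choose_spec

/-- The submodule of row vectors supported in columns `≥ i`. -/
def tail (i : Fin n) : Submodule Aᵐᵒᵖ (RowModule ρ) where
  carrier := {x | ∀ j < i, x.coord j = 0}
  add_mem' {x y} hx hy j hj := by
    change x.coord j + y.coord j = 0
    rw [hx j hj, hy j hj, add_zero]
  zero_mem' j _ := rfl
  smul_mem' r x hx j hj := by
    rw [RowModule.coord_smul, vecMul_eq_sum, Finset.sum_apply]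
    refine Finset.sum_eq_zero fun m _ => ?_
    simp only [Pi.smul_apply, smul_eq_mul]
    rcases lt_or_ge m i with h | h
    · rw [hx m h, zero_mul]
    · rw [hρ.lower _ (hj.trans_le h), mul_zero]

theorem smul_apply_self {i : Fin n} (r : Aᵐᵒᵖ) (x : hρ.tail i) :
    (r • x : hρ.tail i).1.coord i = x.1.coord i * ρ r.unop i i := by
  rw [Submodule.coe_smul, RowModule.coord_smul, vecMul_eq_sum, Finset.sum_apply, Finset.sum_eq_single i]
  · simp
  · intro j _ hj
    simp only [Pi.smul_apply, smul_eq_mul]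
    rcases lt_or_gt_of_ne hj with h | h
    · rw [x.2 j h, zero_mul]
    · rw [hρ.lower _ h, mul_zero]
  · simp

/-- The elements with zero diagonal, as a right ideal. -/
def radical : Submodule Aᵐᵒᵖ A where
  carrier := {a | ∀ i, ρ a i i = 0}
  add_mem' {x y} hx hy i := by rw [map_add, Matrix.add_apply, hx, hy, add_zero]
  zero_mem' i := by rw [map_zero, Matrix.zero_apply]
  smul_mem' r x hx i := by
    change ρ (x * r.unop) i i = 0
    rw [hρ.diag_mul, hx, zero_mul]

theorem mem_radical {a : A} : a ∈ hρ.radical ↔ ∀ i, ρ a i i = 0 := Iff.rfl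

theorem mul_mem_radical (a : A) {b : A} (hb : b ∈ hρ.radical) : a * b ∈ hρ.radical := fun i => by
  rw [hρ.diag_mul, hb i, mul_zero]

theorem mk_eq_mk {a b : A} :
    (Submodule.Quotient.mk a : A ⧸ hρ.radical) = Submodule.Quotient.mk b ↔
      ∀ i, ρ a i i = ρ b i i := by
  rw [Submodule.Quotient.eq, hρ.mem_radical]
  simp only [map_sub, Matrix.sub_apply, sub_eq_zero]

/-- The strictly upper triangular elements form a two-sided ideal, so they kill the quotient from
the right. -/
theorem op_smul_eq_zero {b : A} (hb : b ∈ hρ.radical) (y : A ⧸ hρ.radical) :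
    MulOpposite.op b • y = 0 := by
  obtain ⟨a, rfl⟩ := Submodule.Quotient.mk_surjective _ y
  exact (Submodule.Quotient.mk_eq_zero _).2 (hρ.mul_mem_radical a hb)

/-- Left multiplication on the quotient by the radical. -/
def leftMul (a : A) : A ⧸ hρ.radical →ₗ[Aᵐᵒᵖ] A ⧸ hρ.radical :=
  Submodule.mapQ _ _ (mulLeftHom a) fun _ hb => hρ.mul_mem_radical a hb

theorem leftMul_mk (a b : A) : hρ.leftMul a (Submodule.Quotient.mk b) =
    Submodule.Quotient.mk (a * b) := rfl

/-- The element whose only nonzero row is the row `s`, with entries `x`. -/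
def ofRow {s i : Fin n} (h : s < i) (x : hρ.tail i) : A :=
  hρ.ofMatrix (Matrix.of fun a b => if a = s then x.1.coord b else 0) <| by
    have h0 : ∀ a b, b ≤ a → (if a = s then x.1.coord b else 0) = 0 := by
      intro a b hab
      split_ifs with ha
      · exact x.2 b (by subst ha; exact hab.trans_lt h)
      · rfl
    exact ⟨fun a b hab => h0 a b hab.le, fun a => (h0 a a le_rfl).trans (h0 _ _ le_rfl).symm⟩

theorem rho_ofRow {s i : Fin n} (h : s < i) (x : hρ.tail i) (a b : Fin n) :
    ρ (hρ.ofRow h x) a b = if a = s then x.1.coord b else 0 := by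
  rw [ofRow, rho_ofMatrix, Matrix.of_apply]

/-- The embedding of a module of row vectors as a right ideal. -/
def inc {s i : Fin n} (h : s < i) : hρ.tail i →ₗ[Aᵐᵒᵖ] A where
  toFun x := hρ.ofRow h x
  map_add' x y := hρ.ext fun a b => by
    rw [map_add, Matrix.add_apply, rho_ofRow, rho_ofRow, rho_ofRow]
    split_ifs
    · rfl
    · rw [add_zero]
  map_smul' r x := hρ.ext fun a b => by
    change _ = ρ (_ * r.unop) a b
    rw [map_mul, Matrix.mul_apply, rho_ofRow]
    simp only [rho_ofRow]
    split_ifs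
    · rfl
    · simp

theorem rho_inc {s i : Fin n} (h : s < i) (x : hρ.tail i) (a b : Fin n) :
    ρ (hρ.inc h x) a b = if a = s then x.1.coord b else 0 := hρ.rho_ofRow h x a b

theorem inc_mem_radical {s i : Fin n} (h : s < i) (x : hρ.tail i) : hρ.inc h x ∈ hρ.radical := by
  intro a
  rw [rho_inc]
  split_ifs with ha
  · exact x.2 a (by rwa [ha])
  · rfl

variable (hα : ∀ i, α (α i) = i) (hα' : ∀ i, α i ≠ i)

/-- An algebra element with `i`-th row `x`. -/
def liftRow (hα : ∀ i, α (α i) = i) (hα' : ∀ i, α i ≠ i) (i : Fin n) (x : hρ.tail i) : A :=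
  hρ.ofMatrix (Matrix.of fun a b => if a = i then x.1.coord b else
      if a = α i ∧ b = α i then x.1.coord i else 0) ⟨fun a b hab => by
    rw [Matrix.of_apply]
    split_ifs with h₁ h₂
    · exact x.2 b (h₁ ▸ hab)
    · rw [h₂.1, h₂.2] at hab
      exact absurd hab (lt_irrefl _)
    · rfl, fun a => by
    simp only [Matrix.of_apply, and_self]
    by_cases h₁ : a = i
    · subst h₁
      simp [hα' a]
    · have h₃ : α a ≠ α i := fun h => h₁ (α.injective h)
      by_cases h₂ : a = α i
      · subst h₂
        simp [hα, hα' i]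
      · have : α a ≠ i := fun h => h₂ (by rw [← h, hα])
        simp [h₁, h₂, h₃, this]⟩

include hα hα'

theorem rho_liftRow (i : Fin n) (x : hρ.tail i) (a b : Fin n) :
    ρ (hρ.liftRow hα hα' i x) a b = if a = i then x.1.coord b else
      if a = α i ∧ b = α i then x.1.coord i else 0 := by
  rw [liftRow, rho_ofMatrix, Matrix.of_apply]

theorem rho_liftRow_diag (i : Fin n) (x : hρ.tail i) (a : Fin n) :
    ρ (hρ.liftRow hα hα' i x) a a = if a = i ∨ a = α i then x.1.coord i else 0 := by
  rw [rho_liftRow]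
  by_cases h : a = i
  · simp [h]
  · simp [h]

omit hα hα' in
/-- The unit vector at `i`. -/
def unit (i : Fin n) : hρ.tail i :=
  ⟨RowModule.of ρ (Pi.single i 1), fun _ hj => Pi.single_eq_of_ne hj.ne 1⟩

/-- The trivial path at the vertex containing `i`. -/
def idem (hα : ∀ i, α (α i) = i) (hα' : ∀ i, α i ≠ i) (i : Fin n) : A :=
  hρ.liftRow hα hα' i (hρ.unit i)

theorem rho_idem (i : Fin n) : ρ (hρ.idem hα hα' i) =
    Matrix.diagonal fun j => if j = i ∨ j = α i then 1 else 0 := by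
  ext a b
  rw [idem, rho_liftRow, Matrix.diagonal_apply]
  change (if a = i then (Pi.single i 1 : Fin n → k) b else
    if a = α i ∧ b = α i then (Pi.single i 1 : Fin n → k) i else 0) = _
  by_cases h : a = i
  · subst h
    simp [Pi.single_apply, eq_comm]
  · by_cases h' : a = α i
    · subst h'
      simp [h, eq_comm]
    · simp [h, h']

theorem rho_idem_diag (i j : Fin n) :
    ρ (hρ.idem hα hα' i) j j = if j = i ∨ j = α i then 1 else 0 := by
  rw [rho_idem, Matrix.diagonal_apply_eq]

theorem rho_idem_mul (i : Fin n) (a : A) (b c : Fin n) :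
    ρ (hρ.idem hα hα' i * a) b c = if b = i ∨ b = α i then ρ a b c else 0 := by
  rw [map_mul, rho_idem, Matrix.diagonal_mul, ite_mul, one_mul, zero_mul]

end IsGluedModel

end RowModules

/-! ### Maps from row modules to the top, and projective covers of row modules -/

section RowModules

open Matrix

variable {k : Type u} [Field k] {n : ℕ} {A : Type u} [Ring A] [Algebra k A]
  {ρ : A →ₐ[k] Matrix (Fin n) (Fin n) k}

/-- A ring as a right module over itself. -/
def unopLinearEquiv (A : Type u) [Ring A] : Aᵐᵒᵖ ≃ₗ[Aᵐᵒᵖ] A where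
  toFun := MulOpposite.unop
  invFun := MulOpposite.op
  map_add' _ _ := rfl
  map_smul' _ _ := rfl
  left_inv _ := rfl
  right_inv _ := rfl

instance projective_op (A : Type u) [Ring A] : Module.Projective Aᵐᵒᵖ A :=
  Module.Projective.of_equiv (unopLinearEquiv A)

namespace IsGluedModel

variable {α : Equiv.Perm (Fin n)} (hρ : IsGluedModel α ρ) (hα : ∀ i, α (α i) = i)
  (hα' : ∀ i, α i ≠ i)

/-- The map to the top, sending `x` to `x i` times the trivial path at `i`. -/
def toTop (i : Fin n) : hρ.tail i →ₗ[Aᵐᵒᵖ] A ⧸ hρ.radical where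
  toFun x := Submodule.Quotient.mk (hρ.liftRow hα hα' i x)
  map_add' x y := by
    rw [← Submodule.Quotient.mk_add, hρ.mk_eq_mk]
    intro j
    rw [map_add, Matrix.add_apply, rho_liftRow_diag, rho_liftRow_diag, rho_liftRow_diag]
    split_ifs
    · rfl
    · rw [add_zero]
  map_smul' r x := by
    rw [RingHom.id_apply, ← Submodule.Quotient.mk_smul, hρ.mk_eq_mk]
    intro j
    change _ = ρ (_ * r.unop) j j
    rw [hρ.diag_mul, rho_liftRow_diag, rho_liftRow_diag, smul_apply_self]
    split_ifs with h
    · rcases h with rfl | rfl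
      · rfl
      · rw [hρ.diag]
    · rw [zero_mul]

theorem toTop_apply (i : Fin n) (x : hρ.tail i) :
    hρ.toTop hα hα' i x = Submodule.Quotient.mk (hρ.liftRow hα hα' i x) := rfl

/-- The unit vector generates `tail i`, so a homomorphism from `tail i` is determined by its value
there. -/
theorem unit_smul (i : Fin n) (x : hρ.tail i) :
    MulOpposite.op (hρ.liftRow hα hα' i x) • hρ.unit i = x := by
  apply Subtype.ext
  apply RowModule.coord_injective
  ext j
  change ((Pi.single i 1 : Fin n → k) ᵥ* ρ (hρ.liftRow hα hα' i x)) j = _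
  rw [Matrix.single_one_vecMul, Matrix.row_apply, rho_liftRow, if_pos rfl]

theorem mk_idem_mul {i : Fin n} {a : A} :
    Submodule.Quotient.mk (hρ.idem hα hα' i * a) = (Submodule.Quotient.mk
      (algebraMap k A (ρ a i i) * hρ.idem hα hα' i) : A ⧸ hρ.radical) := by
  rw [hρ.mk_eq_mk]
  intro j
  rw [hρ.diag_mul, hρ.diag_mul, rho_idem_diag, AlgHom.commutes, Matrix.algebraMap_matrix_apply,
    if_pos rfl]
  split_ifs with h
  · rcases h with rfl | rfl
    · simp
    · simp [hρ.diag]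
  · simp

theorem algebraMap_op_smul (c : k) (y : A ⧸ hρ.radical) (a : A)
    (h : y = Submodule.Quotient.mk a) :
    algebraMap k Aᵐᵒᵖ c • y = Submodule.Quotient.mk (algebraMap k A c * a) := by
  subst h
  rw [Algebra.commutes]
  rfl

/-- The image of the generator is fixed by the idempotent at `i`. Modulo the radical, `a * idem i`
depends only on the scalar `ρ a i i`. -/
theorem exists_eq_smul_toTop (i : Fin n) (h : hρ.tail i →ₗ[Aᵐᵒᵖ] A ⧸ hρ.radical) :
    ∃ c : k, ∀ x, h x = algebraMap k Aᵐᵒᵖ c • hρ.toTop hα hα' i x := by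
  obtain ⟨a, ha⟩ := Submodule.Quotient.mk_surjective _ (h (hρ.unit i))
  refine ⟨ρ a i i, fun x => ?_⟩
  have h1 : h (hρ.unit i) = Submodule.Quotient.mk (a * hρ.idem hα hα' i) := by
    conv_lhs => rw [← hρ.unit_smul hα hα' i (hρ.unit i), map_smul, ← ha]
    rfl
  rw [hρ.algebraMap_op_smul _ _ _ (hρ.toTop_apply hα hα' i x)]
  conv_lhs => rw [← hρ.unit_smul hα hα' i x, map_smul, h1]
  change Submodule.Quotient.mk (a * hρ.idem hα hα' i * hρ.liftRow hα hα' i x) = _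
  rw [hρ.mk_eq_mk]
  intro j
  rw [hρ.diag_mul, hρ.diag_mul, hρ.diag_mul, rho_idem_diag, rho_liftRow_diag, AlgHom.commutes,
    Matrix.algebraMap_matrix_apply, if_pos rfl]
  split_ifs with hj
  · rcases hj with rfl | rfl
    · simp
    · simp [hρ.diag]
  · simp

theorem mk_idem_ne_zero (i : Fin n) :
    (Submodule.Quotient.mk (hρ.idem hα hα' i) : A ⧸ hρ.radical) ≠ 0 := by
  rw [Ne, Submodule.Quotient.mk_eq_zero, hρ.mem_radical]
  intro h
  simpa [rho_idem_diag] using h i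

/-- The projective right ideal of the vertex containing `i`. -/
def cover (i : Fin n) : Submodule Aᵐᵒᵖ A where
  carrier := {a | ∀ j, j ≠ i → j ≠ α i → ∀ m, ρ a j m = 0}
  add_mem' {x y} hx hy j h h' m := by
    rw [map_add, Matrix.add_apply, hx j h h', hy j h h', add_zero]
  zero_mem' j _ _ m := by rw [map_zero, Matrix.zero_apply]
  smul_mem' r x hx j h h' m := by
    change ρ (x * r.unop) j m = 0
    rw [map_mul, Matrix.mul_apply]
    exact Finset.sum_eq_zero fun m' _ => by rw [hx j h h', zero_mul]

include hρ in
theorem idem_mul_mem_cover (i : Fin n) (a : A) : hρ.idem hα hα' i * a ∈ cover (ρ := ρ) (α := α) i := by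
  intro j h h' m
  rw [hρ.rho_idem_mul, if_neg (by tauto)]

theorem idem_mul_of_mem_cover {i : Fin n} {a : A} (ha : a ∈ cover (ρ := ρ) (α := α) i) :
    hρ.idem hα hα' i * a = a := by
  refine hρ.ext fun j m => ?_
  rw [hρ.rho_idem_mul]
  split_ifs with h
  · rfl
  · rw [ha j (by tauto) (by tauto)]

include hρ hα hα' in
theorem projective_cover (i : Fin n) : Module.Projective Aᵐᵒᵖ (cover (ρ := ρ) (α := α) i) :=
  Module.Projective.of_split (M := A) (cover i).subtype
    ((mulLeftHom (hρ.idem hα hα' i)).codRestrict _ (hρ.idem_mul_mem_cover hα hα' i))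
    (by
      ext x
      exact hρ.idem_mul_of_mem_cover hα hα' x.2)

/-- The projection to the `i`-th row. -/
def toTail (i : Fin n) : A →ₗ[Aᵐᵒᵖ] hρ.tail i :=
  (rowMap ρ i).codRestrict _ fun a _ hj => hρ.lower a hj

@[simp]
theorem coord_toTail (i : Fin n) (a : A) : (hρ.toTail i a).1.coord = ρ a i := rfl

include hα hα' in
theorem toTail_liftRow (i : Fin n) (x : hρ.tail i) :
    hρ.toTail i (hρ.liftRow hα hα' i x) = x := by
  apply Subtype.ext
  apply RowModule.coord_injective
  ext j
  rw [coord_toTail, rho_liftRow, if_pos rfl]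

theorem liftRow_mem_cover (i : Fin n) (x : hρ.tail i) :
    hρ.liftRow hα hα' i x ∈ cover (ρ := ρ) (α := α) i := by
  intro j h h' m
  rw [rho_liftRow, if_neg h, if_neg (by tauto)]

include hα hα' in
-- The section `liftRow` of the row projection must also put `x i` at the diagonal position of `α
-- i`. It is linear because the last row of a triangular matrix has only a diagonal entry, and
-- gluing equates that entry with the one at `i`.
theorem projective_tail {i : Fin n} (hi : ∀ j, j ≤ α i) :
    Module.Projective Aᵐᵒᵖ (hρ.tail i) :=
  Module.Projective.of_split (M := A)
    { toFun := hρ.liftRow hα hα' i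
      map_add' := fun x y => hρ.ext fun a b => by
        rw [map_add, Matrix.add_apply, rho_liftRow, rho_liftRow, rho_liftRow]
        split_ifs
        · rfl
        · rfl
        · rw [add_zero]
      map_smul' := fun r x => hρ.ext fun a b => by
        change _ = ρ (_ * r.unop) a b
        rw [map_mul, Matrix.mul_apply_eq_vecMul, rho_liftRow, smul_apply_self]
        by_cases h : a = i
        · have : ρ (hρ.liftRow hα hα' i x) a = x.1.coord := by
            ext c
            rw [rho_liftRow, if_pos h]
          rw [this, if_pos h]
          rfl
        · rw [if_neg h]
          by_cases h' : a = α i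
          · have : ρ (hρ.liftRow hα hα' i x) a = Pi.single (α i) (x.1.coord i) := by
              ext c
              rw [rho_liftRow, if_neg h, Pi.single_apply]
              simp [h']
            rw [this, Matrix.single_vecMul, Pi.smul_apply, Matrix.row_apply, smul_eq_mul]
            rcases eq_or_lt_of_le (hi b) with hb | hb
            · rw [if_pos ⟨h', hb⟩, hb, hρ.diag]
            · rw [if_neg (fun hh => hb.ne hh.2), hρ.lower _ hb, mul_zero]
          · have : ρ (hρ.liftRow hα hα' i x) a = 0 := by
              ext c
              rw [rho_liftRow, if_neg h, if_neg (fun hh => h' hh.1)]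
              rfl
            rw [this, Matrix.zero_vecMul, if_neg (fun hh => h' hh.1)]
            rfl }
    (hρ.toTail i) (by
      ext x : 1
      exact hρ.toTail_liftRow hα hα' i x)

/-- Right ideals of strictly upper triangular rows. -/
theorem inc_mem_cover {s t i : Fin n} (h : s < t) (hs : α i = s) (x : hρ.tail t) :
    hρ.inc h x ∈ cover (ρ := ρ) (α := α) i := by
  intro j _ h' m
  rw [rho_inc, if_neg (by rwa [← hs])]

/-- The inclusion of the kernel of the projection `coverTop`. -/
def coverInc {s t i : Fin n} (h : s < t) (hs : α i = s) :
    hρ.tail t →ₗ[Aᵐᵒᵖ] cover (ρ := ρ) (α := α) i :=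
  (hρ.inc h).codRestrict _ (hρ.inc_mem_cover h hs)

/-- The projection of the projective right ideal to its `i`-th row. -/
def coverTop (i : Fin n) : cover (ρ := ρ) (α := α) i →ₗ[Aᵐᵒᵖ] hρ.tail i :=
  hρ.toTail i ∘ₗ (cover i).subtype

include hα hα' in
theorem coverTop_surjective (i : Fin n) : Function.Surjective (hρ.coverTop i) := fun x =>
  ⟨⟨_, hρ.liftRow_mem_cover hα hα' i x⟩, hρ.toTail_liftRow hα hα' i x⟩

theorem inc_injective {s t : Fin n} (h : s < t) : Function.Injective (hρ.inc h) := by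
  intro x y hxy
  apply Subtype.ext
  apply RowModule.coord_injective
  ext j
  have := congrArg (fun a => ρ a s j) hxy
  simpa [rho_inc] using this

include hα' in
-- If row `i` vanishes, gluing kills the diagonal entry at `s = α i` too. What remains is row `s`,
-- supported from the next column `t` on.
theorem coverInc_exact {s t i : Fin n} (h : s < t) (hst : ∀ j, j ≤ s ∨ t ≤ j) (hs : α i = s) :
    Function.Exact (hρ.coverInc h hs) (hρ.coverTop i) := by
  intro y
  constructor
  · intro hy
    have hi : ∀ m, ρ y.1 i m = 0 := fun m => congrArg (fun x => x.1.coord m) hy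
    refine ⟨⟨RowModule.of ρ (ρ y.1 s), fun j hj => ?_⟩, Subtype.ext (hρ.ext fun a b => ?_)⟩
    · rw [RowModule.coord_of]
      rcases eq_or_lt_of_le ((hst j).resolve_right hj.not_ge) with h' | h'
      · rw [h', ← hs, hρ.diag, hi]
      · exact hρ.lower _ h'
    · change ρ (hρ.inc h _) a b = _
      rw [rho_inc]
      split_ifs with ha
      · rw [ha]
        rfl
      · by_cases hai : a = i
        · rw [hai, hi]
        · exact (y.2 a hai (by rwa [hs]) b).symm
  · rintro ⟨x, rfl⟩
    apply Subtype.ext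
    apply RowModule.coord_injective
    ext m
    change ρ (hρ.inc h x) i m = 0
    rw [rho_inc, if_neg]
    rintro rfl
    exact hα' _ hs

end IsGluedModel

end RowModules

theorem ModuleCat.hom_smul_apply' {k : Type w} [Field k] {R : Type u} [Ring R] [Algebra k R]
    {M N : ModuleCat.{v} R} (c : k) (f : M ⟶ N) (x : M) :
    (c • f).hom x = algebraMap k R c • f.hom x := rfl

theorem ModuleCat.projective_of {R : Type u} [Ring R] (M : Type u) [AddCommGroup M] [Module R M]
    (_ : Module.Projective R M) : Projective (ModuleCat.of R M) :=
  (IsProjective.iff_projective M).1 ‹_›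

/-! ### The radical of a glued algebra and the syzygies of its top -/

namespace IsGluedModel

variable {k : Type u} [Field k] {l : ℕ} {A : Type u} [Ring A] [Algebra k A]
  {ρ : A →ₐ[k] Matrix (Fin (l + 1)) (Fin (l + 1)) k} {α : Equiv.Perm (Fin (l + 1))}
  (hρ : IsGluedModel α ρ) (hα : ∀ i, α (α i) = i) (hα' : ∀ i, α i ≠ i)

/-- The top of the algebra, as a right module. -/
def top : ModuleCat.{u} Aᵐᵒᵖ := ModuleCat.of Aᵐᵒᵖ (A ⧸ hρ.radical)

/-- The class of an element in the top of the algebra. -/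
def topMk (a : A) : hρ.top := (Submodule.Quotient.mk a : A ⧸ hρ.radical)

theorem topMk_eq_topMk {a b : A} : hρ.topMk a = hρ.topMk b ↔ ∀ i, ρ a i i = ρ b i i :=
  hρ.mk_eq_mk

theorem topMk_surjective : Function.Surjective hρ.topMk := Submodule.Quotient.mk_surjective _

theorem op_smul_topMk_one (a : A) : MulOpposite.op a • hρ.topMk 1 = hρ.topMk a :=
  congrArg hρ.topMk (one_mul a)

theorem algebraMap_op_smul_topMk (c : k) (a : A) :
    algebraMap k Aᵐᵒᵖ c • hρ.topMk a = hρ.topMk (algebraMap k A c * a) :=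
  hρ.algebraMap_op_smul c _ a rfl

theorem topMk_sum {ι : Type*} (s : Finset ι) (f : ι → A) :
    hρ.topMk (∑ i ∈ s, f i) = ∑ i ∈ s, hρ.topMk (f i) := map_sum hρ.radical.mkQ f s

include hρ in
theorem hom_radical_eq_zero (h : A →ₗ[Aᵐᵒᵖ] A ⧸ hρ.radical) (x : A) (hx : x ∈ hρ.radical) :
    h x = 0 := by
  have : x = MulOpposite.op x • (1 : A) := (one_mul x).symm
  rw [this, map_smul, hρ.op_smul_eq_zero hx]

theorem rowMap_mem_tail {s : Fin l} {a : A} (ha : a ∈ hρ.radical) :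
    rowMap ρ s.castSucc a ∈ hρ.tail s.succ := by
  intro j hj
  rw [coord_rowMap]
  rcases eq_or_lt_of_le (Fin.le_castSucc_iff.2 hj) with h | h
  · rw [h, ha]
  · exact hρ.lower a h

/-- The components of the radical. -/
def radicalRow (s : Fin l) : hρ.radical →ₗ[Aᵐᵒᵖ] hρ.tail s.succ :=
  (rowMap ρ s.castSucc ∘ₗ hρ.radical.subtype).codRestrict _ fun a => hρ.rowMap_mem_tail a.2

@[simp]
theorem coord_radicalRow (s : Fin l) (a : hρ.radical) :
    (hρ.radicalRow s a).1.coord = ρ a.1 s.castSucc := rfl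

/-- The embeddings of the components of the radical. -/
def radicalInc (s : Fin l) : hρ.tail s.succ →ₗ[Aᵐᵒᵖ] hρ.radical :=
  (hρ.inc s.castSucc_lt_succ).codRestrict _ fun x => hρ.inc_mem_radical _ x

theorem rho_radicalInc (s : Fin l) (x : hρ.tail s.succ) (a b : Fin (l + 1)) :
    ρ (hρ.radicalInc s x).1 a b = if a = s.castSucc then x.1.coord b else 0 :=
  hρ.rho_inc _ x a b

theorem radicalRow_radicalInc (s : Fin l) (x : hρ.tail s.succ) :
    hρ.radicalRow s (hρ.radicalInc s x) = x := by
  apply Subtype.ext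
  apply RowModule.coord_injective
  ext j
  rw [coord_radicalRow, rho_radicalInc, if_pos rfl]

theorem radicalRow_radicalInc_of_ne {s t : Fin l} (h : s ≠ t) (x : hρ.tail s.succ) :
    hρ.radicalRow t (hρ.radicalInc s x) = 0 := by
  apply Subtype.ext
  apply RowModule.coord_injective
  ext j
  rw [coord_radicalRow, rho_radicalInc, if_neg fun h' => h (Fin.castSucc_injective _ h').symm]
  rfl

theorem sum_radicalInc_radicalRow (a : hρ.radical) :
    ∑ s, hρ.radicalInc s (hρ.radicalRow s a) = a := by
  apply Subtype.ext
  rw [AddSubmonoidClass.coe_finsetSum]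
  refine hρ.ext fun i j => ?_
  rw [map_sum, Matrix.sum_apply]
  simp only [rho_radicalInc, coord_radicalRow]
  induction i using Fin.lastCases with
  | last =>
    rw [Finset.sum_eq_zero fun s _ => if_neg (Fin.castSucc_lt_last s).ne']
    rcases eq_or_lt_of_le (Fin.le_last j) with h | h
    · rw [h, a.2]
    · rw [hρ.lower _ h]
  | cast i =>
    rw [Finset.sum_eq_single i]
    · rw [if_pos rfl]
    · intro s _ hs
      rw [if_neg fun h => hs (Fin.castSucc_injective _ h).symm]
    · simp

theorem radical_shortExact : (ShortComplex.mk (ModuleCat.ofHom hρ.radical.subtype)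
    (ModuleCat.ofHom hρ.radical.mkQ) (by ext x; simp)).ShortExact :=
  ModuleCat.shortComplex_shortExact _ (LinearMap.exact_subtype_mkQ _)
    (Submodule.subtype_injective _) (Submodule.mkQ_surjective _)

variable {E : Type} [Fintype E] [DecidableEq E] (e : E ≃ Fin l) (next : E → Option E)

/-- The syzygies of the top of a glued algebra. -/
def syzygySystem (hsome : ∀ a b, next a = some b → α (e a).succ = (e b).castSucc)
    (hnone : ∀ a, next a = none → α (e a).succ = Fin.last l) :
    SyzygySystem k hρ.top E where
  J := ModuleCat.of Aᵐᵒᵖ hρ.radical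
  P := ModuleCat.of Aᵐᵒᵖ A
  f := ModuleCat.ofHom hρ.radical.subtype
  g := ModuleCat.ofHom hρ.radical.mkQ
  w := by
    ext x : 2
    exact (Submodule.Quotient.mk_eq_zero _).2 x.2
  exact := hρ.radical_shortExact
  projective := ModuleCat.projective_of A inferInstance
  comp_eq_zero h := by
    ext x
    exact hρ.hom_radical_eq_zero h.hom x.1 x.2
  M a := ModuleCat.of Aᵐᵒᵖ (hρ.tail (e a).succ)
  ι a := ModuleCat.ofHom (hρ.radicalInc (e a))
  p a := ModuleCat.ofHom (hρ.radicalRow (e a))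
  ι_p a := by
    ext x : 2
    exact hρ.radicalRow_radicalInc (e a) x
  ι_p_of_ne a b h := by
    ext x : 2
    exact hρ.radicalRow_radicalInc_of_ne (e.injective.ne h) x
  total := by
    ext x : 2
    rw [ModuleCat.hom_sum, LinearMap.sum_apply]
    exact (e.sum_comp fun s => hρ.radicalInc s (hρ.radicalRow s x)).trans
      (hρ.sum_radicalInc_radicalRow x)
  π a := ModuleCat.ofHom (hρ.toTop hα hα' (e a).succ)
  π_ne_zero a h := hρ.mk_idem_ne_zero hα hα' (e a).succ
    (congrArg (fun f => f.hom (hρ.unit (e a).succ)) h)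
  π_span a h := by
    obtain ⟨c, hc⟩ := hρ.exists_eq_smul_toTop hα hα' (e a).succ h.hom
    refine ⟨c, ?_⟩
    ext x : 2
    exact hc x
  next := next
  terminal a ha := by
    refine ModuleCat.projective_of _ (hρ.projective_tail hα hα' ?_)
    rw [hnone a ha]
    exact Fin.le_last
  step a b hab := by
    have hs := hsome a b hab
    refine ⟨ModuleCat.of Aᵐᵒᵖ (cover (ρ := ρ) (α := α) (e a).succ),
      ModuleCat.ofHom (hρ.coverInc (e b).castSucc_lt_succ hs),
      ModuleCat.ofHom (hρ.coverTop (e a).succ), ModuleCat.ofHom (Submodule.subtype _), ?_, ?_,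
      ModuleCat.projective_of _ (hρ.projective_cover hα hα' _), ?_, ?_, ?_⟩
    · ext x : 2
      exact ((hρ.coverInc_exact hα' _ (fun j => by
        rw [Fin.le_castSucc_iff]
        exact lt_or_ge _ _) hs) _).2 ⟨x, rfl⟩
    · refine ModuleCat.shortComplex_shortExact _ (hρ.coverInc_exact hα' _ (fun j => by
        rw [Fin.le_castSucc_iff]
        exact lt_or_ge _ _) hs) ?_ (hρ.coverTop_surjective hα hα' _)
      intro x y hxy
      exact hρ.inc_injective _ (congrArg Subtype.val hxy)
    · rfl
    · ext x : 2
      -- Modulo the radical only the diagonal matters, and on the cover it is supported at `i` and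
      -- `α i`, where its two values agree.
      change Submodule.Quotient.mk x.1 = Submodule.Quotient.mk _
      rw [hρ.mk_eq_mk]
      intro j
      rw [rho_liftRow_diag]
      change _ = if _ then ρ x.1 (e a).succ (e a).succ else 0
      split_ifs with h
      · rcases h with rfl | rfl
        · rfl
        · rw [hρ.diag]
      · exact x.2 j (by tauto) (by tauto) j
    · intro h
      ext x : 2
      change h.hom (hρ.coverInc _ hs x) = 0
      -- The element is the idempotent generator of the cover times itself, a radical element; hence
      -- every map to the top kills it.
      have hx : hρ.coverInc (e b).castSucc_lt_succ hs x =
          MulOpposite.op (hρ.coverInc (e b).castSucc_lt_succ hs x).1 •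
            (⟨hρ.idem hα hα' (e a).succ * 1, hρ.idem_mul_mem_cover hα hα' _ 1⟩ :
              cover (ρ := ρ) (α := α) (e a).succ) := by
        apply Subtype.ext
        change _ = hρ.idem hα hα' _ * 1 * _
        rw [mul_one]
        exact (hρ.idem_mul_of_mem_cover hα hα' (Subtype.property _)).symm
      rw [hx, map_smul]
      exact hρ.op_smul_eq_zero (hρ.inc_mem_radical _ x) _

end IsGluedModel

/-! ### Identification of a Yoneda algebra with a glued algebra -/

section YonedaAlgebra

variable {C : Type u} [Category.{v} C] [Abelian C] [HasExt.{v} C]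

theorem yoneda_of_mul_of {X : C} {i j c : ℕ} (x : Ext.{v} X X i) (y : Ext.{v} X X j)
    (h : j + i = c) :
    (DirectSum.of (fun n : ℕ => Ext.{v} X X n) i x) * DirectSum.of (fun n : ℕ => Ext.{v} X X n) j y =
      DirectSum.of (fun n : ℕ => Ext.{v} X X n) c (y.comp x h) := by
  rw [DirectSum.of_mul_of]
  exact DirectSum.of_eq_of_gradedMonoid_eq (ext_mk_comp y x _ _)

variable {k : Type w} [Field k] [Linear k C]

/-- A complete family of orthogonal idempotents of `End X` indexed by the vertices of a glued
bound quiver, compatible with a system of syzygies of `X` indexed by the arrows. -/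
structure KoszulDatum {X : C} {l : ℕ} (D : SyzygySystem k X (Fin l)) {Q : BoundQuiver}
    (p : Q.Path l) where
  φ : Q.V → (X ⟶ X)
  next : D.next = finPrev
  comp_self : ∀ v, φ v ≫ φ v = φ v
  comp_of_ne : ∀ v w, v ≠ w → φ v ≫ φ w = 0
  total : ∑ v, φ v = 𝟙 X
  Θ_comp : ∀ s : Fin l, (D.Θ 0 s).comp (Ext.mk₀ (φ (p.vertex s.castSucc))) (add_zero (0 + 1)) =
    D.Θ 0 s
  comp_Θ : ∀ s : Fin l, (Ext.mk₀ (φ (p.vertex s.succ))).comp (D.Θ 0 s) (zero_add (0 + 1)) =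
    D.Θ 0 s
  span : ∀ h : X ⟶ X, ∃ c : Q.V → k, h = ∑ v, c v • φ v
  independent : ∀ c : Q.V → k, ∑ v, c v • φ v = 0 → ∀ v, c v = 0

namespace KoszulDatum

variable {X : C} {l : ℕ} {D : SyzygySystem k X (Fin l)} {Q : BoundQuiver} {p : Q.Path l}
  (K : KoszulDatum D p) {γ : Equiv.Perm (Fin (l + 1))} (hp : p.IsGlued γ)

include K in
-- The Yoneda product reverses `comp`, so the right-hand factor is performed first. With `next =
-- finPrev` this matches the recursion for `segment`.
theorem Θ_zero_mul_Θ (d : ℕ) {s t : Fin l} (h : t.val + 1 = s.val) :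
    DirectSum.of (fun n : ℕ => Ext.{v} X X n) (d + 1) (D.Θ d t) *
      DirectSum.of (fun n : ℕ => Ext.{v} X X n) (0 + 1) (D.Θ 0 s) =
        DirectSum.of (fun n : ℕ => Ext.{v} X X n) (d + 1 + 1) (D.Θ (d + 1) s) := by
  rw [yoneda_of_mul_of _ _ (by omega : 0 + 1 + (d + 1) = d + 1 + 1), D.Θ_zero_comp_Θ, K.next,
    if_pos (finPrev_eq_some.2 h)]

include K in
theorem Θ_zero_mul_Θ_of_ne (d : ℕ) {s t : Fin l} (h : t.val + 1 ≠ s.val) :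
    DirectSum.of (fun n : ℕ => Ext.{v} X X n) (d + 1) (D.Θ d t) *
      DirectSum.of (fun n : ℕ => Ext.{v} X X n) (0 + 1) (D.Θ 0 s) = 0 := by
  rw [yoneda_of_mul_of _ _ (by omega : 0 + 1 + (d + 1) = d + 1 + 1), D.Θ_zero_comp_Θ, K.next,
    if_neg (fun h' => h (finPrev_eq_some.1 h')), map_zero]

/-- The homomorphism to the Yoneda algebra. -/
def toYoneda : Q.Alg k →ₐ[k] ⨁ n : ℕ, Ext.{v} X X n :=
  BoundQuiver.lift
    (fun v => DirectSum.of (fun n : ℕ => Ext.{v} X X n) 0 (Ext.mk₀ (K.φ v)))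
    (fun a => DirectSum.of (fun n : ℕ => Ext.{v} X X n) (0 + 1)
      (D.Θ 0 ((Equiv.ofBijective p.edge hp.edge_bijective).symm a)))
    (fun v => by
      rw [yoneda_of_mul_of _ _ (zero_add 0), Ext.mk₀_comp_mk₀, K.comp_self])
    (fun v w h => by
      rw [yoneda_of_mul_of _ _ (zero_add 0), Ext.mk₀_comp_mk₀, K.comp_of_ne _ _ h.symm,
        Ext.mk₀_zero, map_zero])
    (by
      rw [← map_sum, show ∑ v, Ext.mk₀ (K.φ v) = Ext.mk₀ (∑ v, K.φ v) from
        (map_sum (Ext.addEquiv₀ (X := X) (Y := X)).symm _ _).symm, K.total]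
      rfl)
    (fun a => by
      obtain ⟨s, rfl⟩ := hp.edge_bijective.2 a
      rw [yoneda_of_mul_of _ _ (add_zero (0 + 1)), Equiv.ofBijective_symm_apply_apply, p.src_edge,
        K.Θ_comp])
    (fun a => by
      obtain ⟨s, rfl⟩ := hp.edge_bijective.2 a
      rw [yoneda_of_mul_of _ _ (zero_add (0 + 1)), Equiv.ofBijective_symm_apply_apply, p.tgt_edge,
        K.comp_Θ])
    (fun a b h => by
      obtain ⟨s, rfl⟩ := hp.edge_bijective.2 a
      obtain ⟨t, rfl⟩ := hp.edge_bijective.2 b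
      rw [Equiv.ofBijective_symm_apply_apply, Equiv.ofBijective_symm_apply_apply]
      exact K.Θ_zero_mul_Θ_of_ne 0 fun h' => ((hp.rel_iff s t).1 h).2 h'.symm)

theorem toYoneda_idempotent (v : Q.V) : K.toYoneda hp (Q.idempotent k v) =
    DirectSum.of (fun n : ℕ => Ext.{v} X X n) 0 (Ext.mk₀ (K.φ v)) :=
  BoundQuiver.lift_idempotent ..

theorem toYoneda_arrow (s : Fin l) : K.toYoneda hp (Q.arrow k (p.edge s)) =
    DirectSum.of (fun n : ℕ => Ext.{v} X X n) (0 + 1) (D.Θ 0 s) := by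
  refine (BoundQuiver.lift_arrow ..).trans ?_
  rw [Equiv.ofBijective_symm_apply_apply]

include K in
theorem alive_iff {d : ℕ} {s : Fin l} : D.Alive d s ↔ d ≤ s.val := by
  induction d generalizing s with
  | zero => simp [SyzygySystem.Alive]
  | succ d ih =>
    simp only [SyzygySystem.Alive, K.next, finPrev_eq_some, ih]
    constructor
    · rintro ⟨t, h, h'⟩
      omega
    · intro h
      exact ⟨⟨s.val - 1, by omega⟩, by simp; omega, by simp; omega⟩

theorem toYoneda_segment (d : ℕ) (s : Fin l) : K.toYoneda hp (p.segment k d s) =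
    DirectSum.of (fun n : ℕ => Ext.{v} X X n) (d + 1) (D.Θ d s) := by
  induction d generalizing s with
  | zero => exact K.toYoneda_arrow hp s
  | succ d ih =>
    rcases hs : finPrev s with _ | t
    · have : ¬ D.Alive (d + 1) s := by
        rw [K.alive_iff, finPrev_eq_none.1 hs]
        omega
      rw [BoundQuiver.Path.segment, hs, D.Θ_eq_zero this, map_zero]
      exact map_zero _
    · have := finPrev_eq_some.1 hs
      rw [p.segment_succ_of_prev this, map_mul, ih, toYoneda_arrow, K.Θ_zero_mul_Θ d this]

theorem toYoneda_surjective : Function.Surjective (K.toYoneda hp) := by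
  intro x
  change x ∈ (K.toYoneda hp).range
  induction x using DirectSum.induction_on with
  | zero => exact zero_mem _
  | add x y hx hy => exact add_mem hx hy
  | of n x =>
    rcases n with _ | d
    · obtain ⟨h, rfl⟩ := (Ext.mk₀_bijective _ _).2 x
      obtain ⟨c, rfl⟩ := K.span h
      refine ⟨∑ v, c v • Q.idempotent k v, ?_⟩
      rw [show Ext.mk₀ (∑ v, c v • K.φ v) = ∑ v, Ext.mk₀ (c v • K.φ v) from
        (map_sum (Ext.addEquiv₀ (X := X) (Y := X)).symm _ _)]
      change K.toYoneda hp _ = _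
      rw [map_sum, map_sum]
      refine Finset.sum_congr rfl fun v _ => ?_
      rw [map_smul, toYoneda_idempotent, Ext.mk₀_smul]
      exact (map_smul (DirectSum.lof k ℕ (fun n : ℕ => Ext.{v} X X n) 0) _ _).symm
    · obtain ⟨c, rfl⟩ := D.exists_eq_sum_smul_Θ d x
      refine ⟨∑ s, c s • p.segment k d s, ?_⟩
      change K.toYoneda hp _ = _
      rw [map_sum, map_sum]
      refine Finset.sum_congr rfl fun v _ => ?_
      rw [map_smul, toYoneda_segment]
      exact (map_smul (DirectSum.lof k ℕ (fun n : ℕ => Ext.{v} X X n) (d + 1)) _ _).symm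

/-- Homogeneous components separate the coefficients: degree zero gives `c`, degree `d + 1` gives
the `b (d, s)` with `d ≤ s`. The other coefficients multiply zero segments. -/
theorem toYoneda_injective : Function.Injective (K.toYoneda hp) := by
  rw [injective_iff_map_eq_zero]
  intro a ha
  obtain ⟨c, b, rfl⟩ := hp.exists_eq_sum a
  simp only [map_add, map_sum, map_smul, toYoneda_idempotent, toYoneda_segment] at ha
  have hn : ∀ n, ∑ v, c v • (DirectSum.of (fun n : ℕ => Ext.{v} X X n) 0 (Ext.mk₀ (K.φ v))) n +
      ∑ x : Fin l × Fin l, b x •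
        (DirectSum.of (fun n : ℕ => Ext.{v} X X n) (x.1.val + 1) (D.Θ x.1.val x.2)) n = 0 := by
    intro n
    have := congrArg (fun x : ⨁ n : ℕ, Ext.{v} X X n => DirectSum.component k ℕ _ n x) ha
    simp only [map_add, map_sum, map_smul, map_zero] at this
    exact this
  have hc : ∀ v, c v = 0 := by
    have h0 := hn 0
    rw [Finset.sum_eq_zero (s := (Finset.univ : Finset (Fin l × Fin l))) fun x _ => by
      rw [DirectSum.of_eq_of_ne _ _ _ (by omega), smul_zero], add_zero] at h0
    simp only [DirectSum.of_eq_same, ← Ext.mk₀_smul] at h0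
    rw [show ∑ v, Ext.mk₀ (c v • K.φ v) = Ext.mk₀ (∑ v, c v • K.φ v) from
      (map_sum (Ext.addEquiv₀ (X := X) (Y := X)).symm _ _).symm, Ext.mk₀_eq_zero_iff] at h0
    exact K.independent c h0
  have hb : ∀ d s : Fin l, b (d, s) • p.segment k d.val s = 0 := by
    intro d s
    have h0 := hn (d.val + 1)
    rw [Finset.sum_eq_zero (s := (Finset.univ : Finset Q.V)) fun v _ => by
      rw [hc v, zero_smul], zero_add, Fintype.sum_prod_type, Finset.sum_eq_single d] at h0
    · simp only [DirectSum.of_eq_same] at h0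
      by_cases hd : d.val ≤ s.val
      · rw [D.eq_zero_of_sum_smul_Θ (c := fun s => b (d, s)) h0 (K.alive_iff.2 hd), zero_smul]
      · rw [p.segment_eq_zero (not_le.1 hd), smul_zero]
    · intro d' _ hd'
      refine Finset.sum_eq_zero fun s _ => ?_
      rw [DirectSum.of_eq_of_ne _ _ _ (by simpa [Fin.ext_iff, eq_comm] using hd'), smul_zero]
    · simp
  rw [Finset.sum_eq_zero fun v _ => by rw [hc v, zero_smul],
    Finset.sum_eq_zero fun x _ => hb x.1 x.2, add_zero]

/-- The Yoneda algebra is the algebra of a glued bound quiver. -/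
def yonedaEquiv : Q.Alg k ≃ₐ[k] ⨁ n : ℕ, Ext.{v} X X n :=
  AlgEquiv.ofBijective (K.toYoneda hp) ⟨K.toYoneda_injective hp, K.toYoneda_surjective hp⟩

end KoszulDatum

/-- Nonzero classes in distinct degrees are linearly independent. -/
theorem not_finite_of_ext_ne_zero {X : C}
    (h : ∀ d, ∃ x : Ext.{v} X X (d + 1), x ≠ 0) :
    ¬ Module.Finite k (⨁ n : ℕ, Ext.{v} X X n) := by
  intro hfin
  choose x hx using h
  have hli : LinearIndependent k fun d => DirectSum.of (fun n : ℕ => Ext.{v} X X n) (d + 1) (x d) := by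
    rw [linearIndependent_iff']
    intro s g hg d hd
    have := congrArg (fun x : ⨁ n : ℕ, Ext.{v} X X n => DirectSum.component k ℕ _ (d + 1) x) hg
    simp only [map_sum, map_smul, map_zero] at this
    rw [Finset.sum_eq_single d] at this
    · have h1 : g d • (DirectSum.of (fun n : ℕ => Ext.{v} X X n) (d + 1) (x d)) (d + 1) = 0 := this
      rw [DirectSum.of_eq_same] at h1
      exact (smul_eq_zero.1 h1).resolve_right (hx d)
    · intro d' _ hd'
      change g d' • (DirectSum.of (fun n : ℕ => Ext.{v} X X n) (d' + 1) (x d')) (d + 1) = 0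
      rw [DirectSum.of_eq_of_ne _ _ _ (by omega), smul_zero]
    · exact fun h => absurd hd h
  have := hli.finite
  exact Infinite.not_finite this

end YonedaAlgebra

/-! ### The dual of a maximal chord diagram -/

namespace QuasiDiagram

theorem IsQuasiDiagram.apply_apply {n : ℕ} {α : Equiv.Perm (Fin n)} (h : IsQuasiDiagram α)
    (i : Fin n) : α (α i) = i := congrArg (fun f : Equiv.Perm (Fin n) => f i) h

theorem IsChordDiagram.apply_apply {n : ℕ} {α : Equiv.Perm (Fin n)} (h : IsChordDiagram α)
    (i : Fin n) : α (α i) = i := h.1.apply_apply i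

theorem IsChordDiagram.apply_ne {n : ℕ} {α : Equiv.Perm (Fin n)} (h : IsChordDiagram α)
    (i : Fin n) : α i ≠ i := h.2 i

variable {l : ℕ} {α : Equiv.Perm (Fin (l + 1))}

theorem isMaximal_iff :
    IsMaximal α ↔ ∀ i j, (finRotate (l + 1) * α).SameCycle i j := by
  rw [IsMaximal, Nat.card_eq_one_iff_unique]
  constructor
  · rintro ⟨h, -⟩ i j
    exact Quotient.exact (h.elim (Quotient.mk _ i) (Quotient.mk _ j))
  · intro h
    refine ⟨⟨fun x y => ?_⟩, ⟨Quotient.mk _ 0⟩⟩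
    induction x using Quotient.inductionOn
    induction y using Quotient.inductionOn
    exact Quotient.sound (h _ _)

theorem finRotate_castSucc (s : Fin l) : finRotate (l + 1) s.castSucc = s.succ := by
  rw [finRotate_apply, Fin.coeSucc_eq_succ]

theorem finRotate_pow_zero (j : Fin (l + 1)) : (finRotate (l + 1) ^ j.val) 0 = j := by
  induction j using Fin.induction with
  | zero => rfl
  | succ s ih =>
    rw [Fin.val_succ, pow_succ', Equiv.Perm.mul_apply]
    rw [Fin.val_castSucc] at ih
    rw [ih, finRotate_castSucc]

theorem finRotate_pow_sub (j : Fin (l + 1)) :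
    (finRotate (l + 1) ^ (l - j.val)) j = Fin.last l := by
  conv_lhs => rw [← finRotate_pow_zero j]
  rw [← Equiv.Perm.mul_apply, ← pow_add, finRotate_pow_zero, Nat.sub_add_cancel (by omega)]
  exact finRotate_pow_zero (Fin.last l)

theorem isCycleOn_of_isMaximal (h : IsMaximal α) :
    (finRotate (l + 1) * α).IsCycleOn (Finset.univ : Finset (Fin (l + 1))) := by
  refine ⟨?_, fun i _ j _ => isMaximal_iff.1 h i j⟩
  rw [Finset.coe_univ, Set.bijOn_univ]
  exact Equiv.bijective _

/-- The points in the order in which the single face of `α` is traversed, ending with `0`. -/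
def faceWalk (h : IsMaximal α) : Equiv.Perm (Fin (l + 1)) :=
  Equiv.ofBijective (fun j => ((finRotate (l + 1) * α) ^ (l - j.val)) 0) <| by
    refine Finite.surjective_iff_bijective.1 fun i => ?_
    obtain ⟨m, hm, hi⟩ := (isCycleOn_of_isMaximal h).exists_pow_eq (Finset.mem_univ 0)
      (Finset.mem_univ i)
    rw [Finset.card_univ, Fintype.card_fin] at hm
    -- The walk is numbered backwards: position `j` carries the exponent `l - j`.
    refine ⟨⟨l - m, by omega⟩, ?_⟩
    rw [← hi]
    congr 2
    simp only
    omega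

theorem faceWalk_apply (h : IsMaximal α) (j : Fin (l + 1)) :
    faceWalk h j = ((finRotate (l + 1) * α) ^ (l - j.val)) 0 := rfl

theorem faceWalk_last (h : IsMaximal α) : faceWalk h (Fin.last l) = 0 := by
  simp [faceWalk_apply]

theorem face_faceWalk_succ (h : IsMaximal α) (s : Fin l) :
    finRotate (l + 1) (α (faceWalk h s.succ)) = faceWalk h s.castSucc := by
  rw [faceWalk_apply, faceWalk_apply, ← Equiv.Perm.mul_apply, ← Equiv.Perm.mul_apply, ← pow_succ']
  congr 2
  simp
  omega

theorem face_faceWalk_zero (h : IsMaximal α) :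
    finRotate (l + 1) (α (faceWalk h 0)) = 0 := by
  rw [faceWalk_apply, ← Equiv.Perm.mul_apply, ← Equiv.Perm.mul_apply, ← pow_succ']
  have := (isCycleOn_of_isMaximal h).pow_card_apply (Finset.mem_univ 0)
  rwa [Finset.card_univ, Fintype.card_fin] at this

/-- The cyclic form, including the wrap-around from the last position to `0`; both duality and
parity rest on it. -/
theorem face_faceWalk_finRotate (h : IsMaximal α) (j : Fin (l + 1)) :
    finRotate (l + 1) (α (faceWalk h (finRotate (l + 1) j))) = faceWalk h j := by
  induction j using Fin.lastCases with
  | last => rw [finRotate_last, face_faceWalk_zero, faceWalk_last]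
  | cast s => rw [finRotate_castSucc, face_faceWalk_succ]

/-- The diagram obtained by relabelling the points along the face. -/
def faceDual (h : IsMaximal α) : Equiv.Perm (Fin (l + 1)) :=
  (faceWalk h)⁻¹ * α * faceWalk h

theorem faceWalk_faceDual (h : IsMaximal α) (j : Fin (l + 1)) :
    faceWalk h (faceDual h j) = α (faceWalk h j) := by
  simp [faceDual]

theorem isChordDiagram_faceDual (h : IsMaximal α) (hα : IsChordDiagram α) :
    IsChordDiagram (faceDual h) := by
  refine ⟨?_, fun i hi => hα.2 (faceWalk h i) ?_⟩
  · have : α * α = 1 := hα.1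
    rw [IsQuasiDiagram, faceDual]
    simp only [mul_assoc, mul_inv_cancel_left]
    rw [← mul_assoc α α, this, one_mul, inv_mul_cancel]
  · rw [IsIsolated, ← faceWalk_faceDual, show faceDual h i = i from hi]

theorem finRotate_mul_faceWalk (h : IsMaximal α) :
    finRotate (l + 1) * α * faceWalk h * finRotate (l + 1) = faceWalk h := by
  ext j : 1
  exact face_faceWalk_finRotate h j

/-- Solving `ζ α w ζ = w` for one factor `ζ` gives the conjugacy. So the faces of the dual
correspond to the cycles of `ζ⁻¹`, of which there is one. -/
theorem face_faceDual (h : IsMaximal α) (hα : IsQuasiDiagram α) :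
    finRotate (l + 1) * faceDual h =
      ((faceWalk h)⁻¹ * α) * (finRotate (l + 1))⁻¹ * ((faceWalk h)⁻¹ * α)⁻¹ := by
  have h2 : α⁻¹ = α := inv_eq_of_mul_eq_one_right hα
  have h3 : finRotate (l + 1) = (faceWalk h)⁻¹ * α * (finRotate (l + 1))⁻¹ * faceWalk h := by
    have := eq_inv_mul_of_mul_eq (finRotate_mul_faceWalk h)
    rwa [mul_inv_rev, mul_inv_rev, h2, ← mul_assoc] at this
  calc finRotate (l + 1) * faceDual h
      = (faceWalk h)⁻¹ * α * (finRotate (l + 1))⁻¹ * faceWalk h * faceDual h := by rw [← h3]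
    _ = _ := by rw [faceDual, mul_inv_rev, inv_inv, h2]; group

theorem isMaximal_faceDual (h : IsMaximal α) (hα : IsQuasiDiagram α) :
    IsMaximal (faceDual h) := by
  rw [isMaximal_iff]
  intro i j
  rw [face_faceDual h hα, Equiv.Perm.sameCycle_conj, Equiv.Perm.sameCycle_inv]
  have : ∀ i, (finRotate (l + 1)).SameCycle 0 i := fun i => ⟨i.val, by
    rw [zpow_natCast, finRotate_pow_zero]⟩
  exact (this _).symm.trans (this _)

/-- Under the conjugation of `face_faceDual` the point `0` corresponds to the last point, from which
`ζ⁻¹` counts down. -/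
theorem faceWalk_faceDual_eq (h : IsMaximal α) (hα : IsQuasiDiagram α)
    (h' : IsMaximal (faceDual h)) : faceWalk h' = (faceWalk h)⁻¹ * α := by
  ext j : 1
  have h0 : ((faceWalk h)⁻¹ * α)⁻¹ 0 = Fin.last l := by
    have : α (faceWalk h 0) = Fin.last l := (finRotate (l + 1)).injective <| by
      rw [face_faceWalk_zero, finRotate_last]
    rw [Equiv.Perm.inv_eq_iff_eq, Equiv.Perm.mul_apply, ← this, hα.apply_apply]
    simp
  rw [faceWalk_apply, face_faceDual h hα, conj_pow, Equiv.Perm.mul_apply, h0, inv_pow,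
    Equiv.Perm.mul_apply, ← finRotate_pow_sub j]
  exact congrArg _ (Equiv.symm_apply_apply _ _)

theorem faceDual_faceDual (h : IsMaximal α) (hα : IsQuasiDiagram α)
    (h' : IsMaximal (faceDual h)) : faceDual h' = α := by
  rw [faceDual, faceWalk_faceDual_eq h hα, faceDual]
  group

/-- A maximal chord diagram has an even number of chords. -/
theorem even_of_isMaximal {m : ℕ} (hm : l + 1 = 2 * m) (hα : IsChordDiagram α)
    (h : IsMaximal α) : Even m := by
  -- The signs of `w` cancel and `ζ` occurs twice, which leaves `sign α = 1`.
  have h1 := congrArg Equiv.Perm.sign (finRotate_mul_faceWalk h)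
  simp only [map_mul] at h1
  have h2 : Equiv.Perm.sign α = 1 := by
    rcases Int.units_eq_one_or (Equiv.Perm.sign (finRotate (l + 1))) with hz | hz <;>
      simpa [hz] using h1
  rw [Equiv.Perm.sign_of_pow_two_eq_one (by rw [sq]; exact hα.1)] at h2
  have h3 : Fintype.card (Function.fixedPoints α) = 0 :=
    Fintype.card_eq_zero_iff.2 ⟨fun x => hα.2 x.1 x.2⟩
  rw [h3, Fintype.card_fin, Nat.sub_zero, hm, Nat.mul_div_cancel_left _ two_pos] at h2
  rcases Nat.even_or_odd m with he | ho
  · exact he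
  · rw [ho.neg_one_pow] at h2
    exact absurd h2 (by decide)

end QuasiDiagram

namespace SyzygySystem

variable {C : Type u} [Category.{v} C] [Abelian C] [HasExt.{v} C] {k : Type w} [Field k]
  [Linear k C] {X : C} {E : Type} [Fintype E] [DecidableEq E] (D : SyzygySystem k X E)

/-- An endomorphism of the presentation moves through `η` from `X` to `J`, where `h₃` says that the
projection to `M e` does not see it. -/
theorem comp_Θ (h : X ⟶ X) (hJ : D.J ⟶ D.J) (hP : D.P ⟶ D.P) (h₁ : hJ ≫ D.f = D.f ≫ hP)
    (h₂ : hP ≫ D.g = D.g ≫ h) {e : E} (h₃ : hJ ≫ D.p e = D.p e) (d : ℕ) :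
    (Ext.mk₀ h).comp (D.Θ d e) (zero_add (d + 1)) = D.Θ d e := by
  let φ : ShortComplex.mk D.f D.g D.w ⟶ ShortComplex.mk D.f D.g D.w :=
    { τ₁ := hJ, τ₂ := hP, τ₃ := h, comm₁₂ := h₁, comm₂₃ := h₂ }
  have hn : D.η.comp (Ext.mk₀ hJ) (add_zero 1) = (Ext.mk₀ h).comp D.η (zero_add 1) :=
    ShortComplex.ShortExact.extClass_naturality D.exact D.exact φ
  rw [Θ, ← Ext.comp_assoc (a₁₂ := 1) _ _ _ (by lia) (by lia) (by lia), ← hn,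
    Ext.comp_assoc (a₁₂ := 1) (a₂₃ := d) _ _ _ (by lia) (by lia) (by lia),
    Ext.mk₀_comp_mk₀_assoc, h₃]

theorem Θ_zero_comp (h : X ⟶ X) {e : E} (h₁ : D.π e ≫ h = D.π e) :
    (D.Θ 0 e).comp (Ext.mk₀ h) (add_zero (0 + 1)) = D.Θ 0 e := by
  rw [Θ, θ, Ext.mk₀_comp_mk₀,
    Ext.comp_assoc (a₁₂ := 1) (a₂₃ := 0) _ _ _ (by lia) (by lia) (by lia),
    Ext.mk₀_comp_mk₀, Category.assoc, h₁]

end SyzygySystem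

/-! ### Idempotent endomorphisms of the top -/

namespace IsGluedModel

variable {k : Type u} [Field k] {l : ℕ} {A : Type u} [Ring A] [Algebra k A]
  {ρ : A →ₐ[k] Matrix (Fin (l + 1)) (Fin (l + 1)) k} {α : Equiv.Perm (Fin (l + 1))}
  (hρ : IsGluedModel α ρ) (hα : ∀ i, α (α i) = i) (hα' : ∀ i, α i ≠ i)

section System

variable {E : Type} [Fintype E] [DecidableEq E] (e : E ≃ Fin l) (next : E → Option E)
  (hsome : ∀ a b, next a = some b → α (e a).succ = (e b).castSucc)
  (hnone : ∀ a, next a = none → α (e a).succ = Fin.last l)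

/-- The summand belonging to `a` is row `(e a).castSucc` of the radical, which left multiplication
by that idempotent fixes. -/
theorem leftMul_comp_Θ (a : E) (d : ℕ) :
    (Ext.mk₀ (ModuleCat.ofHom (hρ.leftMul (hρ.idem hα hα' (e a).castSucc)))).comp
      ((hρ.syzygySystem hα hα' e next hsome hnone).Θ d a) (zero_add (d + 1)) =
        (hρ.syzygySystem hα hα' e next hsome hnone).Θ d a := by
  refine SyzygySystem.comp_Θ _ _ (ModuleCat.ofHom
    ((mulLeftHom (hρ.idem hα hα' (e a).castSucc)).restrict fun _ h => hρ.mul_mem_radical _ h))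
    (ModuleCat.ofHom (mulLeftHom (hρ.idem hα hα' (e a).castSucc))) rfl rfl ?_ d
  ext x : 2
  apply Subtype.ext
  apply RowModule.coord_injective
  ext j
  change ρ (hρ.idem hα hα' (e a).castSucc * x.1) (e a).castSucc j = ρ x.1 (e a).castSucc j
  rw [rho_idem_mul, if_pos (Or.inl rfl)]

theorem leftMul_toTop (i : Fin (l + 1)) (x : hρ.tail i) :
    hρ.leftMul (hρ.idem hα hα' i) (hρ.toTop hα hα' i x) = hρ.toTop hα hα' i x := by
  rw [toTop_apply, leftMul_mk, hρ.mk_eq_mk]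
  intro j
  rw [hρ.diag_mul, rho_idem_diag, rho_liftRow_diag]
  split_ifs <;> simp

theorem Θ_comp_leftMul (a : E) :
    ((hρ.syzygySystem hα hα' e next hsome hnone).Θ 0 a).comp
      (Ext.mk₀ (ModuleCat.ofHom (hρ.leftMul (hρ.idem hα hα' (e a).succ)))) (add_zero (0 + 1)) =
        (hρ.syzygySystem hα hα' e next hsome hnone).Θ 0 a := by
  refine SyzygySystem.Θ_zero_comp _ _ ?_
  ext x : 2
  exact hρ.leftMul_toTop hα hα' (e a).succ x

end System

theorem idem_apply (i : Fin (l + 1)) : hρ.idem hα hα' (α i) = hρ.idem hα hα' i := by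
  apply hρ.injective
  rw [rho_idem, rho_idem, hα]
  exact congrArg Matrix.diagonal (funext fun j => if_congr or_comm rfl rfl)

section Endomorphisms

variable {Q : BoundQuiver} {p : Q.Path l} {γ : Equiv.Perm (Fin (l + 1))} (hp : p.IsGlued γ)
  (w : Equiv.Perm (Fin (l + 1))) (hw : ∀ j, w (γ j) = α (w j))

/-- The trivial path of `A` at a vertex of `Q`. -/
def vertexIdem (v : Q.V) : A := hρ.idem hα hα' (w (hp.vertex_surjective v).choose)

include hw in
-- The choice of a point above the vertex is immaterial: `w` carries orbits of `γ` to orbits of `α`,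
-- on which `idem` is constant.
theorem vertexIdem_vertex (j : Fin (l + 1)) :
    hρ.vertexIdem hα hα' hp w (p.vertex j) = hρ.idem hα hα' (w j) := by
  have h := (hp.vertex_surjective (p.vertex j)).choose_spec
  rw [vertexIdem]
  rcases (hp.vertex_eq _ _).1 h with h' | h'
  · rw [← h']
  · conv_rhs => rw [h', hw, idem_apply]

include hw in
theorem rho_vertexIdem_diag (v : Q.V) (j : Fin (l + 1)) [Decidable (v = p.vertex j)] :
    ρ (hρ.vertexIdem hα hα' hp w v) (w j) (w j) = if v = p.vertex j then 1 else 0 := by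
  obtain ⟨i, rfl⟩ := hp.vertex_surjective v
  rw [hρ.vertexIdem_vertex hα hα' hp w hw, rho_idem_diag]
  congr 1
  rw [← hw, w.injective.eq_iff, w.injective.eq_iff, eq_iff_iff, hp.vertex_eq]

/-- The endomorphism of the top given by a vertex of `Q`. -/
def vertexEnd (v : Q.V) : hρ.top ⟶ hρ.top :=
  ModuleCat.ofHom (hρ.leftMul (hρ.vertexIdem hα hα' hp w v))

theorem hom_ext_topMk_one {M : ModuleCat.{u} Aᵐᵒᵖ} {f g : hρ.top ⟶ M}
    (h : f.hom (hρ.topMk 1) = g.hom (hρ.topMk 1)) : f = g := by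
  ext x : 2
  obtain ⟨a, rfl⟩ := hρ.topMk_surjective x
  rw [← op_smul_topMk_one, map_smul, map_smul, h]

theorem vertexEnd_topMk (v : Q.V) (a : A) : (hρ.vertexEnd hα hα' hp w v).hom (hρ.topMk a) =
    hρ.topMk (hρ.vertexIdem hα hα' hp w v * a) := rfl

theorem sum_vertexEnd_topMk_one (c : Q.V → k) :
    (∑ v, c v • hρ.vertexEnd hα hα' hp w v).hom (hρ.topMk 1) =
      hρ.topMk (∑ v, algebraMap k A (c v) * hρ.vertexIdem hα hα' hp w v) := by
  rw [ModuleCat.hom_sum, LinearMap.sum_apply, topMk_sum]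
  refine Finset.sum_congr rfl fun v _ => ?_
  rw [ModuleCat.hom_smul_apply', vertexEnd_topMk, algebraMap_op_smul_topMk, mul_one]

include hw in
theorem rho_sum_vertexIdem_diag (c : Q.V → k) (j : Fin (l + 1)) :
    ρ (∑ v, algebraMap k A (c v) * hρ.vertexIdem hα hα' hp w v) (w j) (w j) = c (p.vertex j) := by
  classical
  rw [map_sum, Matrix.sum_apply]
  have : ∀ v, ρ (algebraMap k A (c v) * hρ.vertexIdem hα hα' hp w v) (w j) (w j) =
      if v = p.vertex j then c v else 0 := by
    intro v
    rw [hρ.diag_mul, hρ.rho_vertexIdem_diag hα hα' hp w hw, AlgHom.commutes,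
      Matrix.algebraMap_matrix_apply, if_pos rfl, mul_ite, mul_one, mul_zero]
    rfl
  simp only [this, Finset.sum_ite_eq', Finset.mem_univ, if_true]

include hw in
-- An endomorphism is determined by the image of `1`, and that class by its diagonal, which is
-- constant on chords.
theorem vertexEnd_span (h : hρ.top ⟶ hρ.top) :
    ∃ c : Q.V → k, h = ∑ v, c v • hρ.vertexEnd hα hα' hp w v := by
  obtain ⟨a, ha⟩ := hρ.topMk_surjective (h.hom (hρ.topMk 1))
  choose f hf using hp.vertex_surjective
  refine ⟨fun v => ρ a (w (f v)) (w (f v)), hρ.hom_ext_topMk_one ?_⟩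
  rw [sum_vertexEnd_topMk_one, ← ha, topMk_eq_topMk]
  intro i
  obtain ⟨j, rfl⟩ := w.surjective i
  rw [hρ.rho_sum_vertexIdem_diag hα hα' hp w hw fun v => ρ a (w (f v)) (w (f v))]
  rcases (hp.vertex_eq _ _).1 (hf (p.vertex j)) with h' | h'
  · rw [← h']
  · conv_lhs => rw [h', hw, hρ.diag]

include hw in
theorem vertexEnd_independent (c : Q.V → k) (h : ∑ v, c v • hρ.vertexEnd hα hα' hp w v = 0)
    (v : Q.V) : c v = 0 := by
  obtain ⟨j, rfl⟩ := hp.vertex_surjective v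
  have h1 := hρ.sum_vertexEnd_topMk_one hα hα' hp w c
  rw [h] at h1
  have h2 := (Submodule.Quotient.mk_eq_zero _).1 h1.symm (w j)
  rwa [hρ.rho_sum_vertexIdem_diag hα hα' hp w hw] at h2

include hw in
theorem sum_vertexEnd : ∑ v, hρ.vertexEnd hα hα' hp w v = 𝟙 _ := by
  have h1 : ∑ v, hρ.vertexEnd hα hα' hp w v = ∑ v, (1 : k) • hρ.vertexEnd hα hα' hp w v := by
    simp
  rw [h1]
  apply hρ.hom_ext_topMk_one
  rw [hρ.sum_vertexEnd_topMk_one hα hα' hp w fun _ => 1]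
  refine hρ.topMk_eq_topMk.2 fun i => ?_
  obtain ⟨j, rfl⟩ := w.surjective i
  rw [hρ.rho_sum_vertexIdem_diag hα hα' hp w hw fun _ => 1, map_one, Matrix.one_apply_eq]

include hw in
theorem vertexEnd_comp [DecidableEq Q.V] (v v' : Q.V) :
    hρ.vertexEnd hα hα' hp w v ≫ hρ.vertexEnd hα hα' hp w v' =
      if v = v' then hρ.vertexEnd hα hα' hp w v else 0 := by
  apply hρ.hom_ext_topMk_one
  have h2 : (if v = v' then hρ.vertexEnd hα hα' hp w v else 0).hom (hρ.topMk 1) =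
      hρ.topMk (if v = v' then hρ.vertexIdem hα hα' hp w v * 1 else 0) := by
    split_ifs <;> rfl
  rw [h2, ModuleCat.comp_apply, vertexEnd_topMk, vertexEnd_topMk, topMk_eq_topMk]
  intro i
  obtain ⟨j, rfl⟩ := w.surjective i
  rw [mul_one, hρ.diag_mul, hρ.rho_vertexIdem_diag hα hα' hp w hw,
    hρ.rho_vertexIdem_diag hα hα' hp w hw]
  by_cases h : v = v'
  · subst h
    rw [if_pos rfl, hρ.rho_vertexIdem_diag hα hα' hp w hw]
    split_ifs <;> simp
  · rw [if_neg h, map_zero, Matrix.zero_apply]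
    split_ifs with h3 h4
    · exact absurd (h4.trans h3.symm) h
    all_goals simp

end Endomorphisms

end IsGluedModel

/-! ### The arrows numbered in the order of the face -/

namespace QuasiDiagram

variable {l : ℕ} {α : Equiv.Perm (Fin (l + 1))}

theorem faceWalk_castSucc_ne_zero (h : IsMaximal α) (s : Fin l) :
    faceWalk h s.castSucc ≠ 0 := by
  rw [← faceWalk_last h]
  exact (faceWalk h).injective.ne (Fin.castSucc_lt_last s).ne

/-- The arrows in the order of the face. -/
def faceArrow (h : IsMaximal α) : Fin l ≃ Fin l :=
  Equiv.ofBijective (fun s => (faceWalk h s.castSucc).pred (faceWalk_castSucc_ne_zero h s)) <| by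
    rw [← Finite.injective_iff_bijective]
    intro s t hst
    simpa using hst

theorem succ_faceArrow (h : IsMaximal α) (s : Fin l) :
    (faceArrow h s).succ = faceWalk h s.castSucc :=
  Fin.succ_pred _ (faceWalk_castSucc_ne_zero h s)

/-- Together with `succ_faceArrow` this shows that dual arrows run backwards: step `s` of the dual
path leads from the vertex at the target of the original arrow to the one at its source. -/
theorem castSucc_faceArrow (h : IsMaximal α) (s : Fin l) :
    (faceArrow h s).castSucc = α (faceWalk h s.succ) := by
  apply (finRotate (l + 1)).injective
  rw [finRotate_castSucc, succ_faceArrow, face_faceWalk_succ]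

theorem faceArrow_some (h : IsMaximal α) (s t : Fin l)
    (hst : finPrev s = some t) : α (faceArrow h s).succ = (faceArrow h t).castSucc := by
  rw [castSucc_faceArrow, succ_faceArrow]
  have := finPrev_eq_some.1 hst
  congr 2
  exact Fin.ext this.symm

theorem faceArrow_none (h : IsMaximal α) (s : Fin l) (hs : finPrev s = none) :
    α (faceArrow h s).succ = Fin.last l := by
  have h0 : s.val = 0 := finPrev_eq_none.1 hs
  apply (finRotate (l + 1)).injective
  rw [succ_faceArrow, finRotate_last, show s.castSucc = 0 from Fin.ext h0, face_faceWalk_zero]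

end QuasiDiagram

/-! ### Self-extensions of the top in the maximal and the non-maximal case -/

namespace IsGluedModel

open QuasiDiagram

variable {k : Type u} [Field k] {l : ℕ} {A : Type u} [Ring A] [Algebra k A]
  {ρ : A →ₐ[k] Matrix (Fin (l + 1)) (Fin (l + 1)) k} {α : Equiv.Perm (Fin (l + 1))}
  (hρ : IsGluedModel α ρ) (hα : IsChordDiagram α) (h : IsMaximal α)

/-- The syzygies of the top in the order of the face. -/
def faceSystem : SyzygySystem k (hρ.top) (Fin l) :=
  hρ.syzygySystem hα.apply_apply hα.apply_ne (faceArrow h) finPrev (faceArrow_some h)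
    (faceArrow_none h)

open Classical in
/-- The Koszul dual in the maximal case. -/
def koszulDatum {Q : BoundQuiver} {p : Q.Path l} (hp : p.IsGlued (faceDual h)) :
    KoszulDatum (hρ.faceSystem hα h) p where
  φ := hρ.vertexEnd hα.apply_apply hα.apply_ne hp (faceWalk h)
  next := rfl
  comp_self v := by
    rw [hρ.vertexEnd_comp _ _ _ _ (faceWalk_faceDual h), if_pos rfl]
  comp_of_ne v v' hv := by
    rw [hρ.vertexEnd_comp _ _ _ _ (faceWalk_faceDual h), if_neg hv]
  total := hρ.sum_vertexEnd _ _ _ _ (faceWalk_faceDual h)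
  Θ_comp s := by
    rw [vertexEnd, hρ.vertexIdem_vertex _ _ _ _ (faceWalk_faceDual h), ← succ_faceArrow]
    exact hρ.Θ_comp_leftMul hα.apply_apply hα.apply_ne (faceArrow h) finPrev _ _ s
  comp_Θ s := by
    rw [vertexEnd, hρ.vertexIdem_vertex _ _ _ _ (faceWalk_faceDual h), ← idem_apply,
      ← castSucc_faceArrow]
    exact hρ.leftMul_comp_Θ hα.apply_apply hα.apply_ne (faceArrow h) finPrev _ _ s 0
  span := hρ.vertexEnd_span _ _ _ _ (faceWalk_faceDual h)
  independent := hρ.vertexEnd_independent _ _ _ _ (faceWalk_faceDual h)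

include hα h in
theorem exists_ext_ne_zero_of_isMaximal (hl : l ≠ 0) :
    ∃ x : Ext.{u} (hρ.top) (hρ.top) l,
      x ≠ 0 := by
  obtain ⟨d, rfl⟩ := Nat.exists_eq_succ_of_ne_zero hl
  -- The last arrow in the order of the face has `d` predecessors, so its class survives in degree
  -- `d + 1 = l`.
  refine ⟨(hρ.faceSystem hα h).Θ d (Fin.last d), SyzygySystem.Θ_ne_zero _ ?_⟩
  have key : ∀ m (s : Fin (d + 1)), m ≤ s.val → (hρ.faceSystem hα h).Alive m s := by
    intro m
    induction m with
    | zero => exact fun _ _ => trivial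
    | succ m ih =>
      intro s hs
      exact ⟨⟨s.val - 1, by omega⟩, finPrev_eq_some.2 (by simp; omega), ih _ (by simp; omega)⟩
  exact key d (Fin.last d) le_rfl

open Classical in
/-- The next arrow of an antipath. -/
def _root_.QuasiDiagram.nextArrow (α : Equiv.Perm (Fin (l + 1))) (s : Fin l) : Option (Fin l) :=
  if h : α s.succ = Fin.last l then none else some ((α s.succ).castPred h)

include hα in
-- Syzygies follow `ζ α` and stop only on reaching `0`; starting in an orbit that avoids `0`, they
-- never stop.
theorem exists_ext_ne_zero_of_not_isMaximal (h : ¬ IsMaximal α) (d : ℕ) :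
    ∃ x : Ext.{u} (hρ.top) (hρ.top)
      (d + 1), x ≠ 0 := by
  have h0 : ∃ i, ¬ (finRotate (l + 1) * α).SameCycle 0 i := by
    by_contra! h'
    exact h (isMaximal_iff.2 fun i j => (h' i).symm.trans (h' j))
  obtain ⟨i, hi⟩ := h0
  obtain ⟨s, rfl⟩ := Fin.exists_succ_eq.2 (show i ≠ 0 by rintro rfl; exact hi (.refl _ _))
  let D := hρ.syzygySystem hα.apply_apply hα.apply_ne (Equiv.refl (Fin l)) (nextArrow α)
    (fun a b hab => by
      rw [nextArrow] at hab
      split_ifs at hab with h'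
      rw [← Option.some.inj hab]
      simp)
    (fun a ha => by
      rw [nextArrow] at ha
      split_ifs at ha with h'
      exact h')
  refine ⟨D.Θ d s, SyzygySystem.Θ_ne_zero _ ?_⟩
  clear h
  induction d generalizing s with
  | zero => trivial
  | succ d ih =>
    have h1 : α s.succ ≠ Fin.last l := by
      intro h1
      refine hi (Equiv.Perm.SameCycle.symm ⟨1, ?_⟩)
      rw [zpow_one, Equiv.Perm.mul_apply, h1, finRotate_last]
    refine ⟨(α s.succ).castPred h1, dif_neg h1, ih _ ?_⟩
    intro h2
    refine hi (h2.trans (Equiv.Perm.SameCycle.symm ⟨1, ?_⟩))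
    rw [zpow_one, Equiv.Perm.mul_apply]
    exact (congrArg (finRotate (l + 1)) (Fin.castSucc_castPred _ h1).symm).trans
      (finRotate_castSucc _)

end IsGluedModel

/-! ### Projective dimensions -/

namespace SyzygySystem

variable {C : Type u} [Category.{v} C] [Abelian C] [HasExt.{v} C] {k : Type w} [Field k]
  [Linear k C] {X : C} {l : ℕ} (D : SyzygySystem k X (Fin l))

omit [HasExt.{v} C] in
-- From position `s`, exactly `s` syzygy steps lead to the projective module at position `0`.
theorem hasProjectiveDimensionLT_M (hD : D.next = finPrev) (d : ℕ) (s : Fin l) (hs : s.val = d) :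
    HasProjectiveDimensionLT (D.M s) (d + 1) := by
  induction d generalizing s with
  | zero =>
    have := D.terminal s (by rw [hD, finPrev_eq_none, hs])
    infer_instance
  | succ d ih =>
    obtain ⟨Q, i, q, r, w, hS, hQ, -⟩ := D.step s ⟨d, by omega⟩ (by
      rw [hD, finPrev_eq_some, hs])
    exact hS.hasProjectiveDimensionLT_X₃ (d + 1) (ih _ rfl)
      (hasProjectiveDimensionLT_of_ge Q 1 _ (by omega))

theorem hasProjectiveDimensionLT_J (hD : D.next = finPrev) : HasProjectiveDimensionLT D.J l := by
  rw [hasProjectiveDimensionLT_iff]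
  intro d hd Y y
  have h1 : (Ext.mk₀ (∑ e, D.p e ≫ D.ι e)).comp y (zero_add d) = y := by
    rw [D.total, Ext.mk₀_id_comp]
  have h2 : Ext.mk₀ (∑ e, D.p e ≫ D.ι e) = ∑ e, Ext.mk₀ (D.p e ≫ D.ι e) :=
    map_sum (Ext.addEquiv₀ (X := D.J) (Y := D.J)).symm _ _
  have h3 : (∑ e, Ext.mk₀ (D.p e ≫ D.ι e)).comp y (zero_add d) =
      ∑ e, (Ext.mk₀ (D.p e ≫ D.ι e)).comp y (zero_add d) :=
    map_sum (Ext.postcomp y D.J (zero_add d)) _ _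
  rw [← h1, h2, h3]
  refine Finset.sum_eq_zero fun s _ => ?_
  have := D.hasProjectiveDimensionLT_M hD s.val s rfl
  rw [← Ext.mk₀_comp_mk₀_assoc,
    Ext.eq_zero_of_hasProjectiveDimensionLT ((Ext.mk₀ (D.ι s)).comp y (zero_add d)) (s.val + 1)
      (by omega), Ext.comp_zero]

theorem hasProjectiveDimensionLT (hD : D.next = finPrev) : HasProjectiveDimensionLT X (l + 1) := by
  have := D.projective
  exact D.exact.hasProjectiveDimensionLT_X₃ l (D.hasProjectiveDimensionLT_J hD)
    (hasProjectiveDimensionLT_of_ge D.P 1 _ (by omega))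

end SyzygySystem

theorem ModuleCat.finsupp_shortExact {R : Type u} [Ring R] {M : Type u} [AddCommGroup M]
    [Module R M] {N : Type u} [AddCommGroup N] [Module R N] (ι : Type u) (f : M →ₗ[R] N)
    (hf : Function.Surjective f) :
    (ShortComplex.mk
      (ModuleCat.ofHom (Finsupp.mapRange.linearMap (α := ι) (LinearMap.ker f).subtype))
      (ModuleCat.ofHom (Finsupp.mapRange.linearMap (α := ι) f)) (by
        ext : 1
        exact LinearMap.ext fun x : ι →₀ LinearMap.ker f => Finsupp.ext fun i => (x i).2)).ShortExact := by
  classical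
  refine ModuleCat.shortComplex_shortExact _ ?_ ?_ ?_
  · intro y
    constructor
    · intro hy
      have h0 : ∀ i, f ((y : ι →₀ M) i) = 0 := fun i => DFunLike.congr_fun hy i
      refine ⟨Finsupp.mapRange (fun m => if h : f m = 0 then (⟨m, h⟩ : LinearMap.ker f) else 0)
        (dif_pos (map_zero f)) (y : ι →₀ M), Finsupp.ext fun i => ?_⟩
      change Subtype.val (if h : f ((y : ι →₀ M) i) = 0 then
        (⟨(y : ι →₀ M) i, h⟩ : LinearMap.ker f) else 0) = (y : ι →₀ M) i
      rw [dif_pos (h0 i)]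
    · rintro ⟨x, rfl⟩
      exact Finsupp.ext fun i => (x i).2
  · exact Finsupp.mapRange_injective _ (map_zero _) (Submodule.subtype_injective _)
  · exact Finsupp.mapRange_surjective _ (map_zero _) hf

/-- Direct sums of any size preserve exactness and projectivity, so one can shift dimension along a
free cover of `M`. Infinite sums are needed because arbitrary modules enter the global dimension. -/
theorem ModuleCat.hasProjectiveDimensionLT_finsupp {R : Type u} [Ring R] (ι : Type u) (d : ℕ)
    (M : Type u) [AddCommGroup M] [Module R M]
    (hM : HasProjectiveDimensionLT (ModuleCat.of R M) (d + 1)) :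
    HasProjectiveDimensionLT (ModuleCat.of R (ι →₀ M)) (d + 1) := by
  classical
  induction d generalizing M with
  | zero =>
    have h1 : Projective (ModuleCat.of R M) := inferInstance
    have h2 : Module.Projective R M := (IsProjective.iff_projective M).2 h1
    have := ModuleCat.projective_of (ι →₀ M)
      (Module.Projective.of_equiv' (finsuppLequivDFinsupp (ι := ι) (M := M) R).symm)
    infer_instance
  | succ d ih =>
    have hf : Function.Surjective (Finsupp.linearCombination R (id : M → M)) :=
      Finsupp.linearCombination_id_surjective R M
    have h1 := LinearMap.shortExact_shortComplexKer hf
    have h2 : Projective (ModuleCat.of R (M →₀ R)) := ModuleCat.projective_of _ inferInstance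
    have h3 : Projective (ModuleCat.of R (ι →₀ M →₀ R)) := ModuleCat.projective_of _ <|
      Module.Projective.of_equiv' (finsuppLequivDFinsupp (ι := ι) (M := M →₀ R) R).symm
    exact (ModuleCat.finsupp_shortExact ι _ hf).hasProjectiveDimensionLT_X₃ (d + 1)
      (ih _ (h1.hasProjectiveDimensionLT_X₁ (d + 1)
        (hasProjectiveDimensionLT_of_ge _ 1 _ (by omega)) hM))
      (hasProjectiveDimensionLT_of_ge _ 1 _ (by omega))

namespace IsGluedModel

open QuasiDiagram

variable {k : Type u} [Field k] {l : ℕ} {A : Type u} [Ring A] [Algebra k A]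
  {ρ : A →ₐ[k] Matrix (Fin (l + 1)) (Fin (l + 1)) k} {α : Equiv.Perm (Fin (l + 1))}
  (hρ : IsGluedModel α ρ) (hα : IsChordDiagram α)

include hα in
-- The algebra acts on the class of each `idem i` by scalars, so this class spans a simple module,
-- and these modules generate the top.
theorem isSemisimpleModule_top : IsSemisimpleModule Aᵐᵒᵖ (A ⧸ hρ.radical) := by
  let e := hρ.idem hα.apply_apply hα.apply_ne
  let x : Fin (l + 1) → A ⧸ hρ.radical := fun i => Submodule.Quotient.mk (e i)
  have hx : ∀ i (a : A), ∃ c : k, MulOpposite.op a • x i = algebraMap k Aᵐᵒᵖ c • x i := by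
    intro i a
    refine ⟨ρ a i i, ?_⟩
    rw [hρ.algebraMap_op_smul _ _ (e i) rfl]
    exact hρ.mk_idem_mul hα.apply_apply hα.apply_ne
  refine isSemisimpleModule_of_isSemisimpleModule_submodule'
    (p := fun i : Fin (l + 1) => Submodule.span Aᵐᵒᵖ {x i}) (fun i => ?_) ?_
  · have : IsSimpleModule Aᵐᵒᵖ (Submodule.span Aᵐᵒᵖ {x i}) := by
      rw [isSimpleModule_iff_toSpanSingleton_surjective]
      constructor
      · exact ⟨⟨⟨x i, Submodule.mem_span_singleton_self _⟩, 0, fun h =>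
          hρ.mk_idem_ne_zero hα.apply_apply hα.apply_ne i (congrArg Subtype.val h)⟩⟩
      · rintro ⟨y, hy⟩ hy0 ⟨z, hz⟩
        obtain ⟨a, rfl⟩ := Submodule.mem_span_singleton.1 hy
        obtain ⟨b, rfl⟩ := Submodule.mem_span_singleton.1 hz
        obtain ⟨c, hc⟩ := hx i a.unop
        obtain ⟨d, hd⟩ := hx i b.unop
        rw [MulOpposite.op_unop] at hc hd
        have hc0 : c ≠ 0 := by
          rintro rfl
          exact hy0 (Subtype.ext (hc.trans (by rw [map_zero, zero_smul]; rfl)))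
        refine ⟨algebraMap k Aᵐᵒᵖ (d * c⁻¹), Subtype.ext ?_⟩
        change algebraMap k Aᵐᵒᵖ (d * c⁻¹) • a • x i = b • x i
        rw [hc, hd, smul_smul, ← map_mul, mul_assoc, inv_mul_cancel₀ hc0, mul_one]
    infer_instance
  · rw [eq_top_iff]
    rintro y -
    obtain ⟨a, rfl⟩ := Submodule.Quotient.mk_surjective _ y
    -- The condition `i < α i` picks one point of each chord, so these idempotents add up to the
    -- class of `1`.
    have h1 : (Submodule.Quotient.mk a : A ⧸ hρ.radical) =
        MulOpposite.op a • ∑ i with i < α i, x i := by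
      have h2 : ∑ i with i < α i, x i =
          Submodule.Quotient.mk (∑ i with i < α i, e i) :=
        (map_sum hρ.radical.mkQ _ _).symm
      rw [h2, ← Submodule.Quotient.mk_smul]
      refine hρ.mk_eq_mk.2 fun j => ?_
      change _ = ρ ((∑ i with i < α i, e i) * a) j j
      rw [hρ.diag_mul, map_sum, Matrix.sum_apply]
      have h3 : ∑ i with i < α i, ρ (e i) j j = 1 := by
        simp only [e, rho_idem_diag]
        rcases lt_or_gt_of_ne (hα.apply_ne j) with h | h
        · rw [Finset.sum_eq_single (α j)]
          · simp [hα.apply_apply]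
          · intro i hi hij
            rw [if_neg]
            rintro (rfl | rfl)
            · exact lt_asymm h (by simpa using hi)
            · exact hij (hα.apply_apply i).symm
          · intro h'
            simp [hα.apply_apply, h] at h'
        · rw [Finset.sum_eq_single j]
          · simp
          · intro i hi hij
            rw [if_neg]
            rintro (rfl | rfl)
            · exact hij rfl
            · rw [hα.apply_apply] at h
              exact lt_asymm h (by simpa using hi)
          · intro h'
            simp [h] at h'
      rw [h3, one_mul]
    rw [h1]
    exact Submodule.smul_mem _ _ (Submodule.sum_mem _ fun i _ =>
      Submodule.mem_iSup_of_mem i (Submodule.mem_span_singleton_self _))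

/-- A module killed by the radical as a quotient of a sum of copies of the top. -/
def topCover {N : Type u} [AddCommGroup N] [Module Aᵐᵒᵖ N]
    (hN : ∀ b ∈ hρ.radical, ∀ x : N, MulOpposite.op b • x = 0) :
    (N →₀ A ⧸ hρ.radical) →ₗ[Aᵐᵒᵖ] N :=
  Finsupp.lsum ℕ fun x => hρ.radical.liftQ
    { toFun := fun a => MulOpposite.op a • x
      map_add' := fun a b => by rw [MulOpposite.op_add, add_smul]
      map_smul' := fun r a => (smul_smul r (MulOpposite.op a) x).symm } fun b hb => hN b hb x

theorem topCover_surjective {N : Type u} [AddCommGroup N] [Module Aᵐᵒᵖ N]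
    (hN : ∀ b ∈ hρ.radical, ∀ x : N, MulOpposite.op b • x = 0) :
    Function.Surjective (hρ.topCover hN) := fun x => by
  refine ⟨Finsupp.single x (Submodule.Quotient.mk 1), ?_⟩
  rw [topCover, Finsupp.lsum_single]
  exact one_smul Aᵐᵒᵖ x

include hα in
-- Such a module is a quotient of a sum of copies of the semisimple top, hence a direct summand of
-- it.
theorem hasProjectiveDimensionLT_of_radical {N : Type u} [AddCommGroup N] [Module Aᵐᵒᵖ N]
    (hN : ∀ b ∈ hρ.radical, ∀ x : N, MulOpposite.op b • x = 0) {d : ℕ}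
    (hd : HasProjectiveDimensionLT hρ.top (d + 1)) :
    HasProjectiveDimensionLT (ModuleCat.of Aᵐᵒᵖ N) (d + 1) := by
  have := hρ.isSemisimpleModule_top hα
  have : IsSemisimpleModule Aᵐᵒᵖ N := .of_surjective _ (hρ.topCover_surjective hN)
  obtain ⟨s, hs⟩ := IsSemisimpleModule.lifting_property _ (hρ.topCover_surjective hN) LinearMap.id
  have := ModuleCat.hasProjectiveDimensionLT_finsupp N d (A ⧸ hρ.radical) hd
  exact Retract.hasProjectiveDimensionLT
    (Y := ModuleCat.of Aᵐᵒᵖ (N →₀ A ⧸ hρ.radical))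
    { i := ModuleCat.ofHom s
      r := ModuleCat.ofHom (hρ.topCover hN)
      retract := by
        ext x
        exact LinearMap.congr_fun hs x } _

/-- The elements of a module killed by the radical. -/
def socle (N : Type u) [AddCommGroup N] [Module Aᵐᵒᵖ N] : Submodule Aᵐᵒᵖ N where
  carrier := {x | ∀ b ∈ hρ.radical, MulOpposite.op b • x = 0}
  add_mem' hx hy b hb := by rw [smul_add, hx b hb, hy b hb, add_zero]
  zero_mem' b _ := smul_zero _
  smul_mem' a x hx b hb := by
    rw [smul_smul, ← MulOpposite.op_unop a, ← MulOpposite.op_mul]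
    exact hx _ (hρ.mul_mem_radical _ hb)

/-- A strictly upper triangular factor moves all entries one diagonal further up. These bands play
the role of the powers of the radical. -/
theorem mul_band {a b : A} {r : ℕ} (ha : ∀ i j : Fin (l + 1), j.val < i.val + r → ρ a i j = 0)
    (hb : b ∈ hρ.radical) (i j : Fin (l + 1)) (hij : j.val < i.val + (r + 1)) :
    ρ (a * b) i j = 0 := by
  rw [map_mul, Matrix.mul_apply]
  refine Finset.sum_eq_zero fun s _ => ?_
  rcases lt_or_ge s.val (i.val + r) with h | h
  · rw [ha i s h, zero_mul]
  · rcases eq_or_lt_of_le (show j ≤ s from Fin.le_def.2 (by omega)) with rfl | h'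
    · rw [hb, mul_zero]
    · rw [hρ.lower b h', mul_zero]

include hα in
theorem hasProjectiveDimensionLT_of_band {d : ℕ} (hd : HasProjectiveDimensionLT hρ.top (d + 1))
    (r : ℕ) (N : Type u) [AddCommGroup N] [Module Aᵐᵒᵖ N]
    (hN : ∀ a : A, (∀ i j : Fin (l + 1), j.val < i.val + r → ρ a i j = 0) →
      ∀ x : N, MulOpposite.op a • x = 0) :
    HasProjectiveDimensionLT (ModuleCat.of Aᵐᵒᵖ N) (d + 1) := by
  induction r generalizing N with
  | zero =>
    have : Subsingleton N := subsingleton_of_forall_eq 0 fun x => by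
      rw [← one_smul Aᵐᵒᵖ x]
      -- For `r = 0` the band condition is plain triangularity, so already `1` acts as zero.
      exact hN 1 (fun i j h => hρ.lower 1 (Fin.lt_def.2 (by omega))) x
    have := (ModuleCat.isZero_of_subsingleton (ModuleCat.of Aᵐᵒᵖ N)).hasProjectiveDimensionLT_zero
    exact hasProjectiveDimensionLT_of_ge _ 0 _ (by omega)
  | succ r ih =>
    have hS : (ShortComplex.mk (ModuleCat.ofHom (hρ.socle N).subtype)
        (ModuleCat.ofHom (hρ.socle N).mkQ) (by ext x; simp)).ShortExact :=
      ModuleCat.shortComplex_shortExact _ (LinearMap.exact_subtype_mkQ _)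
        (Submodule.subtype_injective _) (Submodule.mkQ_surjective _)
    refine hS.hasProjectiveDimensionLT_X₂ _
      (hρ.hasProjectiveDimensionLT_of_radical hα (N := hρ.socle N)
        (fun b hb x => Subtype.ext (x.2 b hb)) hd)
      (ih _ fun a ha y => ?_)
    obtain ⟨x, rfl⟩ := Submodule.Quotient.mk_surjective _ y
    rw [← Submodule.Quotient.mk_smul, Submodule.Quotient.mk_eq_zero]
    -- The element `x a` lies in the socle, since `a b` lies in the next band; so the quotient by
    -- the socle is killed by band `r`.
    intro b hb
    rw [smul_smul, ← MulOpposite.op_mul]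
    exact hN _ (hρ.mul_band ha hb) x

include hα in
theorem hasProjectiveDimensionLT_of_top {d : ℕ} (hd : HasProjectiveDimensionLT hρ.top (d + 1))
    (N : ModuleCat.{u} Aᵐᵒᵖ) : HasProjectiveDimensionLT N (d + 1) := by
  refine hρ.hasProjectiveDimensionLT_of_band hα hd (l + 1) N fun a ha x => ?_
  have : a = 0 := hρ.ext fun i j => by
    rw [ha i j (by omega), map_zero, Matrix.zero_apply]
  rw [this, MulOpposite.op_zero, zero_smul]

include hρ hα in
-- The left side does not involve `α`, so different gluing permutations of one algebra can be
-- compared through it.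
theorem globalDimension_eq_iff (hl : l ≠ 0) :
    globalDimension A = (l : WithBot ℕ∞) ↔ IsMaximal α := by
  constructor
  · intro h
    by_contra hmax
    obtain ⟨x, hx⟩ := hρ.exists_ext_ne_zero_of_not_isMaximal hα hmax l
    have h1 : projectiveDimension hρ.top ≤ l := h ▸ le_iSup (fun M => projectiveDimension M) _
    rw [projectiveDimension_le_iff] at h1
    exact hx (x.eq_zero_of_hasProjectiveDimensionLT (l + 1) le_rfl)
  · intro h
    apply le_antisymm
    · refine iSup_le fun M => ?_
      rw [projectiveDimension_le_iff]
      exact hρ.hasProjectiveDimensionLT_of_top hα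
        ((hρ.faceSystem hα h).hasProjectiveDimensionLT rfl) M
    · obtain ⟨x, hx⟩ := hρ.exists_ext_ne_zero_of_isMaximal hα h hl
      refine le_trans ?_ (le_iSup (fun M => projectiveDimension M) hρ.top)
      rw [projectiveDimension_ge_iff]
      intro h1
      exact hx (x.eq_zero_of_hasProjectiveDimensionLT l le_rfl)

end IsGluedModel

/-! ### Maximal paths -/

theorem List.prod_ofFn_eq_zero {R : Type*} [Ring R] {n : ℕ} (f : Fin n → R) {s t : Fin n}
    (hst : t.val = s.val + 1) (h : f s * f t = 0) : (List.ofFn f).prod = 0 := by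
  induction n with
  | zero => exact s.elim0
  | succ n ih =>
    rw [List.ofFn_succ, List.prod_cons]
    obtain ⟨t, rfl⟩ := Fin.exists_succ_eq.2 (show t ≠ 0 by rintro rfl; simp at hst)
    induction s using Fin.cases with
    | zero =>
      obtain _ | n := n
      · exact t.elim0
      · obtain rfl : t = 0 := Fin.ext (by simpa using hst)
        rw [List.ofFn_succ, List.prod_cons, ← mul_assoc, h, zero_mul]
    | succ s => rw [ih (fun i => f i.succ) (by simpa using hst) h, mul_zero]

namespace BoundQuiver

variable {k : Type u} [Field k] {Q : BoundQuiver}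

namespace Path

theorem ext_edge {l : ℕ} (hl : l ≠ 0) {p q : Q.Path l} (h : ∀ s, p.edge s = q.edge s) : p = q := by
  have hv : p.vertex = q.vertex := by
    funext i
    induction i using Fin.lastCases with
    | last =>
      obtain ⟨m, rfl⟩ := Nat.exists_eq_succ_of_ne_zero hl
      rw [← Fin.succ_last, ← p.tgt_edge, ← q.tgt_edge, h]
    | cast s => rw [← p.src_edge, ← q.src_edge, h]
  cases p
  cases q
  obtain rfl := hv
  obtain rfl : _ = _ := funext h
  rfl

/-- Extension of a path by an arrow at its end. -/
def snoc {l : ℕ} (p : Q.Path l) (a : Q.E) (h : Q.src a = p.vertex (Fin.last l)) :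
    Q.Path (l + 1) where
  vertex := Fin.snoc (α := fun _ => Q.V) p.vertex (Q.tgt a)
  edge := Fin.snoc (α := fun _ => Q.E) p.edge a
  src_edge i := by
    induction i using Fin.lastCases with
    | last => rw [Fin.snoc_last, Fin.snoc_castSucc, h]
    | cast s => rw [Fin.snoc_castSucc, Fin.snoc_castSucc, p.src_edge]
  tgt_edge i := by
    induction i using Fin.lastCases with
    | last => rw [Fin.succ_last, Fin.snoc_last, Fin.snoc_last]
    | cast s => rw [Fin.succ_castSucc, Fin.snoc_castSucc, Fin.snoc_castSucc, p.tgt_edge]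

/-- Extension of a path by an arrow at its beginning. -/
def cons {l : ℕ} (p : Q.Path l) (a : Q.E) (h : Q.tgt a = p.vertex 0) : Q.Path (l + 1) where
  vertex := Fin.cons (α := fun _ => Q.V) (Q.src a) p.vertex
  edge := Fin.cons (α := fun _ => Q.E) a p.edge
  src_edge i := by
    induction i using Fin.cases with
    | zero => rfl
    | succ s => rw [Fin.cons_succ, Fin.castSucc_succ, Fin.cons_succ, p.src_edge]
  tgt_edge i := by
    induction i using Fin.cases with
    | zero => rw [Fin.cons_zero, Fin.cons_succ, h]
    | succ s => rw [Fin.cons_succ, Fin.cons_succ, p.tgt_edge]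

variable {l : ℕ} (p : Q.Path l)

theorem toAlg_snoc (a : Q.E) (h : Q.src a = p.vertex (Fin.last l)) :
    (p.snoc a h).toAlg k = p.toAlg k * Q.arrow k a := by
  rw [toAlg, toAlg, List.ofFn_succ', List.concat_eq_append, List.prod_append, List.prod_singleton,
    mul_assoc]
  have h0 : (p.snoc a h).vertex 0 = p.vertex 0 :=
    Fin.snoc_castSucc (α := fun _ => Q.V) (Q.tgt a) p.vertex 0
  have h1 : ∀ i : Fin l, (p.snoc a h).edge i.castSucc = p.edge i :=
    fun i => Fin.snoc_castSucc (α := fun _ => Q.E) _ _ i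
  have h2 : (p.snoc a h).edge (Fin.last l) = a := Fin.snoc_last (α := fun _ => Q.E) _ _
  simp only [h0, h1, h2]

theorem toAlg_cons (a : Q.E) (h : Q.tgt a = p.vertex 0) :
    (p.cons a h).toAlg k = Q.arrow k a * p.toAlg k := by
  rw [toAlg, toAlg, List.ofFn_succ, List.prod_cons, ← mul_assoc, ← mul_assoc, ← h,
    arrow_mul_idempotent_tgt]
  congr 1
  exact idempotent_src_mul_arrow a

variable {p}

theorem isFree_of_toAlg_ne_zero (h : p.toAlg k ≠ 0) : p.IsFree := fun s t hst hr =>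
  h (by rw [toAlg, List.prod_ofFn_eq_zero _ hst (arrow_mul_arrow_of_rel hr), mul_zero])

theorem IsFree.snoc (hp : p.IsFree) {a : Q.E} (h : Q.src a = p.vertex (Fin.last l))
    (hr : ∀ s : Fin l, s.val + 1 = l → ¬ Q.rel (p.edge s) a) : (p.snoc a h).IsFree := by
  intro s t hst
  obtain ⟨s, rfl⟩ := Fin.exists_castSucc_eq.2 (show s ≠ Fin.last l by
    rintro rfl
    simp at hst
    omega)
  change ¬ Q.rel (Fin.snoc (α := fun _ => Q.E) p.edge a s.castSucc)
    (Fin.snoc (α := fun _ => Q.E) p.edge a t)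
  rw [Fin.snoc_castSucc]
  induction t using Fin.lastCases with
  | last =>
    rw [Fin.snoc_last]
    exact hr s (by simpa using hst.symm)
  | cast t =>
    rw [Fin.snoc_castSucc]
    exact hp s t (by simpa using hst)

theorem IsFree.cons (hp : p.IsFree) {a : Q.E} (h : Q.tgt a = p.vertex 0)
    (hr : ∀ s : Fin l, s.val = 0 → ¬ Q.rel a (p.edge s)) : (p.cons a h).IsFree := by
  intro s t hst
  obtain ⟨t, rfl⟩ := Fin.exists_succ_eq.2 (show t ≠ 0 by rintro rfl; simp at hst)
  induction s using Fin.cases with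
  | zero => exact hr t (by simpa using hst)
  | succ s => exact hp s t (by simpa using hst)

/-- A path without relations which cannot be extended. -/
structure IsSaturated (p : Q.Path l) : Prop where
  isFree : p.IsFree
  rel_last : ∀ a, Q.src a = p.vertex (Fin.last l) →
    ∃ s : Fin l, s.val + 1 = l ∧ Q.rel (p.edge s) a
  rel_first : ∀ a, Q.tgt a = p.vertex 0 → ∃ s : Fin l, s.val = 0 ∧ Q.rel a (p.edge s)

theorem toAlg_eq_mul_idempotent : p.toAlg k * Q.idempotent k (p.vertex (Fin.last l)) = p.toAlg k := by
  rw [toAlg]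
  obtain _ | l := l
  · rw [List.ofFn_zero, List.prod_nil, mul_one]
    exact idempotent_mul_self _
  · rw [List.ofFn_succ', List.concat_eq_append, List.prod_append, List.prod_singleton, mul_assoc,
      mul_assoc, ← Fin.succ_last, ← p.tgt_edge, arrow_mul_idempotent_tgt]

theorem toAlg_mul_arrow_eq_zero {a : Q.E} {s : Fin l} (hs : s.val + 1 = l)
    (h : Q.rel (p.edge s) a) : p.toAlg k * Q.arrow k a = 0 := by
  obtain _ | l := l
  · exact s.elim0
  · obtain rfl : s = Fin.last l := Fin.ext (by simpa using hs)
    rw [toAlg, List.ofFn_succ', List.concat_eq_append, List.prod_append, List.prod_singleton,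
      mul_assoc, mul_assoc, arrow_mul_arrow_of_rel h, mul_zero, mul_zero]

theorem arrow_mul_toAlg_eq_zero {a : Q.E} {s : Fin l} (hs : s.val = 0)
    (h : Q.rel a (p.edge s)) : Q.arrow k a * p.toAlg k = 0 := by
  obtain _ | l := l
  · exact s.elim0
  · obtain rfl : s = 0 := Fin.ext hs
    have h0 : p.vertex 0 = Q.src (p.edge 0) := (p.src_edge 0).symm
    rw [toAlg, List.ofFn_succ, List.prod_cons, ← mul_assoc (Q.idempotent k _), h0,
      idempotent_src_mul_arrow, ← mul_assoc, arrow_mul_arrow_of_rel h, zero_mul]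

/-- String modules show that a path is nonzero once it contains no relation. Applied to one-arrow
extensions, this makes maximality combinatorial and independent of `k`. -/
theorem isMaximal_iff_isSaturated : p.IsMaximal k ↔ p.IsSaturated := by
  constructor
  · rintro ⟨h0, h⟩
    have hp := isFree_of_toAlg_ne_zero h0
    refine ⟨hp, fun a ha => ?_, fun a ha => ?_⟩
    · by_contra! hr
      refine (p.snoc a ha).toAlg_ne_zero (k := k) (hp.snoc ha hr) ?_
      rw [toAlg_snoc, (h a).1]
    · by_contra! hr
      refine (p.cons a ha).toAlg_ne_zero (k := k) (hp.cons ha hr) ?_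
      rw [toAlg_cons, (h a).2]
  · intro h
    refine ⟨p.toAlg_ne_zero h.isFree, fun a => ⟨?_, ?_⟩⟩
    · by_cases ha : Q.src a = p.vertex (Fin.last l)
      · obtain ⟨s, hs, hr⟩ := h.rel_last a ha
        exact toAlg_mul_arrow_eq_zero hs hr
      · rw [← toAlg_eq_mul_idempotent, mul_assoc, idempotent_mul_arrow_of_ne (Ne.symm ha), mul_zero]
    · by_cases ha : Q.tgt a = p.vertex 0
      · obtain ⟨s, hs, hr⟩ := h.rel_first a ha
        exact arrow_mul_toAlg_eq_zero hs hr
      · rw [toAlg, ← mul_assoc, arrow_mul_idempotent_of_ne ha, zero_mul]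

variable (k) in
-- A relation-free path can be prolonged until it is saturated, because the dimension bounds its
-- length. The predicate `S` records what prolongation preserves.
theorem exists_isSaturated [Module.Finite k (Q.Alg k)] (S : ∀ l, Q.Path l → Prop)
    (hsnoc : ∀ {l} (p : Q.Path l) a h, S l p → S (l + 1) (p.snoc a h))
    (hcons : ∀ {l} (p : Q.Path l) a h, S l p → S (l + 1) (p.cons a h)) {l : ℕ} (p : Q.Path l)
    (hp : p.IsFree) (hS : S l p) : ∃ (m : ℕ) (q : Q.Path m), q.IsSaturated ∧ S m q := by
  by_cases h : p.IsSaturated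
  · exact ⟨l, p, h, hS⟩
  · have hl := p.length_lt_finrank (k := k) hp
    have h' : ¬ ((∀ a, Q.src a = p.vertex (Fin.last l) →
        ∃ s : Fin l, s.val + 1 = l ∧ Q.rel (p.edge s) a) ∧
      ∀ a, Q.tgt a = p.vertex 0 → ∃ s : Fin l, s.val = 0 ∧ Q.rel a (p.edge s)) :=
      fun h' => h ⟨hp, h'.1, h'.2⟩
    rw [not_and_or] at h'
    push Not at h'
    rcases h' with ⟨a, ha, hr⟩ | ⟨a, ha, hr⟩
    · exact exists_isSaturated S hsnoc hcons (p.snoc a ha) (hp.snoc ha hr) (hsnoc _ _ _ hS)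
    · exact exists_isSaturated S hsnoc hcons (p.cons a ha) (hp.cons ha hr) (hcons _ _ _ hS)
termination_by Module.finrank k (Q.Alg k) - l

namespace IsGlued

variable {γ : Equiv.Perm (Fin (l + 1))} (hp : p.IsGlued γ)
include hp

theorem isSaturated : p.IsSaturated where
  isFree := hp.isFree
  rel_last a ha := by
    obtain ⟨j, rfl⟩ := hp.edge_bijective.2 a
    have := j.2
    refine ⟨⟨l - 1, by omega⟩, by simp; omega, (hp.rel_iff _ _).2 ⟨?_, by simp; omega⟩⟩
    rw [← p.src_edge, ha]
    congr 1
    ext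
    simp
    omega
  rel_first a ha := by
    obtain ⟨j, rfl⟩ := hp.edge_bijective.2 a
    have := j.2
    refine ⟨⟨0, by omega⟩, rfl, (hp.rel_iff _ _).2 ⟨?_, by simp⟩⟩
    rw [← p.tgt_edge, ha]
    rfl

theorem val_eq_of_not_rel {i j : Fin l} (h : Q.tgt (p.edge i) = Q.src (p.edge j))
    (hr : ¬ Q.rel (p.edge i) (p.edge j)) : j.val = i.val + 1 := by
  by_contra h'
  exact hr ((hp.rel_iff i j).2 ⟨by rw [← p.tgt_edge, h, p.src_edge], h'⟩)

/-- Arrows of `q` occupy consecutive positions of `p`, and saturation forces the first and last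
positions to be those of `p`. A trivial path is not saturated, as every vertex meets an arrow when
`l ≠ 0`. -/
theorem eq_of_isSaturated (hl : l ≠ 0) {m : ℕ} {q : Q.Path m} (hq : q.IsSaturated) :
    (⟨m, q⟩ : Σ l, Q.Path l) = ⟨l, p⟩ := by
  obtain _ | m := m
  · exfalso
    obtain ⟨i, hi⟩ := hp.vertex_surjective (q.vertex 0)
    induction i using Fin.lastCases with
    | last =>
      obtain ⟨l, rfl⟩ := Nat.exists_eq_succ_of_ne_zero hl
      obtain ⟨s, -⟩ := hq.rel_first (p.edge (Fin.last l)) (by rw [p.tgt_edge, Fin.succ_last, hi])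
      exact s.elim0
    | cast s =>
      obtain ⟨s, -⟩ := hq.rel_last (p.edge s) (by rw [p.src_edge, hi]; rfl)
      exact s.elim0
  choose σ hσ using fun t => hp.edge_bijective.2 (q.edge t)
  have hstep : ∀ s t : Fin (m + 1), t.val = s.val + 1 → (σ t).val = (σ s).val + 1 := by
    intro s t hst
    refine hp.val_eq_of_not_rel ?_ ?_
    · rw [hσ, hσ, q.tgt_edge, q.src_edge]
      congr 1
      exact Fin.ext hst.symm
    · rw [hσ, hσ]
      exact hq.isFree s t hst
  have h0 : (σ 0).val = 0 := by
    by_contra h0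
    obtain ⟨s, hs, hr⟩ := hq.rel_first (p.edge ⟨(σ 0).val - 1, by omega⟩) (by
      have : q.vertex 0 = Q.src (q.edge 0) := (q.src_edge 0).symm
      rw [this, ← hσ, p.tgt_edge, p.src_edge]
      congr 1
      ext
      simp
      omega)
    obtain rfl : s = 0 := Fin.ext hs
    rw [← hσ] at hr
    exact ((hp.rel_iff _ _).1 hr).2 (by simp; omega)
  have hval : ∀ t, (σ t).val = t.val := by
    intro t
    induction t using Fin.induction with
    | zero => exact h0
    | succ t ih => rw [hstep t.castSucc t.succ (by simp), ih]; simp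
  have hm : m + 1 = l := by
    have h1 := hval (Fin.last m)
    have h2 := (σ (Fin.last m)).2
    rw [Fin.val_last] at h1
    by_contra hne
    obtain ⟨s, hs, hr⟩ := hq.rel_last (p.edge ⟨m + 1, by omega⟩) (by
      rw [← Fin.succ_last, ← q.tgt_edge, ← hσ, p.tgt_edge, p.src_edge]
      congr 1
      ext
      simpa using h1.symm)
    obtain rfl : s = Fin.last m := Fin.ext (by simpa using hs)
    rw [← hσ] at hr
    exact ((hp.rel_iff _ _).1 hr).2 (by simpa using h1.symm)
  subst hm
  congr 1
  refine ext_edge hl fun s => ?_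
  rw [← hσ]
  congr 1
  exact Fin.ext (hval s)

theorem hasOneMaximalPath (hl : l ≠ 0) : Q.HasOneMaximalPath k :=
  ⟨⟨l, p⟩, isMaximal_iff_isSaturated.2 hp.isSaturated, fun _ hq =>
    hp.eq_of_isSaturated hl (isMaximal_iff_isSaturated.1 hq)⟩

theorem gluingDatum : Q.GluingDatum k γ :=
  ⟨l, rfl, p, isMaximal_iff_isSaturated.2 hp.isSaturated, fun i j => hp.vertex_eq i j⟩

theorem ncard_le_two (f : Fin l → Fin (l + 1)) (hf : Function.Injective f) (v : Q.V) :
    {a | p.vertex (f ((Equiv.ofBijective _ hp.edge_bijective).symm a)) = v}.ncard ≤ 2 := by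
  obtain ⟨i, rfl⟩ := hp.vertex_surjective v
  refine (Set.ncard_le_ncard_of_injOn
    (fun a => f ((Equiv.ofBijective _ hp.edge_bijective).symm a)) (t := {i, γ i})
    (fun a ha => ?_) ((hf.comp (Equiv.injective _)).injOn)).trans ?_
  · exact (hp.vertex_eq _ _).1 (Eq.symm ha)
  · exact Set.ncard_insert_le _ _ |>.trans (by simp)

theorem isGentle : Q.IsGentle k where
  out_le v := by
    convert hp.ncard_le_two Fin.castSucc (Fin.castSucc_injective l) v using 5 with a
    rw [← p.src_edge]
    exact congrArg Q.src (Equiv.ofBijective_apply_symm_apply _ hp.edge_bijective a).symm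
  in_le v := by
    convert hp.ncard_le_two Fin.succ (Fin.succ_injective l) v using 5 with a
    rw [← p.tgt_edge]
    exact congrArg Q.tgt (Equiv.ofBijective_apply_symm_apply _ hp.edge_bijective a).symm
  rel_right a b b' h h' := by
    obtain ⟨i, rfl⟩ := hp.edge_bijective.2 a
    obtain ⟨j, rfl⟩ := hp.edge_bijective.2 b
    obtain ⟨j', rfl⟩ := hp.edge_bijective.2 b'
    rw [hp.rel_iff, hp.vertex_eq] at h h'
    have key : ∀ j : Fin l, (j.castSucc = i.succ ∨ j.castSucc = γ i.succ) ∧ j.val ≠ i.val + 1 →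
        j.castSucc = γ i.succ := fun j hj => hj.1.resolve_left fun h' => hj.2 (by
      simpa using congrArg Fin.val h')
    rw [Fin.castSucc_injective l ((key j h).trans (key j' h').symm)]
  rel_left a c c' h h' := by
    obtain ⟨i, rfl⟩ := hp.edge_bijective.2 a
    obtain ⟨j, rfl⟩ := hp.edge_bijective.2 c
    obtain ⟨j', rfl⟩ := hp.edge_bijective.2 c'
    rw [hp.rel_iff, hp.vertex_eq] at h h'
    have key : ∀ j : Fin l, (i.castSucc = j.succ ∨ i.castSucc = γ j.succ) ∧ i.val ≠ j.val + 1 →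
        i.castSucc = γ j.succ := fun j hj => hj.1.resolve_left fun h' => hj.2 (by
      simpa using congrArg Fin.val h')
    rw [Fin.succ_injective l (γ.injective ((key j h).symm.trans (key j' h')))]
  nonrel_right a b b' h hr h' hr' := by
    obtain ⟨i, rfl⟩ := hp.edge_bijective.2 a
    obtain ⟨j, rfl⟩ := hp.edge_bijective.2 b
    obtain ⟨j', rfl⟩ := hp.edge_bijective.2 b'
    rw [Fin.ext ((hp.val_eq_of_not_rel h hr).trans (hp.val_eq_of_not_rel h' hr').symm)]
  nonrel_left a c c' h hr h' hr' := by
    obtain ⟨i, rfl⟩ := hp.edge_bijective.2 a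
    obtain ⟨j, rfl⟩ := hp.edge_bijective.2 c
    obtain ⟨j', rfl⟩ := hp.edge_bijective.2 c'
    have h1 := (hp.val_eq_of_not_rel h hr).symm.trans (hp.val_eq_of_not_rel h' hr')
    rw [Fin.ext (Nat.succ_injective h1)]
  finite := hp.finite

theorem arrowIdeal_eq_radical :
    Q.arrowIdeal k = (hp.isGluedModel (k := k)).radical := by
  apply le_antisymm
  · rw [arrowIdeal, Submodule.span_le]
    rintro _ ⟨x, a, rfl⟩
    obtain ⟨s, rfl⟩ := hp.edge_bijective.2 a
    refine IsGluedModel.mul_mem_radical _ _ fun i => ?_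
    rw [rep_arrow, Matrix.single_apply, if_neg]
    rintro ⟨rfl, h⟩
    exact (Fin.castSucc_lt_succ (i := s)).ne' h
  · intro a ha
    obtain ⟨c, b, rfl⟩ := hp.exists_eq_sum a
    have hc : ∀ v, c v = 0 := by
      intro v
      obtain ⟨i, rfl⟩ := hp.vertex_surjective v
      rw [← hp.rep_sum_diag c b, ha]
    simp only [hc, zero_smul, Finset.sum_const_zero, zero_add]
    refine Submodule.sum_mem _ fun x _ => ?_
    obtain ⟨y, hy⟩ := p.segment_eq_mul_arrow (k := k) x.1 x.2
    rw [hy]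
    exact Submodule.subset_span ⟨b x • y, _, (smul_mul_assoc _ _ _).symm⟩

end IsGlued

end Path

/-- The maximal path of a gentle bound quiver with one maximal path traverses every vertex and,
exactly once, every arrow. -/
theorem IsGentle.isGlued (hQ : Q.IsGentle k) (h : Q.HasOneMaximalPath k) {l : ℕ}
    {α : Equiv.Perm (Fin (l + 1))} (hα : Q.GluingDatum k α) :
    ∃ p : Q.Path l, p.IsGlued α := by
  obtain ⟨m, hm, p, hp, hv⟩ := hα
  obtain rfl : l = m := Nat.succ_injective hm
  have hfin := hQ.finite
  have hs := Path.isMaximal_iff_isSaturated.1 hp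
  have huniq : ∀ {n : ℕ} (q : Q.Path n), q.IsSaturated →
      (⟨n, q⟩ : Σ l, Q.Path l) = ⟨l, p⟩ := fun q hq =>
    h.unique (y₁ := ⟨_, q⟩) (y₂ := ⟨_, p⟩) (Path.isMaximal_iff_isSaturated.2 hq) hp
  have hedge : Function.Surjective p.edge := by
    intro a
    let q : Q.Path 1 :=
      { vertex := ![Q.src a, Q.tgt a]
        edge := fun _ => a
        src_edge := fun i => by fin_cases i; rfl
        tgt_edge := fun i => by fin_cases i; rfl }
    -- Prolonging the path that consists of the arrow `a` gives a maximal path through `a`, which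
    -- can only be `p`.
    obtain ⟨n, q', hq', s, hs⟩ := Path.exists_isSaturated k
      (fun l p => ∃ s : Fin l, p.edge s = a)
      (fun p b hb ⟨s, hs⟩ => ⟨s.castSucc, (Fin.snoc_castSucc (α := fun _ => Q.E) _ _ s).trans hs⟩)
      (fun p b hb ⟨s, hs⟩ => ⟨s.succ, hs⟩) q (fun s t hst => by omega) ⟨0, rfl⟩
    cases huniq q' hq'
    exact ⟨s, hs⟩
  have hvert : Function.Surjective p.vertex := by
    intro v
    let q : Q.Path 0 :=
      { vertex := fun _ => v
        edge := fun i => i.elim0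
        src_edge := fun i => i.elim0
        tgt_edge := fun i => i.elim0 }
    obtain ⟨n, q', hq', s, hs⟩ := Path.exists_isSaturated k
      (fun l p => ∃ s : Fin (l + 1), p.vertex s = v)
      (fun p b hb ⟨s, hs⟩ => ⟨s.castSucc, (Fin.snoc_castSucc (α := fun _ => Q.V) _ _ s).trans hs⟩)
      (fun p b hb ⟨s, hs⟩ => ⟨s.succ, hs⟩) q (fun s => s.elim0) ⟨0, rfl⟩
    cases huniq q' hq'
    exact ⟨s, hs⟩
  have hcomp : ∀ s t : Fin l, t.val = s.val + 1 → Q.tgt (p.edge s) = Q.src (p.edge t) := by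
    intro s t hst
    rw [p.tgt_edge, p.src_edge]
    congr 1
    exact Fin.ext hst.symm
  have hinj : Function.Injective p.edge := by
    -- A repeated arrow has a unique continuation without relation, so the repetition spreads to the
    -- right; `n` counts the arrows after `t`.
    have key : ∀ (n : ℕ) (s t : Fin l), t.val + n + 1 = l → s < t → p.edge s ≠ p.edge t := by
      intro n
      induction n with
      | zero =>
        intro s t ht hst he
        rw [Fin.lt_def] at hst
        have hc := hcomp s ⟨s.val + 1, by omega⟩ rfl
        -- Here `t` is the last position, so saturation makes the arrow after `s` a relation with
        -- `edge t = edge s`, against freeness of `p`.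
        obtain ⟨r, hr, hr'⟩ := hs.rel_last (p.edge ⟨s.val + 1, by omega⟩) (by
          rw [← hc, he, p.tgt_edge]
          congr 1
          exact Fin.ext ht)
        obtain rfl : r = t := Fin.ext (by omega)
        rw [← he] at hr'
        exact hs.isFree s ⟨s.val + 1, by omega⟩ rfl hr'
      | succ n ih =>
        intro s t ht hst he
        rw [Fin.lt_def] at hst
        refine ih ⟨s.val + 1, by omega⟩ ⟨t.val + 1, by omega⟩ (by simp; omega)
          (Fin.lt_def.2 (by simpa using hst)) (hQ.nonrel_right (p.edge s) _ _ (hcomp _ _ rfl)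
            (hs.isFree _ _ rfl) ?_ ?_)
        · rw [he]
          exact hcomp _ _ rfl
        · rw [he]
          exact hs.isFree _ _ rfl
    intro s t hst
    rcases lt_trichotomy s t with h' | h' | h'
    · exact absurd hst (key (l - 1 - t.val) s t (by omega) h')
    · exact h'
    · exact absurd hst.symm (key (l - 1 - s.val) t s (by omega) h')
  refine ⟨p, ⟨hinj, hedge⟩, hvert, hv, fun i j => ⟨fun hr => ⟨?_, fun hij => ?_⟩, ?_⟩⟩
  · rw [← p.tgt_edge, Q.rel_composable _ _ hr, p.src_edge]
  · exact hs.isFree i j hij hr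
  · rintro ⟨hij, hne⟩
    have hc : Q.tgt (p.edge i) = Q.src (p.edge j) := by rw [p.tgt_edge, p.src_edge, hij]
    -- Before the last arrow, the continuation without relation is already taken by `edge (i + 1)`;
    -- after it, saturation supplies the relation.
    rcases Nat.lt_or_ge (i.val + 1) l with hi | hi
    · by_contra hr
      have := hQ.nonrel_right _ _ (p.edge ⟨i.val + 1, hi⟩) hc hr (hcomp _ _ rfl)
        (hs.isFree _ _ rfl)
      exact hne (congrArg Fin.val (hinj this))
    · obtain ⟨r, hr, hr'⟩ := hs.rel_last (p.edge j) (by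
        rw [← hc, p.tgt_edge]
        congr 1
        ext
        simp
        omega)
      obtain rfl : r = i := Fin.ext (by omega)
      exact hr'

end BoundQuiver

/-! ### The bound quiver of a quasi-diagram as a glued path -/

namespace QuasiDiagram

/-- The path of the bound quiver of a quasi-diagram through all points. -/
def path {l : ℕ} (γ : Equiv.Perm (Fin (l + 1))) : (gentleQuiver γ).Path l where
  vertex i := Quotient.mk _ i
  edge s := ⟨s.castSucc, by simp⟩
  src_edge _ := rfl
  tgt_edge _ := rfl

theorem sameCycle_iff {n : ℕ} {γ : Equiv.Perm (Fin n)} (hγ : IsQuasiDiagram γ) (i j : Fin n) :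
    γ.SameCycle i j ↔ j = i ∨ j = γ i := by
  constructor
  · rintro ⟨z, rfl⟩
    rcases Int.even_or_odd' z with ⟨w, rfl | rfl⟩
    · left
      rw [zpow_mul, zpow_two, hγ, one_zpow]
      rfl
    · right
      rw [zpow_add, zpow_mul, zpow_two, hγ, one_zpow]
      rfl
  · rintro (rfl | rfl)
    · exact .refl _ _
    · exact ⟨1, by rw [zpow_one]⟩

theorem isGlued_path {l : ℕ} {γ : Equiv.Perm (Fin (l + 1))} (hγ : IsQuasiDiagram γ) :
    (path γ).IsGlued γ where
  edge_bijective := by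
    constructor
    · intro s t hst
      exact Fin.castSucc_injective _ (congrArg Subtype.val hst)
    · rintro ⟨i, hi⟩
      exact ⟨⟨i.val, by omega⟩, rfl⟩
  vertex_surjective := Quotient.mk_surjective
  vertex_eq i j := by
    rw [← sameCycle_iff hγ]
    exact Quotient.eq
  rel_iff _ _ := Iff.rfl

end QuasiDiagram

/-! ### Characterizations of maximal chord diagrams -/

theorem IsGluedModel.comp_algEquiv {k : Type u} [Field k] {n : ℕ} {γ : Equiv.Perm (Fin n)}
    {A : Type v} [Ring A] [Algebra k A] {B : Type w} [Ring B] [Algebra k B]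
    {ρ : A →ₐ[k] Matrix (Fin n) (Fin n) k} (hρ : IsGluedModel γ ρ) (e : B ≃ₐ[k] A) :
    IsGluedModel γ (ρ.comp e.toAlgHom) where
  injective := hρ.injective.comp e.injective
  mem_range M := by
    rw [← hρ.mem_range, e.surjective.exists]
    rfl

namespace BoundQuiver.Path.IsGlued

open QuasiDiagram

variable {k : Type u} [Field k] {Q : BoundQuiver} {l : ℕ} {p : Q.Path l}
  {α : Equiv.Perm (Fin (l + 1))} (hp : p.IsGlued α) (hα : IsChordDiagram α)
include hp

theorem degreeZero_eq_top : Q.degreeZero k = (hp.isGluedModel (k := k)).top := by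
  rw [degreeZero, hp.arrowIdeal_eq_radical]
  rfl

include hα

theorem nonempty_koszulDual_algEquiv (h : QuasiDiagram.IsMaximal α) {Q' : BoundQuiver} {p' : Q'.Path l}
    (hp' : p'.IsGlued (faceDual h)) : Nonempty (KoszulDual k Q ≃ₐ[k] Q'.Alg k) := by
  unfold KoszulDual
  rw [hp.degreeZero_eq_top]
  exact ⟨(((hp.isGluedModel (k := k)).koszulDatum hα h hp').yonedaEquiv hp').symm⟩

theorem isMaximal_of_finite (h : Module.Finite k (KoszulDual k Q)) :
    QuasiDiagram.IsMaximal α := by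
  by_contra hmax
  unfold KoszulDual at h
  rw [hp.degreeZero_eq_top] at h
  exact not_finite_of_ext_ne_zero
    ((hp.isGluedModel (k := k)).exists_ext_ne_zero_of_not_isMaximal hα hmax) h

end BoundQuiver.Path.IsGlued

namespace QuasiDiagram

/-! ### Rotations and regularity -/

section Rotation

variable {l : ℕ} {α : Equiv.Perm (Fin (l + 1))}

theorem finRotate_mul_rotation (z : ℤ) : finRotate (l + 1) * rotation z α =
    finRotate (l + 1) ^ z * (finRotate (l + 1) * α) * (finRotate (l + 1) ^ z)⁻¹ := by
  rw [rotation]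
  group

theorem isMaximal_rotation_iff (z : ℤ) : IsMaximal (rotation z α) ↔ IsMaximal α := by
  rw [isMaximal_iff, isMaximal_iff, finRotate_mul_rotation]
  simp only [Equiv.Perm.sameCycle_conj]
  constructor
  · intro h i j
    simpa using h ((finRotate (l + 1) ^ z) i) ((finRotate (l + 1) ^ z) j)
  · exact fun h i j => h _ _

theorem IsChordDiagram.rotation (hα : IsChordDiagram α) (z : ℤ) :
    IsChordDiagram (rotation z α) := by
  refine ⟨?_, fun i hi => hα.2 ((finRotate (l + 1) ^ (-z)) i) ?_⟩
  · have : α * α = 1 := hα.1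
    rw [IsQuasiDiagram, QuasiDiagram.rotation]
    calc _ = finRotate (l + 1) ^ z * (α * α) * finRotate (l + 1) ^ (-z) := by group
      _ = 1 := by rw [this]; group
  · have : (finRotate (l + 1) ^ z * α * finRotate (l + 1) ^ (-z)) i = i := hi
    rw [IsIsolated]
    conv_rhs => rw [← this]
    simp

/-- Without isolated points, regularity forces every orbit to contain `0`. -/
theorem isRegular_iff_isMaximal (hα : IsChordDiagram α) : IsRegular α ↔ IsMaximal α := by
  rw [isMaximal_iff]
  constructor
  · intro h
    have h0 : ∀ i, (finRotate (l + 1) * α).SameCycle i 0 := fun i => by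
      obtain ⟨j, hj, hj'⟩ := h i
      rwa [← show j = 0 from Fin.ext (hj'.resolve_right (hα.2 j))]
    exact fun i j => (h0 i).trans (h0 j).symm
  · exact fun h i => ⟨0, h i 0, Or.inl rfl⟩

theorem isRotatablyRegular_iff_isMaximal (hα : IsChordDiagram α) :
    IsRotatablyRegular α ↔ IsMaximal α := by
  simp only [IsRotatablyRegular, isRegular_iff_isMaximal (hα.rotation _), isMaximal_rotation_iff,
    forall_const]

end Rotation

variable (k : Type u) [Field k] {l : ℕ} {α : Equiv.Perm (Fin (l + 1))}

theorem IsChordDiagram.ne_zero (hα : IsChordDiagram α) : l ≠ 0 := by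
  rintro rfl
  exact hα.2 0 (Fin.ext (by omega))

theorem isKoszulDual_of_isMaximal {β γ : Equiv.Perm (Fin (l + 1))} (hβ : IsChordDiagram β)
    (h : IsMaximal β) (hγ : faceDual h = γ) : IsKoszulDual k β γ := by
  subst hγ
  have hγ := isChordDiagram_faceDual h hβ
  have hp := isGlued_path hγ.1
  exact ⟨gentleQuiver (faceDual h), hp.isGentle, hp.hasOneMaximalPath hγ.ne_zero, hp.gluingDatum,
    (isGlued_path hβ.1).nonempty_koszulDual_algEquiv hβ h hp⟩

theorem koszulDualExists_iff_isMaximal (hα : IsChordDiagram α) :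
    KoszulDualExists k α ↔ IsMaximal α := by
  constructor
  · rintro ⟨Q, hQ, -, ⟨e⟩⟩
    have := hQ.finite
    exact (isGlued_path hα.1).isMaximal_of_finite hα (Module.Finite.equiv e.symm.toLinearEquiv)
  · intro h
    obtain ⟨Q, hQ, hQ', -, he⟩ := isKoszulDual_of_isMaximal k hα h rfl
    exact ⟨Q, hQ, hQ', he⟩

/-- No comparison of `α` with `faceDual h` is needed: both glue the same algebra, whose global
dimension detects the maximality of either. -/
theorem isMaximal_of_isKoszulDual {β : Equiv.Perm (Fin (l + 1))} (hα : IsChordDiagram α)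
    (hβ : IsChordDiagram β) (h : IsMaximal β) (hβα : IsKoszulDual k β α) : IsMaximal α := by
  obtain ⟨Q, hQ, hQ', hd, ⟨e⟩⟩ := hβα
  obtain ⟨p, hp⟩ := hQ.isGlued hQ' hd
  have hγ := isChordDiagram_faceDual h hβ
  have hp' := isGlued_path hγ.1
  obtain ⟨e'⟩ := (isGlued_path hβ.1).nonempty_koszulDual_algEquiv (k := k) hβ h hp'
  -- This is a second glued model of `Q.Alg k`, transported from the algebra of the face dual of
  -- `β`.
  have hρ := (hp'.isGluedModel (k := k)).comp_algEquiv (e.symm.trans e')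
  exact ((hp.isGluedModel (k := k)).globalDimension_eq_iff hα hα.ne_zero).1
    ((hρ.globalDimension_eq_iff hγ hα.ne_zero).2 (isMaximal_faceDual h hβ.1))

theorem exists_isKoszulDual_iff_isMaximal (hα : IsChordDiagram α) :
    (∃ β : Equiv.Perm (Fin (l + 1)), IsChordDiagram β ∧ IsMaximal β ∧ IsKoszulDual k β α) ↔
      IsMaximal α := by
  constructor
  · rintro ⟨β, hβ, h, hβα⟩
    exact isMaximal_of_isKoszulDual k hα hβ h hβα
  · intro h
    exact ⟨faceDual h, isChordDiagram_faceDual h hα, isMaximal_faceDual h hα.1,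
      isKoszulDual_of_isMaximal k (isChordDiagram_faceDual h hα) (isMaximal_faceDual h hα.1)
        (faceDual_faceDual h hα.1 _)⟩

theorem globalDimension_eq_iff_isMaximal (hα : IsChordDiagram α) :
    globalDimension (GentleAlgebra k α) = (l : WithBot ℕ∞) ↔ IsMaximal α :=
  ((isGlued_path hα.1).isGluedModel (k := k)).globalDimension_eq_iff hα hα.ne_zero

theorem tfae_isMaximal (hα : IsChordDiagram α) :
    List.TFAE
      [IsMaximal α,
        IsRegular α,
        IsRotatablyRegular α,
        ∀ z : ℤ, IsMaximal (rotation z α),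
        KoszulDualExists k α,
        ∃ β : Equiv.Perm (Fin (l + 1)), IsChordDiagram β ∧ IsMaximal β ∧ IsKoszulDual k β α,
        globalDimension (GentleAlgebra k α) = (l : WithBot ℕ∞)] := by
  tfae_have 2 ↔ 1 := isRegular_iff_isMaximal hα
  tfae_have 3 ↔ 1 := isRotatablyRegular_iff_isMaximal hα
  tfae_have 4 ↔ 1 := by simp only [isMaximal_rotation_iff, forall_const]
  tfae_have 5 ↔ 1 := koszulDualExists_iff_isMaximal k hα
  tfae_have 6 ↔ 1 := exists_isKoszulDual_iff_isMaximal k hα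
  tfae_have 7 ↔ 1 := globalDimension_eq_iff_isMaximal k hα
  tfae_finish

end QuasiDiagram

end

theorem proposition6p2 (k : Type*) [Field k] (m : ℕ) (hm : 0 < m)
    (α : Equiv.Perm (Fin (2 * m))) (hα : QuasiDiagram.IsChordDiagram α) :
    List.TFAE
      [QuasiDiagram.IsMaximal α,
        QuasiDiagram.IsRegular α,
        QuasiDiagram.IsRotatablyRegular α,
        ∀ l : ℤ, QuasiDiagram.IsMaximal (QuasiDiagram.rotation l α),
        QuasiDiagram.KoszulDualExists k α,
        ∃ β : Equiv.Perm (Fin (2 * m)), QuasiDiagram.IsChordDiagram β ∧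
          QuasiDiagram.IsMaximal β ∧ QuasiDiagram.IsKoszulDual k β α,
        globalDimension (QuasiDiagram.GentleAlgebra k α) = ((2 * m - 1 : ℕ) : WithBot ℕ∞)] ∧
    (QuasiDiagram.IsMaximal α → Even m) := by
  revert α
  -- The preceding results concern `Fin (l + 1)`; `m` remains only in `hn`, for the parity claim.
  generalize hn : 2 * m = n
  intro α hα
  obtain ⟨l, rfl⟩ : ∃ l, n = l + 1 := ⟨n - 1, by omega⟩
  exact ⟨QuasiDiagram.tfae_isMaximal k hα, QuasiDiagram.even_of_isMaximal hn.symm hα⟩
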